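/- Work over $\mathbb C$ and let $k,l\ge 1$. Let $B(k|l)=\mathfrak{osp}(2k+1|2l)$ and $D(k|l)=\mathfrak{osp}(2k|2l)$, with the Cartan subalgebra of diagonal matrices (the form being chosen so that basis vectors are paired with opposite weights) and the usual weights $\varepsilon_1,\dots,\varepsilon_k,\delta_1,\dots,\delta_l$; the standard modules $V^B_{st}=\mathbb C^{2k+1|2l}$ and $V^D_{st}=\mathbb C^{2k|2l}$ have even weights $\pm\varepsilon_i$ (and $0$ for $B$) and odd weights $\pm\delta_g$. For $B(k|l)$ take the simple roots $\varepsilon_1-\delta_1,\ \delta_1-\varepsilon_2,\ \varepsilon_2-\varepsilon_3,\dots,\varepsilon_{k-1}-\varepsilon_k,\ \varepsilon_k-\delta_2,\ \delta_2-\delta_3,\dots,\delta_{l-1}-\delta_l,\ \delta_l$, i.e. the consecutive differences of the list $\varepsilon_1,\delta_1,\varepsilon_2,\dots,\varepsilon_k,\delta_2,\dots,\delta_l$ together with its last member; for $D(k|l)$ take $\varepsilon_1-\varepsilon_2,\dots,\varepsilon_{k-1}-\varepsilon_k,\ \varepsilon_k-\delta_1,\ \delta_1-\delta_2,\dots,\delta_{l-1}-\delta_l,\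 2\delta_l$. Let $L_B(\lambda)$, $L_D(\lambda)$ be the simple module with highest weight $\lambda$ and even highest weight vector, let $\mathrm{triv}$ be the one-dimensional even trivial module, let $\Pi$ be the parity shift, and let $S^2$ be the symmetric square in the super sense. Isomorphisms are even. For a module $V$ that is the direct sum of finite-dimensional weight spaces put $\mathrm{ch}\,V=\sum_\alpha(\dim V_\alpha)e^\alpha$. Below $1\le i\ne j\le k$ and $1\le g\neq h\le l$ (with $i$, $g$ arbitrary in the terms that do not involve $j$, $h$), and all signs are independent. 1. $V^B_{st}=L_B(\varepsilon_1)$, and $$\mathrm{ch}\,S^2(V_{st}^B)=(k+l+1)e^0+\sum_{\alpha\in\Omega_B'}e^\alpha,\qquad \Omega'_B=\{\underbrace{\pm\varepsilon_i\pm\varepsilon_j;\ \pm\varepsilon_i;\ \pm\delta_g\pm\delta_h;\ \pm2\varepsilon_i}_{\text{even}};\ \underbrace{\pm\delta_g;\ \pm\varepsilon_i\pm\delta_g}_{\text{odd}}\},$$ where the weight space of weight $0$ is even. The module $L_B(2\varepsilon_1)$ exists and $S^2(V_{st}^B)\cong L_B(2\varepsilon_1)\oplus\mathrm{triv}$. 2.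 $V^D_{st}=L_D(\varepsilon_1)$, and $$\mathrm{ch}\,S^2(V_{st}^D)=(k+l)e^0+\sum_{\alpha\in\Omega_D'}e^\alpha,\qquad \Omega'_D=\{\underbrace{\pm\varepsilon_i\pm\varepsilon_j;\ \pm\delta_g\pm\delta_h;\ \pm2\varepsilon_i}_{\text{even}};\ \underbrace{\pm\varepsilon_i\pm\delta_g}_{\text{odd}}\},$$ where the weight space of weight $0$ is even. The module $L_D(2\varepsilon_1)$ exists and, if $k\ne l$, then $S^2(V_{st}^D)\cong L_D(2\varepsilon_1)\oplus\mathrm{triv}$. 3. Let $V$ be a $B(k|l)$-module that is the direct sum of finite-dimensional weight spaces with $\mathrm{ch}\,V=\mathrm{ch}\,S^2(V^B_{st})$. Then $V\cong \Pi^{s}L_B(2\varepsilon_1)\oplus\Pi^{t}\mathrm{triv}$ for some $s,t\in\{0,1\}$; if moreover the even and the odd parts of all weight spaces of $V$ have the same dimensions as those of $S^2(V_{st}^B)$, then $V\cong L_B(2\varepsilon_1)\oplus\mathrm{triv}$. If $k\ne l$, the same holds for $D(k|l)$ with $V^D_{st}$ and $L_D(2\varepsilon_1)$. -/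

import Mathlib

open scoped TensorProduct

noncomputable section

namespace Super

/-- The sign `(-1)^{pq}`. -/
def sgn (p q : ZMod 2) : ℂ := if p = 1 ∧ q = 1 then -1 else 1

theorem zmod2_cases (p : ZMod 2) : p = 0 ∨ p = 1 := by
  revert p; decide

theorem sgn_comm (p q : ZMod 2) : sgn p q = sgn q p := by
  simp only [sgn, and_comm]

theorem sgn_mul_self (p q : ZMod 2) : sgn p q * sgn p q = 1 := by
  unfold sgn; split_ifs <;> norm_num

theorem sgn_add_left (p q r : ZMod 2) : sgn (p + q) r = sgn p r * sgn q r := by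
  have h1 : (1 : ZMod 2) + 1 = 0 := by decide
  rcases zmod2_cases p with rfl | rfl <;> rcases zmod2_cases q with rfl | rfl <;>
    rcases zmod2_cases r with rfl | rfl <;> simp [sgn, h1]

theorem sgn_add_right (p q r : ZMod 2) : sgn p (q + r) = sgn p q * sgn p r := by
  rw [sgn_comm, sgn_add_left, sgn_comm q, sgn_comm r]

/-- A `ℤ/2`-grading `V = V₀ ⊕ V₁` of a complex vector space, given by the two projections
onto its homogeneous components. -/
structure Grading (V : Type*) [AddCommGroup V] [Module ℂ V] where
  proj : ZMod 2 → V →ₗ[ℂ] V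
  proj_add : ∀ v, proj 0 v + proj 1 v = v
  proj_proj : ∀ p q v, proj p (proj q v) = if p = q then proj q v else 0

namespace Grading

variable {V W : Type*} [AddCommGroup V] [Module ℂ V] [AddCommGroup W] [Module ℂ W]

/-- The homogeneous component of parity `p`. -/
def part (G : Grading V) (p : ZMod 2) : Submodule ℂ V := LinearMap.eqLocus (G.proj p) LinearMap.id

theorem mem_part {G : Grading V} {p : ZMod 2} {v : V} : v ∈ G.part p ↔ G.proj p v = v := by
  simp [part]

theorem proj_mem (G : Grading V) (p : ZMod 2) (v : V) : G.proj p v ∈ G.part p := by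
  rw [mem_part, G.proj_proj, if_pos rfl]

theorem proj_of_mem {G : Grading V} {p : ZMod 2} {v : V} (h : v ∈ G.part p) (q : ZMod 2) :
    G.proj q v = if q = p then v else 0 := by
  rw [mem_part] at h
  conv_lhs => rw [← h]
  rw [G.proj_proj, h]

theorem isCompl (G : Grading V) : IsCompl (G.part 0) (G.part 1) := by
  constructor
  · rw [Submodule.disjoint_def]
    intro v h0 h1
    have := proj_of_mem h1 0
    rw [mem_part.1 h0] at this
    simpa using this
  · rw [codisjoint_iff, eq_top_iff]
    intro v _
    rw [← G.proj_add v]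
    exact Submodule.add_mem_sup (G.proj_mem 0 v) (G.proj_mem 1 v)

theorem induction (G : Grading V) {P : V → Prop} (hadd : ∀ v w, P v → P w → P (v + w))
    (h : ∀ p, ∀ v ∈ G.part p, P v) (v : V) : P v := by
  rw [← G.proj_add v]
  exact hadd _ _ (h 0 _ (G.proj_mem 0 v)) (h 1 _ (G.proj_mem 1 v))

/-- `(V ⊗ W)_r = ⨁_{p+q=r} V_p ⊗ W_q`. -/
def tensor (G : Grading V) (H : Grading W) : Grading (V ⊗[ℂ] W) where
  proj r := ∑ p, TensorProduct.map (G.proj p) (H.proj (r - p))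
  proj_add t := by
    have h1 : (0 : ZMod 2) - 1 = 1 := by decide
    have hu : (Finset.univ : Finset (ZMod 2)) = {0, 1} := by decide
    induction t with
    | zero => simp
    | add x y hx hy =>
      rw [map_add, map_add]
      conv_rhs => rw [← hx, ← hy]
      abel
    | tmul v w =>
      conv_rhs => rw [← G.proj_add v, ← H.proj_add w]
      simp only [hu, Finset.sum_insert, Finset.mem_singleton, Finset.sum_singleton, zero_ne_one,
        not_false_eq_true, LinearMap.add_apply, TensorProduct.map_tmul, h1, sub_self, sub_zero,
        TensorProduct.add_tmul, TensorProduct.tmul_add]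
      abel
  proj_proj r s t := by
    have h1 : (0 : ZMod 2) - 1 = 1 := by decide
    have hu : (Finset.univ : Finset (ZMod 2)) = {0, 1} := by decide
    induction t with
    | zero => simp
    | add x y hx hy =>
      rw [map_add, map_add, hx, hy]
      split_ifs <;> simp
    | tmul v w =>
      rcases zmod2_cases r with rfl | rfl <;> rcases zmod2_cases s with rfl | rfl <;>
      simp [hu, G.proj_proj, H.proj_proj]

theorem tmul_mem_tensor {G : Grading V} {H : Grading W} {p q : ZMod 2} {v : V} {w : W}
    (hv : v ∈ G.part p) (hw : w ∈ H.part q) : v ⊗ₜ[ℂ] w ∈ (G.tensor H).part (p + q) := by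
  rw [mem_part]
  simp only [tensor, LinearMap.sum_apply, TensorProduct.map_tmul, proj_of_mem hv, proj_of_mem hw]
  rw [Finset.sum_eq_single p]
  · simp
  · intro b _ hb; simp [hb]
  · simp

theorem tensor_induction (G : Grading V) (H : Grading W) {P : V ⊗[ℂ] W → Prop}
    (hadd : ∀ s t, P s → P t → P (s + t)) (h0 : P 0)
    (h : ∀ p q, ∀ v ∈ G.part p, ∀ w ∈ H.part q, P (v ⊗ₜ w)) (t : V ⊗[ℂ] W) : P t := by
  induction t with
  | zero => exact h0
  | add x y hx hy => exact hadd _ _ hx hy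
  | tmul v w =>
    refine G.induction (P := fun v => P (v ⊗ₜ w)) ?_ ?_ v
    · intro a b ha hb
      rw [TensorProduct.add_tmul]; exact hadd _ _ ha hb
    · intro p v hv
      refine H.induction (P := fun w => P (v ⊗ₜ w)) ?_ ?_ w
      · intro a b ha hb
        rw [TensorProduct.tmul_add]; exact hadd _ _ ha hb
      · intro q w hw
        exact h p q v hv w hw

/-- The grading induced on a graded subspace. -/
def restrict (G : Grading V) (N : Submodule ℂ V) (hN : ∀ p, ∀ v ∈ N, G.proj p v ∈ N) :
    Grading N where
  proj p := (G.proj p).restrict (hN p)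
  proj_add v := Subtype.ext (G.proj_add v)
  proj_proj p q v := by
    apply Subtype.ext
    have := G.proj_proj p q v
    split_ifs at this ⊢ <;> simpa using this

theorem mem_restrict_part {G : Grading V} {N : Submodule ℂ V}
    {hN : ∀ p, ∀ v ∈ N, G.proj p v ∈ N} {p : ZMod 2} {v : N} :
    v ∈ (G.restrict N hN).part p ↔ (v : V) ∈ G.part p := by
  rw [mem_part, mem_part, Subtype.ext_iff]; rfl

/-- The super flip `v ⊗ w ↦ (-1)^{|v||w|} w ⊗ v`. -/
def flip (G : Grading V) : V ⊗[ℂ] V →ₗ[ℂ] V ⊗[ℂ] V :=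
  ∑ p, ∑ q, sgn p q •
    ((TensorProduct.comm ℂ V V).toLinearMap ∘ₗ TensorProduct.map (G.proj p) (G.proj q))

theorem flip_tmul {G : Grading V} {p q : ZMod 2} {v w : V} (hv : v ∈ G.part p)
    (hw : w ∈ G.part q) : G.flip (v ⊗ₜ w) = sgn p q • (w ⊗ₜ v) := by
  simp only [flip, LinearMap.sum_apply, LinearMap.smul_apply, LinearMap.comp_apply,
    TensorProduct.map_tmul, proj_of_mem hv, proj_of_mem hw]
  rw [Finset.sum_eq_single p]
  · rw [Finset.sum_eq_single q]
    · simp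
    · intro b _ hb; simp [hb]
    · simp
  · intro b _ hb; simp [hb]
  · simp

/-- The underlying space of the (super)symmetric square: the tensors fixed by the super flip. -/
def symSq (G : Grading V) : Submodule ℂ (V ⊗[ℂ] V) := LinearMap.eqLocus G.flip LinearMap.id

theorem mem_symSq {G : Grading V} {t : V ⊗[ℂ] V} : t ∈ G.symSq ↔ G.flip t = t := by
  simp [symSq]

end Grading

/-- A Lie superalgebra structure on a complex vector space. -/
structure LieSuperalgebra (g : Type*) [AddCommGroup g] [Module ℂ g] extends Grading g where
  bracket : g →ₗ[ℂ] g →ₗ[ℂ] g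
  bracket_mem : ∀ p q, ∀ x ∈ toGrading.part p, ∀ y ∈ toGrading.part q,
    bracket x y ∈ toGrading.part (p + q)
  skew : ∀ p q, ∀ x ∈ toGrading.part p, ∀ y ∈ toGrading.part q,
    bracket x y = -(sgn p q • bracket y x)
  jacobi : ∀ p q, ∀ x ∈ toGrading.part p, ∀ y ∈ toGrading.part q, ∀ z,
    bracket x (bracket y z) = bracket (bracket x y) z + sgn p q • bracket y (bracket x z)

/-- The Lie sub-superalgebra on a graded subspace closed under the bracket. -/
def LieSuperalgebra.restrict {g : Type*} [AddCommGroup g] [Module ℂ g] (L : LieSuperalgebra g)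
    (N : Submodule ℂ g) (hN : ∀ p, ∀ x ∈ N, L.proj p x ∈ N)
    (hb : ∀ x ∈ N, ∀ y ∈ N, L.bracket x y ∈ N) : LieSuperalgebra N where
  toGrading := L.toGrading.restrict N hN
  bracket := LinearMap.mk₂ ℂ (fun x y => ⟨L.bracket x y, hb _ x.2 _ y.2⟩)
    (fun _ _ _ => Subtype.ext (by simp)) (fun _ _ _ => Subtype.ext (by simp))
    (fun _ _ _ => Subtype.ext (by simp)) (fun _ _ _ => Subtype.ext (by simp))
  bracket_mem p q x hx y hy := by
    rw [Grading.mem_restrict_part] at *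
    exact L.bracket_mem p q _ hx _ hy
  skew p q x hx y hy := by
    rw [Grading.mem_restrict_part] at *
    exact Subtype.ext (L.skew p q _ hx _ hy)
  jacobi p q x hx y hy z := by
    rw [Grading.mem_restrict_part] at *
    exact Subtype.ext (L.jacobi p q _ hx _ hy z)

section Rep

variable {g : Type*} [AddCommGroup g] [Module ℂ g]

/-- A module over the Lie superalgebra `L` (a representation on the superspace `V`). -/
structure Rep (L : LieSuperalgebra g) (V : Type*) [AddCommGroup V] [Module ℂ V]
    extends Grading V where
  act : g →ₗ[ℂ] V →ₗ[ℂ] V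
  act_mem : ∀ p q, ∀ x ∈ L.part p, ∀ v ∈ toGrading.part q, act x v ∈ toGrading.part (p + q)
  act_bracket : ∀ p q, ∀ x ∈ L.part p, ∀ y ∈ L.part q, ∀ v,
    act (L.bracket x y) v = act x (act y v) - sgn p q • act y (act x v)

namespace Rep

variable {L : LieSuperalgebra g} {V W : Type*} [AddCommGroup V] [Module ℂ V] [AddCommGroup W]
  [Module ℂ W]

/-- Graded subspaces stable under the action. -/
def IsSubmodule (ρ : Rep L V) (N : Submodule ℂ V) : Prop :=
  (∀ p, ∀ v ∈ N, ρ.proj p v ∈ N) ∧ ∀ x, ∀ v ∈ N, ρ.act x v ∈ N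

/-- A simple module. -/
def IsSimple (ρ : Rep L V) : Prop :=
  Nontrivial V ∧ ∀ N, ρ.IsSubmodule N → N = ⊥ ∨ N = ⊤

/-- The module structure on a submodule. -/
def restrict (ρ : Rep L V) (N : Submodule ℂ V) (hN : ρ.IsSubmodule N) : Rep L N where
  toGrading := ρ.toGrading.restrict N hN.1
  act := LinearMap.mk₂ ℂ (fun x v => ⟨ρ.act x v, hN.2 x _ v.2⟩)
    (fun _ _ _ => Subtype.ext (by simp)) (fun _ _ _ => Subtype.ext (by simp))
    (fun _ _ _ => Subtype.ext (by simp)) (fun _ _ _ => Subtype.ext (by simp))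
  act_mem p q x hx v hv := by
    rw [Grading.mem_restrict_part] at *
    exact ρ.act_mem p q _ hx _ hv
  act_bracket p q x hx y hy v := Subtype.ext (ρ.act_bracket p q x hx y hy v)

/-- An even isomorphism of modules exists. -/
def IsIso (ρ : Rep L V) (σ : Rep L W) : Prop :=
  ∃ e : V ≃ₗ[ℂ] W, (∀ p v, e (ρ.proj p v) = σ.proj p (e v)) ∧ ∀ x v, e (ρ.act x v) = σ.act x (e v)

/-- The direct sum of two modules. -/
def directSum (ρ : Rep L V) (σ : Rep L W) : Rep L (V × W) where
  proj p := (ρ.proj p).prodMap (σ.proj p)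
  proj_add v := Prod.ext (ρ.proj_add v.1) (σ.proj_add v.2)
  proj_proj p q v := by
    apply Prod.ext
    · have := ρ.proj_proj p q v.1
      split_ifs at this ⊢ <;> simpa using this
    · have := σ.proj_proj p q v.2
      split_ifs at this ⊢ <;> simpa using this
  act := LinearMap.mk₂ ℂ (fun x v => (ρ.act x v.1, σ.act x v.2))
    (fun _ _ _ => by simp) (fun _ _ _ => by simp) (fun _ _ _ => by simp) (fun _ _ _ => by simp)
  act_mem p q x hx v hv := by
    rw [Grading.mem_part] at hv ⊢
    have h1 : v.1 ∈ ρ.part q := Grading.mem_part.2 (congrArg Prod.fst hv)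
    have h2 : v.2 ∈ σ.part q := Grading.mem_part.2 (congrArg Prod.snd hv)
    exact Prod.ext (Grading.mem_part.1 (ρ.act_mem p q x hx _ h1))
      (Grading.mem_part.1 (σ.act_mem p q x hx _ h2))
  act_bracket p q x hx y hy v :=
    Prod.ext (ρ.act_bracket p q x hx y hy v.1) (σ.act_bracket p q x hx y hy v.2)

/-- The trivial module: `ℂ` in even degree with the zero action. -/
def triv (L : LieSuperalgebra g) : Rep L ℂ where
  proj p := if p = 0 then LinearMap.id else 0
  proj_add v := by simp
  proj_proj p q v := by
    rcases zmod2_cases p with rfl | rfl <;> rcases zmod2_cases q with rfl | rfl <;> simp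
  act := 0
  act_mem _ _ _ _ _ _ := Submodule.zero_mem _
  act_bracket _ _ _ _ _ _ _ := by simp

/-- `ρ.shift 0` is `ρ` and `ρ.shift 1` is its parity shift `Π ρ`. -/
def shift (ρ : Rep L V) (a : ZMod 2) : Rep L V where
  proj p := ρ.proj (p + a)
  proj_add v := by
    have h1 : (1 : ZMod 2) + 1 = 0 := by decide
    rcases zmod2_cases a with rfl | rfl
    · simpa using ρ.proj_add v
    · rw [add_comm]; simpa [h1] using ρ.proj_add v
  proj_proj p q v := by
    rw [ρ.proj_proj]; simp
  act := ρ.act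
  act_mem p q x hx v hv := by
    rw [Grading.mem_part] at hv ⊢
    have := ρ.act_mem p (q + a) x hx v (Grading.mem_part.2 hv)
    rw [← add_assoc] at this
    exact Grading.mem_part.1 this
  act_bracket := ρ.act_bracket

/-- The action on a tensor product, `x (v ⊗ w) = x v ⊗ w + (-1)^{|x||v|} v ⊗ x w`. -/
def tensorAct (ρ : Rep L V) (σ : Rep L W) : g →ₗ[ℂ] V ⊗[ℂ] W →ₗ[ℂ] V ⊗[ℂ] W :=
  (TensorProduct.mapBilinear (RingHom.id ℂ) V W V W).flip LinearMap.id ∘ₗ ρ.act +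
    ∑ p, ∑ q, sgn p q •
      (TensorProduct.mapBilinear (RingHom.id ℂ) V W V W (ρ.proj q) ∘ₗ σ.act ∘ₗ L.proj p)

theorem tensorAct_tmul (ρ : Rep L V) (σ : Rep L W) {p q : ZMod 2} {x : g} (hx : x ∈ L.part p)
    {v : V} (hv : v ∈ ρ.part q) (w : W) :
    ρ.tensorAct σ x (v ⊗ₜ w) = ρ.act x v ⊗ₜ w + sgn p q • (v ⊗ₜ σ.act x w) := by
  simp only [tensorAct, LinearMap.add_apply, LinearMap.sum_apply, LinearMap.smul_apply,
    LinearMap.comp_apply, LinearMap.flip_apply, TensorProduct.mapBilinear_apply,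
    TensorProduct.map_tmul, Grading.proj_of_mem hx, Grading.proj_of_mem hv, LinearMap.id_apply]
  congr 1
  rw [Finset.sum_eq_single p]
  · rw [Finset.sum_eq_single q]
    · simp
    · intro b _ hb; simp [hb]
    · simp
  · intro b _ hb; simp [hb]
  · simp

/-- The tensor product of two modules. -/
def tensor (ρ : Rep L V) (σ : Rep L W) : Rep L (V ⊗[ℂ] W) where
  toGrading := ρ.toGrading.tensor σ.toGrading
  act := ρ.tensorAct σ
  act_mem p r x hx t ht := by
    rw [← Grading.mem_part.1 ht]
    clear ht
    refine Grading.tensor_induction ρ.toGrading σ.toGrading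
      (P := fun t => ρ.tensorAct σ x ((ρ.toGrading.tensor σ.toGrading).proj r t) ∈
        (ρ.toGrading.tensor σ.toGrading).part (p + r)) ?_ ?_ ?_ t
    · intro s t hs ht
      rw [map_add, map_add]; exact Submodule.add_mem _ hs ht
    · simp
    · intro a b v hv w hw
      rw [Grading.proj_of_mem (Grading.tmul_mem_tensor hv hw)]
      split_ifs with h
      · rw [tensorAct_tmul ρ σ hx hv, h]
        refine Submodule.add_mem _ ?_ (Submodule.smul_mem _ _ ?_)
        · rw [← add_assoc]
          exact Grading.tmul_mem_tensor (ρ.act_mem _ _ _ hx _ hv) hw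
        · rw [add_left_comm]
          exact Grading.tmul_mem_tensor hv (σ.act_mem _ _ _ hx _ hw)
      · simp
  act_bracket p q x hx y hy t := by
    refine Grading.tensor_induction ρ.toGrading σ.toGrading
      (P := fun t => ρ.tensorAct σ (L.bracket x y) t = ρ.tensorAct σ x (ρ.tensorAct σ y t) -
        sgn p q • ρ.tensorAct σ y (ρ.tensorAct σ x t)) ?_ ?_ ?_ t
    · intro s t hs ht
      simp only [map_add, hs, ht, smul_add]; abel
    · simp
    · intro a b v hv w hw
      rw [tensorAct_tmul ρ σ (L.bracket_mem p q x hx y hy) hv, tensorAct_tmul ρ σ hx hv,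
        tensorAct_tmul ρ σ hy hv, map_add, map_add, map_smul, map_smul,
        tensorAct_tmul ρ σ hx (ρ.act_mem q a y hy v hv),
        tensorAct_tmul ρ σ hy (ρ.act_mem p a x hx v hv),
        tensorAct_tmul ρ σ hx hv, tensorAct_tmul ρ σ hy hv,
        ρ.act_bracket p q x hx y hy, σ.act_bracket p q x hx y hy,
        sgn_add_left, sgn_add_right, sgn_add_right, sgn_comm q p]
      simp only [TensorProduct.sub_tmul, TensorProduct.tmul_sub, ← TensorProduct.smul_tmul',
        TensorProduct.tmul_smul, smul_add, smul_sub, smul_smul]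
      have h := sgn_mul_self p q
      match_scalars <;> first
        | ring1
        | linear_combination h
        | linear_combination (-1 : ℂ) * h
        | linear_combination (sgn p a * sgn q a) * h
        | linear_combination (sgn p a) * h
        | linear_combination (sgn q a) * h

theorem symSq_isSubmodule (ρ : Rep L V) : (ρ.tensor ρ).IsSubmodule ρ.symSq := by
  constructor
  · intro r t ht
    rw [Grading.mem_symSq] at ht ⊢
    conv_rhs => rw [← ht]
    clear ht
    refine Grading.tensor_induction ρ.toGrading ρ.toGrading
      (P := fun t => ρ.flip ((ρ.tensor ρ).proj r t) = (ρ.tensor ρ).proj r (ρ.flip t)) ?_ ?_ ?_ t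
    · intro s t hs ht
      simp only [map_add, hs, ht]
    · simp
    · intro a b v hv w hw
      have h1 := Grading.proj_of_mem (Grading.tmul_mem_tensor hv hw) r
      have h2 := Grading.proj_of_mem (Grading.tmul_mem_tensor hw hv) r
      have e : (ρ.tensor ρ).proj = (ρ.toGrading.tensor ρ.toGrading).proj := rfl
      rw [Grading.flip_tmul hv hw, map_smul, e, h1, h2, add_comm b a]
      split_ifs
      · rw [Grading.flip_tmul hv hw]
      · simp
  · intro x t ht
    rw [Grading.mem_symSq] at ht ⊢
    conv_rhs => rw [← ht]
    clear ht
    refine L.toGrading.induction (P := fun x => ρ.flip ((ρ.tensor ρ).act x t) =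
      (ρ.tensor ρ).act x (ρ.flip t)) ?_ ?_ x
    · intro x y hx hy
      simp only [map_add, LinearMap.add_apply, hx, hy]
    · intro p x hx
      refine Grading.tensor_induction ρ.toGrading ρ.toGrading
        (P := fun t => ρ.flip ((ρ.tensor ρ).act x t) = (ρ.tensor ρ).act x (ρ.flip t)) ?_ ?_ ?_ t
      · intro s t hs ht
        simp only [map_add, hs, ht]
      · simp
      · intro a b v hv w hw
        have e : (ρ.tensor ρ).act = ρ.tensorAct ρ := rfl
        rw [e, Grading.flip_tmul hv hw, map_smul, tensorAct_tmul ρ ρ hx hv,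
          tensorAct_tmul ρ ρ hx hw, map_add, map_smul,
          Grading.flip_tmul (ρ.act_mem p a x hx v hv) hw,
          Grading.flip_tmul hv (ρ.act_mem p b x hx w hw), sgn_add_left, sgn_add_right,
          sgn_comm a p, smul_add, smul_smul, smul_smul, ← mul_assoc, sgn_mul_self, one_mul,
          add_comm, mul_comm (sgn p b)]

/-- The symmetric square `S²(V)` as a module. -/
def symSquare (ρ : Rep L V) : Rep L ρ.symSq := (ρ.tensor ρ).restrict ρ.symSq ρ.symSq_isSubmodule

/-- The space of vectors of weight `lam` with respect to the subspace `𝔥`. -/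
def weightSpace (ρ : Rep L V) (𝔥 : Submodule ℂ g) (lam : Module.Dual ℂ 𝔥) : Submodule ℂ V where
  carrier := {v | ∀ h : 𝔥, ρ.act h v = lam h • v}
  add_mem' hv hw h := by rw [map_add, hv h, hw h, smul_add]
  zero_mem' h := by simp
  smul_mem' c v hv h := by rw [map_smul, hv h, smul_comm]

/-- `V` is the sum of its weight spaces, and these are finite-dimensional, so that `V` has a
character. -/
def HasCharacter (ρ : Rep L V) (𝔥 : Submodule ℂ g) : Prop :=
  (⨆ lam, ρ.weightSpace 𝔥 lam) = ⊤ ∧ ∀ lam, FiniteDimensional ℂ (ρ.weightSpace 𝔥 lam)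

/-- The character `∑ (dim V_α) e^α`, as the function `α ↦ dim V_α`. -/
def ch (ρ : Rep L V) (𝔥 : Submodule ℂ g) : Module.Dual ℂ 𝔥 → ℕ :=
  fun lam => Module.finrank ℂ (ρ.weightSpace 𝔥 lam)

/-- The contribution of the vectors of parity `p` to the character. -/
def chPart (ρ : Rep L V) (𝔥 : Submodule ℂ g) (p : ZMod 2) : Module.Dual ℂ 𝔥 → ℕ :=
  fun lam => Module.finrank ℂ ↥(ρ.weightSpace 𝔥 lam ⊓ ρ.part p)

end Rep

/-- The subspace of `g` of vectors of weight `α` under the adjoint action of `𝔥`. -/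
def LieSuperalgebra.rootSpace (L : LieSuperalgebra g) (𝔥 : Submodule ℂ g) (α : Module.Dual ℂ 𝔥) :
    Submodule ℂ g where
  carrier := {x | ∀ h : 𝔥, L.bracket h x = α h • x}
  add_mem' hv hw h := by rw [map_add, hv h, hw h, smul_add]
  zero_mem' h := by simp
  smul_mem' c v hv h := by rw [map_smul, hv h, smul_comm]

/-- `ρ` is the simple module `L(lam)` of highest weight `lam` with respect to the base `S` of simple
roots: it is simple and contains a nonzero even vector of weight `lam` killed by the root spaces of
all positive roots, that is, of the roots that are sums of simple roots. -/
def Rep.IsSimpleOfHighestWeight {L : LieSuperalgebra g} {V : Type*} [AddCommGroup V] [Module ℂ V]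
    (ρ : Rep L V) (𝔥 : Submodule ℂ g) (S : Set (Module.Dual ℂ 𝔥)) (lam : Module.Dual ℂ 𝔥) : Prop :=
  ρ.IsSimple ∧ ∃ v ∈ ρ.weightSpace 𝔥 lam ⊓ ρ.part 0, v ≠ 0 ∧
    ∀ α ∈ AddSubmonoid.closure S, α ≠ 0 → ∀ x ∈ L.rootSpace 𝔥 α, ρ.act x v = 0

end Rep

section Matrices

variable {a b : Type*}

/-- The parity of a basis vector of `ℂ^{a|b}`. -/
def par : a ⊕ b → ZMod 2 := Sum.elim (fun _ => 0) (fun _ => 1)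

/-- The grading on `ℂ^{a|b}`. -/
def vecGrading (a b : Type*) : Grading (a ⊕ b → ℂ) where
  proj p :=
    { toFun := fun v i => if par i = p then v i else 0
      map_add' := fun v w => by ext i; simp only [Pi.add_apply]; split_ifs <;> simp
      map_smul' := fun c v => by ext i; simp }
  proj_add v := by
    ext i; cases i <;> simp [par]
  proj_proj p q v := by
    ext i
    by_cases h : p = q
    · subst h; by_cases hi : par i = p <;> simp [hi]
    · rw [if_neg h]
      simp only [LinearMap.coe_mk, AddHom.coe_mk, Pi.zero_apply]
      split_ifs with h1 h2
      · exact absurd (h1.symm.trans h2) h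
      · rfl
      · rfl

/-- The grading on `(a|b) × (a|b)` matrices: block-diagonal matrices are even, block-off-diagonal
ones are odd. -/
def matGrading (a b : Type*) : Grading (Matrix (a ⊕ b) (a ⊕ b) ℂ) where
  proj p :=
    { toFun := fun A => Matrix.of fun i j => if par i + par j = p then A i j else 0
      map_add' := fun v w => by
        ext i j; simp only [Matrix.of_apply, Matrix.add_apply]; split_ifs <;> simp
      map_smul' := fun c v => by ext i j; simp }
  proj_add v := by
    have h1 : (1 : ZMod 2) + 1 = 0 := by decide
    ext i j; cases i <;> cases j <;> simp [par, h1]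
  proj_proj p q v := by
    ext i j
    by_cases h : p = q
    · subst h; by_cases hi : par i + par j = p <;> simp [hi]
    · rw [if_neg h]
      simp only [LinearMap.coe_mk, AddHom.coe_mk, Matrix.of_apply, Matrix.zero_apply]
      split_ifs with h1 h2
      · exact absurd (h1.symm.trans h2) h
      · rfl
      · rfl

theorem mem_vecPart {p : ZMod 2} {v : a ⊕ b → ℂ} :
    v ∈ (vecGrading a b).part p ↔ ∀ i, par i ≠ p → v i = 0 := by
  rw [Grading.mem_part, funext_iff]
  refine forall_congr' fun i => ?_
  simp only [vecGrading, LinearMap.coe_mk, AddHom.coe_mk]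
  by_cases h : par i = p
  · simp [h]
  · simp [h, eq_comm]

theorem mem_matPart {p : ZMod 2} {A : Matrix (a ⊕ b) (a ⊕ b) ℂ} :
    A ∈ (matGrading a b).part p ↔ ∀ i j, par i + par j ≠ p → A i j = 0 := by
  rw [Grading.mem_part, ← Matrix.ext_iff]
  refine forall_congr' fun i => forall_congr' fun j => ?_
  simp only [matGrading, LinearMap.coe_mk, AddHom.coe_mk, Matrix.of_apply]
  by_cases h : par i + par j = p
  · simp [h]
  · simp [h, eq_comm]

variable [Fintype a] [Fintype b] [DecidableEq a] [DecidableEq b]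

theorem mul_mem_matPart {p q : ZMod 2} {A B : Matrix (a ⊕ b) (a ⊕ b) ℂ}
    (hA : A ∈ (matGrading a b).part p) (hB : B ∈ (matGrading a b).part q) :
    A * B ∈ (matGrading a b).part (p + q) := by
  rw [mem_matPart] at *
  intro i j hij
  rw [Matrix.mul_apply]
  refine Finset.sum_eq_zero fun s _ => ?_
  by_cases h1 : par i + par s = p
  · by_cases h2 : par s + par j = q
    · refine absurd ?_ hij
      rw [← h1, ← h2]
      generalize par i = x, par j = y, par s = z
      revert x y z; decide
    · rw [hB _ _ h2, mul_zero]
  · rw [hA _ _ h1, zero_mul]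

/-- The supercommutator, `[A, B] = A B - (-1)^{|A||B|} B A` on homogeneous matrices. -/
def superComm (a b : Type*) [Fintype a] [Fintype b] [DecidableEq a] [DecidableEq b] :
    Matrix (a ⊕ b) (a ⊕ b) ℂ →ₗ[ℂ] Matrix (a ⊕ b) (a ⊕ b) ℂ →ₗ[ℂ] Matrix (a ⊕ b) (a ⊕ b) ℂ :=
  LinearMap.mul ℂ _ - ∑ p, ∑ q, sgn p q •
    (LinearMap.mul ℂ _).flip.compl₁₂ ((matGrading a b).proj p) ((matGrading a b).proj q)

theorem superComm_apply {p q : ZMod 2} {A B : Matrix (a ⊕ b) (a ⊕ b) ℂ}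
    (hA : A ∈ (matGrading a b).part p) (hB : B ∈ (matGrading a b).part q) :
    superComm a b A B = A * B - sgn p q • (B * A) := by
  simp only [superComm, LinearMap.sub_apply, LinearMap.sum_apply, LinearMap.smul_apply,
    LinearMap.compl₁₂_apply, LinearMap.flip_apply, LinearMap.mul_apply', Grading.proj_of_mem hA,
    Grading.proj_of_mem hB]
  congr 1
  rw [Finset.sum_eq_single p]
  · rw [Finset.sum_eq_single q]
    · simp
    · intro b _ hb; simp [hb]
    · simp
  · intro b _ hb; simp [hb]
  · simp

theorem superComm_mem {p q : ZMod 2} {A B : Matrix (a ⊕ b) (a ⊕ b) ℂ}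
    (hA : A ∈ (matGrading a b).part p) (hB : B ∈ (matGrading a b).part q) :
    superComm a b A B ∈ (matGrading a b).part (p + q) := by
  rw [superComm_apply hA hB]
  refine Submodule.sub_mem _ (mul_mem_matPart hA hB) (Submodule.smul_mem _ _ ?_)
  rw [add_comm]
  exact mul_mem_matPart hB hA

/-- The general linear Lie superalgebra `gl(a|b)`. -/
def gl (a b : Type*) [Fintype a] [Fintype b] [DecidableEq a] [DecidableEq b] :
    LieSuperalgebra (Matrix (a ⊕ b) (a ⊕ b) ℂ) where
  toGrading := matGrading a b
  bracket := superComm a b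
  bracket_mem _ _ _ hx _ hy := superComm_mem hx hy
  skew p q x hx y hy := by
    rw [superComm_apply hx hy, superComm_apply hy hx, sgn_comm q p, smul_sub, smul_smul,
      sgn_mul_self, one_smul]
    abel
  jacobi p q x hx y hy z := by
    refine (matGrading a b).induction (P := fun z => superComm a b x (superComm a b y z) =
      superComm a b (superComm a b x y) z + sgn p q • superComm a b y (superComm a b x z)) ?_ ?_ z
    · intro z w hz hw
      simp only [map_add, hz, hw, smul_add]; abel
    · intro r z hz
      rw [superComm_apply hx (superComm_mem hy hz), superComm_apply hy hz,
        superComm_apply (superComm_mem hx hy) hz, superComm_apply hx hy,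
        superComm_apply hy (superComm_mem hx hz), superComm_apply hx hz,
        sgn_add_left, sgn_add_right, sgn_add_right, sgn_comm q p]
      simp only [mul_sub, sub_mul, smul_sub, smul_smul, Matrix.mul_smul, Matrix.smul_mul,
        Matrix.mul_assoc]
      have h := sgn_mul_self p q
      match_scalars <;> first
        | ring1
        | linear_combination h
        | linear_combination (-1 : ℂ) * h
        | linear_combination (sgn p r) * h
        | linear_combination (sgn q r) * h
        | linear_combination (sgn p r * sgn q r) * h
        | linear_combination (-sgn p r * sgn q r) * h

/-- The matrix of the operator `v ↦ (-1)^{p|v|} v`. -/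
def signMat (a b : Type*) [DecidableEq a] [DecidableEq b] (p : ZMod 2) :
    Matrix (a ⊕ b) (a ⊕ b) ℂ := Matrix.diagonal fun i => sgn p (par i)

/-- Matrices `A` with `B(A v, w) + (-1)^{p|v|} B(v, A w) = 0` for all homogeneous `v`, `w`, where
`B` is the bilinear form with Gram matrix `G`. -/
def formPart (G : Matrix (a ⊕ b) (a ⊕ b) ℂ) (p : ZMod 2) :
    Submodule ℂ (Matrix (a ⊕ b) (a ⊕ b) ℂ) where
  carrier := {A | A.transpose * G + signMat a b p * G * A = 0}
  add_mem' {A B} hA hB := by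
    simp only [Set.mem_ofPred_eq, Matrix.transpose_add, add_mul, mul_add] at *
    rw [add_add_add_comm, hA, hB, add_zero]
  zero_mem' := by simp
  smul_mem' c A hA := by
    simp only [Set.mem_ofPred_eq, Matrix.transpose_smul, Matrix.smul_mul, Matrix.mul_smul] at *
    rw [← smul_add, hA, smul_zero]

/-- The underlying space of the orthosymplectic Lie superalgebra of the form `G`: matrices whose
homogeneous components preserve the form in the super sense. -/
def ospSpace (G : Matrix (a ⊕ b) (a ⊕ b) ℂ) : Submodule ℂ (Matrix (a ⊕ b) (a ⊕ b) ℂ) :=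
  ⨅ p, (formPart G p).comap ((matGrading a b).proj p)

theorem mem_ospSpace {G A : Matrix (a ⊕ b) (a ⊕ b) ℂ} :
    A ∈ ospSpace G ↔ ∀ p, (matGrading a b).proj p A ∈ formPart G p := by
  simp [ospSpace]

theorem proj_mem_ospSpace (G : Matrix (a ⊕ b) (a ⊕ b) ℂ) (p : ZMod 2)
    (A : Matrix (a ⊕ b) (a ⊕ b) ℂ) (hA : A ∈ ospSpace G) :
    (matGrading a b).proj p A ∈ ospSpace G := by
  rw [mem_ospSpace] at *
  intro q
  rw [Grading.proj_proj]
  split_ifs with h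
  · exact h ▸ hA p
  · exact Submodule.zero_mem _

theorem mem_ospSpace_of_mem {G A : Matrix (a ⊕ b) (a ⊕ b) ℂ} {p : ZMod 2}
    (hA : A ∈ (matGrading a b).part p) : A ∈ ospSpace G ↔ A ∈ formPart G p := by
  rw [mem_ospSpace]
  constructor
  · intro h
    simpa [Grading.proj_of_mem hA] using h p
  · intro h q
    rw [Grading.proj_of_mem hA]
    split_ifs with e
    · exact e ▸ h
    · exact Submodule.zero_mem _

theorem transpose_mul_signMat {p q : ZMod 2} {B : Matrix (a ⊕ b) (a ⊕ b) ℂ}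
    (hB : B ∈ (matGrading a b).part q) :
    B.transpose * signMat a b p = sgn p q • (signMat a b p * B.transpose) := by
  rw [mem_matPart] at hB
  ext i j
  rw [signMat, Matrix.mul_diagonal, Matrix.smul_apply, Matrix.diagonal_mul, Matrix.transpose_apply]
  by_cases h : par j + par i = q
  · have e : par j = q + par i := by
      rw [← h]; generalize par i = x, par j = y; revert x y; decide
    rw [e, sgn_add_right, smul_eq_mul]; ring
  · rw [hB _ _ h]; simp

theorem formPart_mul {G A B : Matrix (a ⊕ b) (a ⊕ b) ℂ} {p q : ZMod 2}
    (hB : B ∈ (matGrading a b).part q) (hA' : A ∈ formPart G p) (hB' : B ∈ formPart G q) :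
    (A * B).transpose * G = sgn p q • (signMat a b (p + q) * G * (B * A)) := by
  have hA2 : A.transpose * G = -(signMat a b p * G * A) := eq_neg_of_add_eq_zero_left hA'
  have hB2 : B.transpose * G = -(signMat a b q * G * B) := eq_neg_of_add_eq_zero_left hB'
  have hs : signMat a b p * signMat a b q = signMat a b (p + q) := by
    rw [signMat, signMat, signMat, Matrix.diagonal_mul_diagonal]
    congr 1; ext i; rw [sgn_add_left]
  rw [Matrix.transpose_mul, Matrix.mul_assoc, hA2, mul_neg, ← Matrix.mul_assoc,
    ← Matrix.mul_assoc, transpose_mul_signMat hB, Matrix.smul_mul, Matrix.smul_mul,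
    Matrix.mul_assoc (signMat a b p), hB2, mul_neg, neg_mul, smul_neg, neg_neg, ← hs]
  simp only [Matrix.mul_assoc]

theorem superComm_mem_ospSpace (G A : Matrix (a ⊕ b) (a ⊕ b) ℂ) (hA : A ∈ ospSpace G)
    (B : Matrix (a ⊕ b) (a ⊕ b) ℂ) (hB : B ∈ ospSpace G) : superComm a b A B ∈ ospSpace G := by
  have key : ∀ p q, superComm a b ((matGrading a b).proj p A) ((matGrading a b).proj q B)
      ∈ ospSpace G := by
    intro p q
    have hA' := mem_ospSpace.1 hA p
    have hB' := mem_ospSpace.1 hB q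
    have hA1 := (matGrading a b).proj_mem p A
    have hB1 := (matGrading a b).proj_mem q B
    rw [mem_ospSpace_of_mem (superComm_mem hA1 hB1), superComm_apply hA1 hB1]
    have h1 := formPart_mul hB1 hA' hB'
    have h2 := formPart_mul hA1 hB' hA'
    change _ = _
    rw [Matrix.transpose_sub, Matrix.transpose_smul, sub_mul, Matrix.smul_mul, h1, h2, mul_sub,
      add_comm q p, sgn_comm q p, smul_smul, sgn_mul_self, one_smul, Matrix.mul_smul]
    abel
  rw [← (matGrading a b).proj_add A, ← (matGrading a b).proj_add B]
  simp only [map_add, LinearMap.add_apply]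
  exact Submodule.add_mem _ (Submodule.add_mem _ (key 0 0) (key 1 0))
    (Submodule.add_mem _ (key 0 1) (key 1 1))

/-- The orthosymplectic Lie superalgebra of the bilinear form with Gram matrix `G`. -/
def osp (G : Matrix (a ⊕ b) (a ⊕ b) ℂ) : LieSuperalgebra (ospSpace G) :=
  (gl a b).restrict (ospSpace G) (proj_mem_ospSpace G) (superComm_mem_ospSpace G)

/-- The standard module `ℂ^{a|b}` of the orthosymplectic Lie superalgebra. -/
def standard (G : Matrix (a ⊕ b) (a ⊕ b) ℂ) : Rep (osp G) (a ⊕ b → ℂ) where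
  toGrading := vecGrading a b
  act := Matrix.toLin'.toLinearMap ∘ₗ (ospSpace G).subtype
  act_mem p q x hx v hv := by
    have hx' := mem_matPart.1 (Grading.mem_restrict_part.1 hx)
    rw [mem_vecPart] at *
    intro i hi
    change Matrix.toLin' (x : Matrix (a ⊕ b) (a ⊕ b) ℂ) v i = 0
    rw [Matrix.toLin'_apply]
    refine Finset.sum_eq_zero fun s _ => ?_
    by_cases h1 : par i + par s = p
    · by_cases h2 : par s = q
      · refine absurd ?_ hi
        rw [← h1, ← h2]
        generalize par i = x, par s = z
        revert x z; decide
      · rw [hv _ h2, mul_zero]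
    · exact (congrArg (· * v s) (hx' _ _ h1)).trans (zero_mul _)
  act_bracket p q x hx y hy v := by
    have := superComm_apply (Grading.mem_restrict_part.1 hx) (Grading.mem_restrict_part.1 hy)
    change Matrix.toLin' (superComm a b x y) v = Matrix.toLin' _ (Matrix.toLin' _ v) -
      sgn p q • Matrix.toLin' _ (Matrix.toLin' _ v)
    rw [this]
    simp

/-- The Cartan subalgebra: the diagonal matrices in the orthosymplectic Lie superalgebra. -/
def cartan (G : Matrix (a ⊕ b) (a ⊕ b) ℂ) : Submodule ℂ (ospSpace G) where
  carrier := {x | (x : Matrix (a ⊕ b) (a ⊕ b) ℂ).IsDiag}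
  add_mem' hx hy := Matrix.IsDiag.add hx hy
  zero_mem' := Matrix.isDiag_zero
  smul_mem' c _ hx := Matrix.IsDiag.smul c hx

/-- The weight of the `i`-th standard basis vector. -/
def entry (G : Matrix (a ⊕ b) (a ⊕ b) ℂ) (i : a ⊕ b) : Module.Dual ℂ (cartan G) :=
  Matrix.entryLinearMap ℂ ℂ i i ∘ₗ (ospSpace G).subtype ∘ₗ (cartan G).subtype

end Matrices

/-- Gram matrix of the form defining `B(k|l) = osp(2k+1|2l)`. -/
def gramB (k l : ℕ) : Matrix ((Unit ⊕ Fin k ⊕ Fin k) ⊕ (Fin l ⊕ Fin l))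
    ((Unit ⊕ Fin k ⊕ Fin k) ⊕ (Fin l ⊕ Fin l)) ℂ :=
  Matrix.fromBlocks (LieAlgebra.Orthogonal.JB (Fin k) ℂ) 0 0 (Matrix.J (Fin l) ℂ)

/-- Gram matrix of the form defining `D(k|l) = osp(2k|2l)`. -/
def gramD (k l : ℕ) : Matrix ((Fin k ⊕ Fin k) ⊕ (Fin l ⊕ Fin l))
    ((Fin k ⊕ Fin k) ⊕ (Fin l ⊕ Fin l)) ℂ :=
  Matrix.fromBlocks (LieAlgebra.Orthogonal.JD (Fin k) ℂ) 0 0 (Matrix.J (Fin l) ℂ)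

/-- The Lie superalgebra `B(k|l)`. -/
abbrev B (k l : ℕ) : LieSuperalgebra (ospSpace (gramB k l)) := osp (gramB k l)

/-- The Lie superalgebra `D(k|l)`. -/
abbrev D (k l : ℕ) : LieSuperalgebra (ospSpace (gramD k l)) := osp (gramD k l)

/-- The Cartan subalgebra of `B(k|l)`. -/
abbrev hB (k l : ℕ) : Submodule ℂ (ospSpace (gramB k l)) := cartan (gramB k l)

/-- The Cartan subalgebra of `D(k|l)`. -/
abbrev hD (k l : ℕ) : Submodule ℂ (ospSpace (gramD k l)) := cartan (gramD k l)

/-- The weight `ε_i` of `B(k|l)`. -/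
def epsB {k : ℕ} (l : ℕ) (i : Fin k) : Module.Dual ℂ (hB k l) :=
  entry (gramB k l) (Sum.inl (Sum.inr (Sum.inl i)))

/-- The weight `δ_i` of `B(k|l)`. -/
def delB (k : ℕ) {l : ℕ} (i : Fin l) : Module.Dual ℂ (hB k l) :=
  entry (gramB k l) (Sum.inr (Sum.inl i))

/-- The weight `ε_i` of `D(k|l)`. -/
def epsD {k : ℕ} (l : ℕ) (i : Fin k) : Module.Dual ℂ (hD k l) :=
  entry (gramD k l) (Sum.inl (Sum.inl i))

/-- The weight `δ_i` of `D(k|l)`. -/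
def delD (k : ℕ) {l : ℕ} (i : Fin l) : Module.Dual ℂ (hD k l) :=
  entry (gramD k l) (Sum.inr (Sum.inl i))

/-- The differences of consecutive members of a list. -/
def consecutive {M : Type*} [AddCommGroup M] (s : List M) : Set M :=
  {α | α ∈ List.zipWith (fun x y => x - y) s s.tail}

/-- The weights `ε_1, δ_1, ε_2, …, ε_k, δ_2, …, δ_l` of `B(k|l)`, in this order. -/
def orderB (k l : ℕ) : List (Module.Dual ℂ (hB k l)) :=
  (List.ofFn (epsB (k := k) l)).take 1 ++ (List.ofFn (delB k (l := l))).take 1 ++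
    (List.ofFn (epsB (k := k) l)).drop 1 ++ (List.ofFn (delB k (l := l))).drop 1

/-- The simple roots `ε_1 - δ_1, δ_1 - ε_2, ε_2 - ε_3, …, ε_k - δ_2, δ_2 - δ_3, …, δ_{l-1} - δ_l, δ_l`
of `B(k|l)` (for `l = 1` the last one is the last member of the list of weights above). -/
def simpleB (k l : ℕ) : Set (Module.Dual ℂ (hB k l)) :=
  consecutive (orderB k l) ∪ {α | (orderB k l).getLast? = some α}

/-- The weights `ε_1, …, ε_k, δ_1, …, δ_l` of `D(k|l)`, in this order. -/
def orderD (k l : ℕ) : List (Module.Dual ℂ (hD k l)) :=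
  List.ofFn (epsD (k := k) l) ++ List.ofFn (delD k (l := l))

/-- The simple roots `ε_1 - ε_2, …, ε_k - δ_1, δ_1 - δ_2, …, δ_{l-1} - δ_l, 2 δ_l` of `D(k|l)`. -/
def simpleD (k l : ℕ) : Set (Module.Dual ℂ (hD k l)) :=
  consecutive (orderD k l) ∪ {α | ∃ β, (orderD k l).getLast? = some β ∧ α = 2 • β}

/-- `± x` -/
def pm {M : Type*} [AddCommGroup M] (x : M) : Set M := {x, -x}

/-- `± x ± y` with independent signs -/
def pmpm {M : Type*} [AddCommGroup M] (x y : M) : Set M := {x + y, x - y, -x + y, -x - y}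

/-- Nonzero even weights `±ε_i±ε_j`, `±ε_i`, `±δ_g±δ_h`, `±2ε_i` (`i ≠ j`, `g ≠ h`). -/
def evenB (k l : ℕ) : Set (Module.Dual ℂ (hB k l)) :=
  {α | (∃ i j : Fin k, i ≠ j ∧ α ∈ pmpm (epsB l i) (epsB l j)) ∨
    (∃ i : Fin k, α ∈ pm (epsB l i)) ∨
    (∃ g h : Fin l, g ≠ h ∧ α ∈ pmpm (delB k g) (delB k h)) ∨
    ∃ i : Fin k, α ∈ pm (2 • epsB l i)}

/-- Odd weights `±δ_g`, `±ε_i±δ_g`. -/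
def oddB (k l : ℕ) : Set (Module.Dual ℂ (hB k l)) :=
  {α | (∃ g : Fin l, α ∈ pm (delB k g)) ∨
    ∃ (i : Fin k) (g : Fin l), α ∈ pmpm (epsB l i) (delB k g)}

/-- Nonzero even weights `±ε_i±ε_j`, `±δ_g±δ_h`, `±2ε_i` (`i ≠ j`, `g ≠ h`). -/
def evenD (k l : ℕ) : Set (Module.Dual ℂ (hD k l)) :=
  {α | (∃ i j : Fin k, i ≠ j ∧ α ∈ pmpm (epsD l i) (epsD l j)) ∨
    (∃ g h : Fin l, g ≠ h ∧ α ∈ pmpm (delD k g) (delD k h)) ∨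
    ∃ i : Fin k, α ∈ pm (2 • epsD l i)}

/-- Odd weights `±ε_i±δ_g`. -/
def oddD (k l : ℕ) : Set (Module.Dual ℂ (hD k l)) :=
  {α | ∃ (i : Fin k) (g : Fin l), α ∈ pmpm (epsD l i) (delD k g)}

open Classical in
/-- `n e^0 + ∑_{α ∈ Ω} e^α`, as the function sending a weight to its coefficient. -/
def charSum {M : Type*} [Zero M] (n : ℕ) (Ω : Set M) : M → ℕ :=
  fun α => (if α = 0 then n else 0) + if α ∈ Ω then 1 else 0

end Super

end

/-! Both superalgebras are handled at once, as the orthosymplectic algebra of a form that pairs each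
basis vector `e_i` with a multiple of `e_{σ i}` (`OspData`). Such an algebra is spanned by the
elements `F i j`, multiples of `E_{i j} - c E_{σ j, σ i}` projected from gl, which are root vectors
or Cartan elements. An integer rank `r`, odd under `σ`, orders the weights of the standard module.
The Cartan element `h0` with diagonal entries `r i` is positive on every positive root, so that
questions about highest weights become comparisons of integers.

The decisive tool is the Casimir operator `Ω = ∑ (-1)^{|j|} F i j F j i`. It commutes with the
action and kills invariant vectors. On a highest weight vector of weight `2ε₁` it is `4 sdim`
(`IsHighest.casimir_eq`), where the superdimension `sdim` of the standard module is `2k + 1 - 2l`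
for `B` and `2k - 2l` for `D`. This is nonzero for every `B`, by parity, and for `D` exactly when `k
≠ l`. A module generated by such a vector then contains no nonzero invariant vector, and trivial
constituents split off.

If `v` is a highest weight vector of any module and `u` one of the same weight in a simple module
`U`, the submodule of the direct sum generated by `(v, u)` is the graph of a surjection from the
module generated by `v` onto `U` (`exists_hom_of_isHighest`).

In the symmetric square the nonzero weights have multiplicity one, and when the standard module has
dimension at least five any basis product of nonzero weight generates the highest one. The submodule
`N` generated by the highest product contains all products of nonzero weight and, together with a
single vector of weight zero, spans everything; it is proper because the invariant form vanishes on
it. So `N` has codimension one. The kernel of `N → L(2ε₁)` misses the highest vector, hence has only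
the weight zero, hence is invariant, hence vanishes by the Casimir argument. Therefore `dim L(2ε₁) =
dim S² - 1` (`Adapted.finrank_add_one`).

Now let `V` have the character of `S²`. A homogeneous vector `v` of weight `2ε₁` is highest, as no
higher weight occurs. The module it generates maps onto `L(2ε₁)` with kernel of dimension at most
one. The algebra acts by zero on modules of dimension at most one, so the Casimir operator kills
this kernel, which must be zero. The quotient of `V` by the submodule is a trivial line, and the
kernel of `Ω` is an invariant complement (`IsHighest.exists_isIso`). The decomposition of `S²`
itself is the case `V = S²`; graded characters fix the two parities. -/

set_option linter.unusedSectionVars false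

noncomputable section

namespace Super

/-! ### Orthosymplectic algebras of monomial forms and their root vectors -/

section

variable {a b : Type*} [Fintype a] [Fintype b] [DecidableEq a] [DecidableEq b]

/-- A monomial Gram matrix of an orthosymplectic form: `e_i` is paired with `e_{σ i}`, the
coefficient being `η i`. The rank function `r` orders the weights of the standard module. -/
structure OspData (G : Matrix (a ⊕ b) (a ⊕ b) ℂ) where
  σ : a ⊕ b → a ⊕ b
  η : a ⊕ b → ℂ
  r : a ⊕ b → ℤ
  top : a ⊕ b
  σσ : ∀ i, σ (σ i) = i
  par_σ : ∀ i, par (σ i) = par i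
  η_ne : ∀ i, η i ≠ 0
  η_σ : ∀ i, η (σ i) = sgn (par i) (par i) * η i
  G_apply : ∀ i j, G i j = if j = σ i then η i else 0
  r_σ : ∀ i, r (σ i) = -r i
  r_inj : Function.Injective r
  r_le : ∀ i, r i ≤ r top
  par_top : par top = 0
  σ_top : σ top ≠ top
  -- Since `top` is even, every index now has a companion of the opposite parity, which neither
  -- equals it nor is paired with it.
  nonempty_odd : Nonempty b

theorem sgn_ne_zero (p q : ZMod 2) : sgn p q ≠ 0 := by
  unfold sgn; split_ifs <;> norm_num

theorem sgn_zero_left (q : ZMod 2) : sgn 0 q = 1 := by simp [sgn]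

theorem sgn_zero_right (q : ZMod 2) : sgn q 0 = 1 := by simp [sgn]

theorem zmod2_add_self (p : ZMod 2) : p + p = 0 := by revert p; decide

namespace OspData

variable {G : Matrix (a ⊕ b) (a ⊕ b) ℂ} (D : OspData G)
include D

theorem σ_inj {i j : a ⊕ b} : D.σ i = D.σ j ↔ i = j :=
  ⟨fun h => by rw [← D.σσ i, h, D.σσ], fun h => h ▸ rfl⟩

theorem eq_σ_iff {i j : a ⊕ b} : i = D.σ j ↔ D.σ i = j :=
  ⟨fun h => by rw [h, D.σσ], fun h => by rw [← h, D.σσ]⟩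

/-- The Gram matrix has one nonzero entry in each row and column, so every entry of the defining
matrix identity has only two terms; the relation displayed is its entry at `(i, σ s)`. -/
theorem mem_formPart {A : Matrix (a ⊕ b) (a ⊕ b) ℂ} {p : ZMod 2} :
    A ∈ formPart G p ↔
      ∀ s i, A s i * D.η s = -(sgn p (par i) * D.η i * A (D.σ i) (D.σ s)) := by
  have h1 : ∀ x y, (A.transpose * G) x y = A (D.σ y) x * D.η (D.σ y) := by
    intro x y
    rw [Matrix.mul_apply, Finset.sum_eq_single (D.σ y)]
    · simp [D.G_apply, D.σσ]
    · intro s _ hs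
      rw [D.G_apply, if_neg, mul_zero]
      rintro rfl; exact hs (D.σσ s).symm
    · simp
  have h2 : ∀ x y, (signMat a b p * G * A) x y = sgn p (par x) * D.η x * A (D.σ x) y := by
    intro x y
    rw [Matrix.mul_assoc, signMat, Matrix.diagonal_mul, Matrix.mul_apply,
      Finset.sum_eq_single (D.σ x)]
    · simp [D.G_apply, mul_assoc]
    · intro s _ hs; rw [D.G_apply, if_neg hs, zero_mul]
    · simp
  change A.transpose * G + signMat a b p * G * A = 0 ↔ _
  rw [← Matrix.ext_iff]
  constructor
  · intro h s i
    have := h i (D.σ s)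
    rw [Matrix.add_apply, h1, h2, D.σσ, Matrix.zero_apply] at this
    exact eq_neg_of_add_eq_zero_left this
  · intro h x y
    have := h (D.σ y) x
    rw [D.σσ] at this
    rw [Matrix.add_apply, h1, h2, this, Matrix.zero_apply, neg_add_cancel]

/-- The coefficient of `E_{σ j, σ i}` in `-F_{i j}`. -/
def coef (i j : a ⊕ b) : ℂ := sgn (par i + par j) (par j) * D.η i / D.η j

/-- The matrix `E_{i j} - coef i j • E_{σ j, σ i}`. -/
def matF (i j : a ⊕ b) : Matrix (a ⊕ b) (a ⊕ b) ℂ :=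
  Matrix.of fun x y => (if x = i ∧ y = j then 1 else 0) -
    D.coef i j * if x = D.σ j ∧ y = D.σ i then 1 else 0

theorem matF_mem_part (i j : a ⊕ b) : D.matF i j ∈ (matGrading a b).part (par i + par j) := by
  rw [mem_matPart]
  intro x y h
  simp only [matF, Matrix.of_apply]
  rw [if_neg, if_neg, mul_zero, sub_zero]
  · rintro ⟨rfl, rfl⟩; rw [D.par_σ, D.par_σ, add_comm] at h; exact h rfl
  · rintro ⟨rfl, rfl⟩; exact h rfl

/-- The form relation ties the entry at `(i, j)` to the one at `(σ j, σ i)`, and `coef` is the ratio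
it forces. The two positions coincide exactly when `j = σ i`, which needs separate treatment. -/
theorem matF_mem (i j : a ⊕ b) : D.matF i j ∈ ospSpace G := by
  rw [mem_ospSpace_of_mem (D.matF_mem_part i j), D.mem_formPart]
  intro s t
  have hi := D.η_ne i
  have hj := D.η_ne j
  simp only [matF, Matrix.of_apply, D.σ_inj, coef]
  have e1 : (s = D.σ j ∧ t = D.σ i) ↔ (D.σ t = i ∧ D.σ s = j) := by
    rw [D.eq_σ_iff, D.eq_σ_iff, and_comm]
  simp only [e1]
  by_cases h1 : s = i ∧ t = j
  · obtain ⟨rfl, rfl⟩ := h1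
    have e2 : (D.σ t = s ∧ D.σ s = t) ↔ D.σ t = s := by
      constructor
      · exact And.left
      · intro h; exact ⟨h, by rw [← h, D.σσ]⟩
    simp only [e2]
    by_cases h2 : D.σ t = s
    · have hp : par s = par t := by rw [← h2, D.par_σ]
      have he : D.η s = sgn (par t) (par t) * D.η t := by rw [← h2, D.η_σ]
      simp only [h2, and_self, if_true]
      rw [hp, zmod2_add_self, sgn_zero_left, he]
      field_simp
      linear_combination (-1 : ℂ) * sgn_mul_self (par t) (par t)
    · simp only [h2, and_self, if_true, if_false]
      field_simp
      linear_combination (-D.η s * D.η t) * sgn_mul_self (par s + par t) (par t)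
  · by_cases h2 : D.σ t = i ∧ D.σ s = j
    · rw [if_neg h1, if_pos h2, if_neg (fun h => h1 ⟨h.2, h.1⟩)]
      obtain ⟨rfl, rfl⟩ := h2
      rw [D.η_σ, D.η_σ, D.par_σ, D.par_σ]
      have := D.η_ne s
      rcases zmod2_cases (par s) with h | h <;> rcases zmod2_cases (par t) with h' | h' <;>
        simp [h, h', sgn, zmod2_add_self] <;> field_simp
    · rw [if_neg h1, if_neg h2, if_neg (fun h => h1 ⟨h.2, h.1⟩)]; simp

/-- The element `E_{i j} - coef i j • E_{σ j, σ i}` of the orthosymplectic Lie superalgebra. -/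
def F (i j : a ⊕ b) : ospSpace G := ⟨D.matF i j, D.matF_mem i j⟩

theorem F_mem_part (i j : a ⊕ b) : D.F i j ∈ (osp G).part (par i + par j) :=
  Grading.mem_restrict_part.2 (D.matF_mem_part i j)

theorem F_apply (i j x y : a ⊕ b) : (D.F i j : Matrix (a ⊕ b) (a ⊕ b) ℂ) x y =
    (if x = i ∧ y = j then 1 else 0) - D.coef i j * if x = D.σ j ∧ y = D.σ i then 1 else 0 := rfl

theorem apply_eq_zero {p : ZMod 2} {X : ospSpace G} (hX : X ∈ (osp G).part p) {i j : a ⊕ b}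
    (h : par i + par j ≠ p) : (X : Matrix (a ⊕ b) (a ⊕ b) ℂ) i j = 0 :=
  mem_matPart.1 (Grading.mem_restrict_part.1 hX) i j h

theorem apply_mul_η {p : ZMod 2} {X : ospSpace G} (hX : X ∈ (osp G).part p) (s i : a ⊕ b) :
    (X : Matrix (a ⊕ b) (a ⊕ b) ℂ) s i * D.η s = -(sgn p (par i) * D.η i * X.1 (D.σ i) (D.σ s)) :=
  D.mem_formPart.1 ((mem_ospSpace_of_mem (Grading.mem_restrict_part.1 hX)).1 X.2) s i

/-- This and `coef_mul_apply'` match the `σ`-twisted halves of the two sides of `bracket_F`. Entries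
of `X` of the wrong parity vanish on both sides, so the signs need comparing only when `|s| + |i| =
p`. -/
theorem coef_mul_apply {p : ZMod 2} {X : ospSpace G} (hX : X ∈ (osp G).part p) (s i j : a ⊕ b) :
    X.1 s i * D.coef s j =
      -(sgn p (par i + par j) * D.coef i j * X.1 (D.σ i) (D.σ s)) := by
  have h := D.apply_mul_η hX s i
  have hj := D.η_ne j
  by_cases hp : par s + par i = p
  · have e : X.1 s i * D.coef s j =
        (X.1 s i * D.η s) * (sgn (par s + par j) (par j) / D.η j) := by
      rw [coef]; ring
    rw [e, h, coef, sgn_add_right p]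
    have e2 : sgn (par s + par j) (par j) = sgn p (par j) * sgn (par i + par j) (par j) := by
      rw [← sgn_add_left, ← hp, add_assoc, ← add_assoc (par i), zmod2_add_self, zero_add]
    rw [e2]; ring
  · rw [apply_eq_zero D hX hp, apply_eq_zero D hX (i := D.σ i)]
    · simp
    · rwa [D.par_σ, D.par_σ, add_comm]

theorem coef_mul_apply' {p : ZMod 2} {X : ospSpace G} (hX : X ∈ (osp G).part p) (i j t : a ⊕ b) :
    X.1 j t * D.coef i t = -(sgn p (par i + par j) * D.coef i j * X.1 (D.σ t) (D.σ j)) := by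
  have h := D.apply_mul_η hX j t
  have hj := D.η_ne j
  have ht := D.η_ne t
  by_cases hp : par j + par t = p
  · have e2 : sgn (par i + par t) (par t) * sgn p (par t) =
        sgn p (par i + par j) * sgn (par i + par j) (par j) := by
      rw [← hp]
      rcases zmod2_cases (par i) with h1 | h1 <;> rcases zmod2_cases (par j) with h2 | h2 <;>
        rcases zmod2_cases (par t) with h3 | h3 <;> simp [h1, h2, h3, sgn, zmod2_add_self]
    rw [coef, coef]
    field_simp
    linear_combination (D.η i * sgn (par i + par t) (par t)) * h -
      (D.η t * D.η i * X.1 (D.σ t) (D.σ j)) * e2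
  · rw [apply_eq_zero D hX hp, apply_eq_zero D hX (i := D.σ t)]
    · simp
    · rwa [D.par_σ, D.par_σ, add_comm]

/-- Up to a factor two, `E_{i j} ↦ F i j` is the equivariant projection of gl onto osp, so `F i j`
transforms under osp as `E_{i j}` does. -/
theorem bracket_F {p : ZMod 2} {X : ospSpace G} (hX : X ∈ (osp G).part p) (i j : a ⊕ b) :
    (osp G).bracket X (D.F i j) = ∑ s, X.1 s i • D.F s j -
      sgn p (par i + par j) • ∑ t, X.1 j t • D.F i t := by
  apply Subtype.ext
  change superComm a b X.1 (D.matF i j) = _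
  rw [superComm_apply (Grading.mem_restrict_part.1 hX) (D.matF_mem_part i j)]
  ext x y
  have e1 : (X.1 * D.matF i j) x y = (if y = j then X.1 x i else 0) -
      if y = D.σ i then D.coef i j * X.1 x (D.σ j) else 0 := by
    simp only [Matrix.mul_apply, matF, Matrix.of_apply, mul_sub, Finset.sum_sub_distrib, ite_and]
    simp [mul_comm]
  have e2 : (D.matF i j * X.1) x y = (if x = i then X.1 j y else 0) -
      if x = D.σ j then D.coef i j * X.1 (D.σ i) y else 0 := by
    simp only [Matrix.mul_apply, matF, Matrix.of_apply, sub_mul, Finset.sum_sub_distrib, ite_and]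
    simp
  have e3 : (∑ s, X.1 s i • D.F s j : ospSpace G).1 x y = (if y = j then X.1 x i else 0) -
      if x = D.σ j then X.1 (D.σ y) i * D.coef (D.σ y) j else 0 := by
    rw [AddSubmonoidClass.coe_finsetSum, Matrix.sum_apply]
    simp only [SetLike.val_smul, Matrix.smul_apply, F_apply, smul_eq_mul, mul_sub,
      Finset.sum_sub_distrib]
    congr 1
    · simp [ite_and]
    · rw [Finset.sum_eq_single (D.σ y)]
      · simp [D.σσ]
      · intro s _ hs
        rw [if_neg, mul_zero, mul_zero]
        rintro ⟨-, rfl⟩; exact hs (D.σσ s).symm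
      · simp
  have e4 : (∑ t, X.1 j t • D.F i t : ospSpace G).1 x y = (if x = i then X.1 j y else 0) -
      if y = D.σ i then X.1 j (D.σ x) * D.coef i (D.σ x) else 0 := by
    rw [AddSubmonoidClass.coe_finsetSum, Matrix.sum_apply]
    simp only [SetLike.val_smul, Matrix.smul_apply, F_apply, smul_eq_mul, mul_sub,
      Finset.sum_sub_distrib]
    congr 1
    · simp [ite_and]
    · rw [Finset.sum_eq_single (D.σ x)]
      · simp [D.σσ]
      · intro s _ hs
        rw [if_neg, mul_zero, mul_zero]
        rintro ⟨rfl, -⟩; exact hs (D.σσ s).symm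
      · simp
  change _ = (∑ s, X.1 s i • D.F s j : ospSpace G).1 x y - sgn p (par i + par j) *
    (∑ t, X.1 j t • D.F i t : ospSpace G).1 x y
  rw [e3, e4, Matrix.sub_apply, Matrix.smul_apply, e1, e2, smul_eq_mul,
    D.coef_mul_apply hX, D.coef_mul_apply' hX, D.σσ, D.σσ]
  have hs := sgn_mul_self p (par i + par j)
  by_cases h1 : y = D.σ i <;> by_cases h2 : x = D.σ j <;> simp only [h1, h2, if_true, if_false]
  · linear_combination (D.coef i j * X.1 (D.σ j) (D.σ j)) * hs
  · linear_combination (D.coef i j * X.1 x (D.σ j)) * hs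
  · ring

/-- For homogeneous `X` in osp the twisted half of `∑ X_{i j} F i j` is a second copy of `X`, by the
form relation; hence the factor one half. -/
theorem span_F : Submodule.span ℂ (Set.range fun q : (a ⊕ b) × (a ⊕ b) => D.F q.1 q.2) = ⊤ := by
  rw [eq_top_iff]
  rintro X -
  refine (osp G).toGrading.induction (P := fun X => X ∈ Submodule.span ℂ _)
    (fun _ _ h1 h2 => Submodule.add_mem _ h1 h2) ?_ X
  intro p X hX
  have key : (2 : ℂ)⁻¹ • ∑ i, ∑ j, X.1 i j • D.F i j = X := by
    apply Subtype.ext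
    ext x y
    rw [SetLike.val_smul, AddSubmonoidClass.coe_finsetSum, Matrix.smul_apply, Matrix.sum_apply]
    simp only [AddSubmonoidClass.coe_finsetSum, Matrix.sum_apply, SetLike.val_smul,
      Matrix.smul_apply, F_apply, smul_eq_mul, mul_sub, Finset.sum_sub_distrib]
    rw [Finset.sum_eq_single x, Finset.sum_eq_single y, Finset.sum_eq_single (D.σ y),
      Finset.sum_eq_single (D.σ x)]
    · simp only [D.σσ, and_self, if_true, mul_one]
      have h := D.apply_mul_η hX (D.σ y) (D.σ x)
      rw [D.σσ, D.σσ] at h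
      have hx := D.η_ne (D.σ x)
      by_cases hp : par x + par y = p
      · rw [coef, ← mul_div_assoc, mul_left_comm, mul_comm (sgn _ _), h, D.par_σ, D.par_σ,
          add_comm (par y), hp]
        field_simp
        linear_combination X.1 x y * sgn_mul_self p (par x)
      · rw [apply_eq_zero D hX hp, apply_eq_zero D hX (i := D.σ y)]
        · simp
        · rwa [D.par_σ, D.par_σ, add_comm]
    · intro j _ hj
      rw [if_neg, mul_zero, mul_zero]
      rintro ⟨rfl, -⟩; exact hj (D.σσ j).symm
    · simp
    · intro i _ hi
      refine Finset.sum_eq_zero fun j _ => ?_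
      rw [if_neg, mul_zero, mul_zero]
      rintro ⟨-, rfl⟩; exact hi (D.σσ i).symm
    · simp
    · intro j _ hj
      rw [if_neg, mul_zero]
      rintro ⟨-, rfl⟩; exact hj rfl
    · simp
    · intro i _ hi
      refine Finset.sum_eq_zero fun j _ => ?_
      rw [if_neg, mul_zero]
      rintro ⟨rfl, -⟩; exact hi rfl
    · simp
  rw [← key]
  exact Submodule.smul_mem _ _ (Submodule.sum_mem _ fun i _ => Submodule.sum_mem _ fun j _ =>
    Submodule.smul_mem _ _ (Submodule.subset_span ⟨(i, j), rfl⟩))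

theorem induction_F {P : ospSpace G → Prop} (hF : ∀ i j, P (D.F i j))
    (hadd : ∀ x y, P x → P y → P (x + y)) (hsmul : ∀ (c : ℂ) x, P x → P (c • x)) (x : ospSpace G) :
    P x := by
  have hx : x ∈ Submodule.span ℂ (Set.range fun q : (a ⊕ b) × (a ⊕ b) => D.F q.1 q.2) := by
    rw [D.span_F]; trivial
  induction hx using Submodule.span_induction with
  | mem x h => obtain ⟨q, rfl⟩ := h; exact hF _ _
  | zero => simpa using hsmul 0 _ (hF D.top D.top)
  | add x y _ _ hx hy => exact hadd _ _ hx hy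
  | smul c x _ hx => exact hsmul _ _ hx

/-- The diagonal matrix with entries `f i`, for a function `f` that is odd under `σ`. -/
def cart (f : a ⊕ b → ℂ) (hf : ∀ i, f (D.σ i) = -f i) : cartan G :=
  ⟨⟨Matrix.diagonal f, by
    have h0 : Matrix.diagonal f ∈ (matGrading a b).part 0 := by
      rw [mem_matPart]
      intro i j h
      rw [Matrix.diagonal_apply_ne]
      rintro rfl; exact h (zmod2_add_self _)
    rw [mem_ospSpace_of_mem h0, D.mem_formPart]
    intro s i
    by_cases h : s = i
    · subst h; simp [hf, sgn_zero_left, mul_comm]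
    · rw [Matrix.diagonal_apply_ne _ h, Matrix.diagonal_apply_ne]
      · simp
      · rw [Ne, D.σ_inj]; exact Ne.symm h⟩, Matrix.isDiag_diagonal f⟩

theorem entry_cart (f : a ⊕ b → ℂ) (hf : ∀ i, f (D.σ i) = -f i) (i : a ⊕ b) :
    entry G i (D.cart f hf) = f i := by
  simp [entry, cart]

/-- The diagonal matrix with entries `r i`. -/
def h0 : cartan G := D.cart (fun i => D.r i) fun i => by rw [D.r_σ]; push_cast; rfl

theorem entry_h0 (i : a ⊕ b) : entry G i D.h0 = D.r i := D.entry_cart _ _ i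

theorem cartan_mem_part (h : cartan G) : (h : ospSpace G) ∈ (osp G).part 0 := by
  refine Grading.mem_restrict_part.2 (mem_matPart.2 ?_)
  intro i j hij
  refine h.2 ?_
  rintro rfl; exact hij (zmod2_add_self _)

theorem cartan_apply (h : cartan G) (i j : a ⊕ b) :
    h.1.1 i j = if i = j then entry G i h else 0 := by
  split_ifs with e
  · subst e; rfl
  · exact h.2 e

theorem bracket_cartan_F (h : cartan G) (i j : a ⊕ b) :
    (osp G).bracket h (D.F i j) = (entry G i - entry G j) h • D.F i j := by
  rw [D.bracket_F (D.cartan_mem_part h), sgn_zero_left, one_smul]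
  simp only [D.cartan_apply, ite_smul, zero_smul, Finset.sum_ite_eq', Finset.sum_ite_eq,
    Finset.mem_univ, if_true]
  exact (sub_smul _ _ _).symm

theorem F_mem_rootSpace (i j : a ⊕ b) :
    D.F i j ∈ (osp G).rootSpace (cartan G) (entry G i - entry G j) :=
  fun h => D.bracket_cartan_F h i j

theorem coef_self (i : a ⊕ b) : D.coef i i = 1 := by
  rw [coef, zmod2_add_self, sgn_zero_left, one_mul, div_self (D.η_ne i)]

theorem F_self_mem (i : a ⊕ b) : D.F i i ∈ cartan G := by
  intro x y hxy
  rw [D.F_apply, if_neg, if_neg, mul_zero, sub_zero]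
  · rintro ⟨rfl, rfl⟩; exact hxy rfl
  · rintro ⟨rfl, rfl⟩; exact hxy rfl

theorem entry_F_self (i j : a ⊕ b) : entry G j ⟨D.F i i, D.F_self_mem i⟩ =
    (if j = i then 1 else 0) - if j = D.σ i then 1 else 0 := by
  change (D.F i i).1 j j = _
  simp [D.F_apply, D.coef_self]

theorem entry_σ (i : a ⊕ b) : entry G (D.σ i) = -entry G i := by
  ext h
  have := D.apply_mul_η (D.cartan_mem_part h) i i
  rw [sgn_zero_left, one_mul, mul_comm, ← mul_neg] at this
  have := mul_left_cancel₀ (D.η_ne i) this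
  change h.1.1 _ _ = -h.1.1 i i
  rw [this, neg_neg]

theorem entry_injective : Function.Injective (entry G) := by
  intro i j h
  have := LinearMap.congr_fun h D.h0
  rw [D.entry_h0, D.entry_h0] at this
  exact D.r_inj (by exact_mod_cast this)

theorem bracket_F_F {i j : a ⊕ b} (hσ : j ≠ D.σ i) :
    (osp G).bracket (D.F i j) (D.F j i) =
      D.F i i - sgn (par i + par j) (par i + par j) • D.F j j := by
  have hσ' : i ≠ D.σ j := fun h => hσ (by rw [h, D.σσ])
  rw [D.bracket_F (D.F_mem_part i j), Finset.sum_eq_single i, Finset.sum_eq_single j,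
    add_comm (par j)]
  · simp [D.F_apply, hσ, hσ']
  · intro t _ ht; simp [D.F_apply, ht, hσ']
  · simp
  · intro s _ hs; simp [D.F_apply, hs, hσ]
  · simp

/-- The form is symmetric on the even part, so the two elementary matrices cancel: `2ε_i` is not a
root. -/
theorem F_σ_of_even {i : a ⊕ b} (hi : par i = 0) : D.F i (D.σ i) = 0 := by
  apply Subtype.ext; ext x y
  change (D.F i (D.σ i)).1 x y = 0
  rw [D.F_apply, coef, D.σσ, D.par_σ, D.η_σ, hi, sgn_zero_right, sgn_zero_right, one_mul,
    div_self (D.η_ne i)]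
  simp

theorem bracket_F_σ_of_odd {i : a ⊕ b} (hi : par i = 1) :
    (osp G).bracket (D.F i (D.σ i)) (D.F (D.σ i) i) =
      (2 : ℂ) • (D.F i i - D.F (D.σ i) (D.σ i)) := by
  have hc : D.coef i (D.σ i) = -1 := by
    have := D.η_ne i
    rw [coef, D.par_σ, D.η_σ, hi, zmod2_add_self, sgn_zero_left]
    simp only [sgn, and_self, if_true]
    field_simp
  have hF : ∀ x y, (D.F i (D.σ i)).1 x y = if x = i ∧ y = D.σ i then 2 else 0 := by
    intro x y
    rw [D.F_apply, D.σσ, hc]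
    split_ifs <;> norm_num
  rw [D.bracket_F (D.F_mem_part _ _), D.par_σ, hi, zmod2_add_self, sgn_zero_left, one_smul,
    Finset.sum_eq_single i, Finset.sum_eq_single (D.σ i)]
  · simp [hF, smul_sub]
  · intro t _ ht; rw [hF]; simp [ht]
  · simp
  · intro s _ hs; rw [hF]; simp [hs]
  · simp

end OspData

end

/-! ### Submodules, quotients, highest weight vectors and the Casimir operator -/

section

namespace Rep

variable {g : Type*} [AddCommGroup g] [Module ℂ g] {L : LieSuperalgebra g}
  {V W : Type*} [AddCommGroup V] [Module ℂ V] [AddCommGroup W] [Module ℂ W]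

theorem act_proj (ρ : Rep L V) {q : ZMod 2} {x : g} (hx : x ∈ L.part q) (p : ZMod 2) (v : V) :
    ρ.act x (ρ.proj p v) = ρ.proj (q + p) (ρ.act x v) := by
  have h1 : ∀ s, ρ.act x (ρ.proj s v) ∈ ρ.part (q + s) := fun s =>
    ρ.act_mem q s x hx _ (ρ.toGrading.proj_mem s v)
  conv_rhs => rw [← ρ.proj_add v, map_add, map_add, Grading.proj_of_mem (h1 0),
    Grading.proj_of_mem (h1 1)]
  rcases zmod2_cases p with rfl | rfl <;> simp

/-- The submodule generated by a vector. -/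
def gen (ρ : Rep L V) (v : V) : Submodule ℂ V := sInf {N | ρ.IsSubmodule N ∧ v ∈ N}

theorem mem_gen (ρ : Rep L V) (v : V) : v ∈ ρ.gen v :=
  Submodule.mem_sInf.2 fun _ h => h.2

theorem gen_le {ρ : Rep L V} {v : V} {N : Submodule ℂ V} (hN : ρ.IsSubmodule N) (hv : v ∈ N) :
    ρ.gen v ≤ N :=
  sInf_le ⟨hN, hv⟩

theorem gen_isSubmodule (ρ : Rep L V) (v : V) : ρ.IsSubmodule (ρ.gen v) :=
  ⟨fun p w hw => Submodule.mem_sInf.2 fun N h => h.1.1 p w (Submodule.mem_sInf.1 hw N h),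
    fun x w hw => Submodule.mem_sInf.2 fun N h => h.1.2 x w (Submodule.mem_sInf.1 hw N h)⟩

/-- Even homomorphisms of modules. -/
def IsHom (ρ : Rep L V) (σ : Rep L W) (f : V →ₗ[ℂ] W) : Prop :=
  (∀ p v, f (ρ.proj p v) = σ.proj p (f v)) ∧ ∀ x v, f (ρ.act x v) = σ.act x (f v)

theorem IsHom.isSubmodule_map {ρ : Rep L V} {σ : Rep L W} {f : V →ₗ[ℂ] W} (hf : ρ.IsHom σ f)
    {N : Submodule ℂ V} (hN : ρ.IsSubmodule N) : σ.IsSubmodule (N.map f) := by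
  constructor
  · rintro p _ ⟨v, hv, rfl⟩
    exact ⟨_, hN.1 p v hv, hf.1 p v⟩
  · rintro x _ ⟨v, hv, rfl⟩
    exact ⟨_, hN.2 x v hv, hf.2 x v⟩

theorem IsHom.isSubmodule_comap {ρ : Rep L V} {σ : Rep L W} {f : V →ₗ[ℂ] W} (hf : ρ.IsHom σ f)
    {N : Submodule ℂ W} (hN : σ.IsSubmodule N) : ρ.IsSubmodule (N.comap f) := by
  constructor
  · intro p v hv
    rw [Submodule.mem_comap] at *
    rw [hf.1]; exact hN.1 p _ hv
  · intro p v hv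
    rw [Submodule.mem_comap] at *
    rw [hf.2]; exact hN.2 p _ hv

theorem isSubmodule_bot (ρ : Rep L V) : ρ.IsSubmodule ⊥ := by
  constructor
  · rintro p v hv; rw [Submodule.mem_bot] at *; rw [hv, map_zero]
  · rintro p v hv; rw [Submodule.mem_bot] at *; rw [hv, map_zero]

theorem isHom_subtype (ρ : Rep L V) {N : Submodule ℂ V} (hN : ρ.IsSubmodule N) :
    (ρ.restrict N hN).IsHom ρ N.subtype :=
  ⟨fun _ _ => rfl, fun _ _ => rfl⟩

theorem isHom_fst (ρ : Rep L V) (σ : Rep L W) :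
    (ρ.directSum σ).IsHom ρ (LinearMap.fst ℂ V W) := ⟨fun _ _ => rfl, fun _ _ => rfl⟩

theorem isHom_snd (ρ : Rep L V) (σ : Rep L W) :
    (ρ.directSum σ).IsHom σ (LinearMap.snd ℂ V W) := ⟨fun _ _ => rfl, fun _ _ => rfl⟩

theorem isHom_inr (ρ : Rep L V) (σ : Rep L W) :
    σ.IsHom (ρ.directSum σ) (LinearMap.inr ℂ V W) :=
  ⟨fun p _ => Prod.ext (map_zero (ρ.proj p)).symm rfl,
    fun x _ => Prod.ext (map_zero (ρ.act x)).symm rfl⟩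

/-- The quotient of a module by a submodule. -/
def quotient (ρ : Rep L V) (N : Submodule ℂ V) (hN : ρ.IsSubmodule N) : Rep L (V ⧸ N) where
  proj p := N.mapQ N (ρ.proj p) fun v hv => hN.1 p v hv
  proj_add v := by
    obtain ⟨v, rfl⟩ := N.mkQ_surjective v
    simp only [Submodule.mkQ_apply, Submodule.mapQ_apply, ← Submodule.Quotient.mk_add, ρ.proj_add]
  proj_proj p q v := by
    obtain ⟨v, rfl⟩ := N.mkQ_surjective v
    simp only [Submodule.mkQ_apply, Submodule.mapQ_apply, ρ.proj_proj]
    split_ifs <;> simp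
  act := LinearMap.mk₂ ℂ (fun x v => N.mapQ N (ρ.act x) (fun v hv => hN.2 x v hv) v)
    (fun x y v => by
      obtain ⟨v, rfl⟩ := N.mkQ_surjective v
      simp)
    (fun c x v => by
      obtain ⟨v, rfl⟩ := N.mkQ_surjective v
      simp)
    (fun x v w => map_add _ v w) (fun c x v => map_smul _ c v)
  act_mem p q x hx v hv := by
    rw [Grading.mem_part] at hv ⊢
    obtain ⟨v, rfl⟩ := N.mkQ_surjective v
    conv_lhs => rw [← hv]
    conv_rhs => rw [← hv]
    simp only [LinearMap.mk₂_apply, Submodule.mkQ_apply, Submodule.mapQ_apply]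
    rw [Grading.mem_part.1 (ρ.act_mem p q x hx _ (ρ.toGrading.proj_mem q v))]
  act_bracket p q x hx y hy v := by
    obtain ⟨v, rfl⟩ := N.mkQ_surjective v
    simp only [LinearMap.mk₂_apply, Submodule.mkQ_apply, Submodule.mapQ_apply,
      ρ.act_bracket p q x hx y hy, Submodule.Quotient.mk_sub, Submodule.Quotient.mk_smul]

theorem isHom_mkQ (ρ : Rep L V) {N : Submodule ℂ V} (hN : ρ.IsSubmodule N) :
    ρ.IsHom (ρ.quotient N hN) N.mkQ := ⟨fun _ _ => rfl, fun _ _ => rfl⟩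

end Rep

variable {a b : Type*} [Fintype a] [Fintype b] [DecidableEq a] [DecidableEq b]

namespace OspData

variable {G : Matrix (a ⊕ b) (a ⊕ b) ℂ} (D : OspData G)
  {V W : Type*} [AddCommGroup V] [Module ℂ V] [AddCommGroup W] [Module ℂ W]
  (ρ : Rep (osp G) V)
include D

theorem act_F_mem_weightSpace {lam : Module.Dual ℂ (cartan G)} {v : V}
    (hv : v ∈ ρ.weightSpace (cartan G) lam) (i j : a ⊕ b) :
    ρ.act (D.F i j) v ∈ ρ.weightSpace (cartan G) (lam + (entry G i - entry G j)) := by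
  intro h
  have := ρ.act_bracket 0 _ _ (D.cartan_mem_part h) _ (D.F_mem_part i j) v
  rw [sgn_zero_left, one_smul, hv h, D.bracket_cartan_F, map_smul, LinearMap.smul_apply,
    map_smul] at this
  rw [LinearMap.add_apply, add_smul, this]
  abel

/-- Even nonzero vectors of weight `lam` killed by the positive root vectors. -/
structure IsHighest (lam : Module.Dual ℂ (cartan G)) (v : V) : Prop where
  mem_weight : v ∈ ρ.weightSpace (cartan G) lam
  mem_part : v ∈ ρ.part 0
  ne_zero : v ≠ 0
  act_F : ∀ i j, D.r j < D.r i → ρ.act (D.F i j) v = 0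

/-- The span of the vectors obtained from `v` by applying negative root vectors. -/
def lowerSpan (v : V) : Submodule ℂ V :=
  sInf {N | v ∈ N ∧ ∀ i j, D.r i < D.r j → ∀ w ∈ N, ρ.act (D.F i j) w ∈ N}

variable {ρ} {D}

omit D in
theorem lowerSpan_le {D : OspData G} {v : V} {N : Submodule ℂ V} (hv : v ∈ N)
    (hN : ∀ i j, D.r i < D.r j → ∀ w ∈ N, ρ.act (D.F i j) w ∈ N) : D.lowerSpan ρ v ≤ N :=
  sInf_le ⟨hv, hN⟩

theorem mem_lowerSpan (v : V) : v ∈ D.lowerSpan ρ v := Submodule.mem_sInf.2 fun _ h => h.1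

theorem act_F_mem_lowerSpan {v w : V} (hw : w ∈ D.lowerSpan ρ v) {i j : a ⊕ b}
    (hij : D.r i < D.r j) : ρ.act (D.F i j) w ∈ D.lowerSpan ρ v :=
  Submodule.mem_sInf.2 fun N h => h.2 i j hij w (Submodule.mem_sInf.1 hw N h)

/-- This replaces the Poincaré–Birkhoff–Witt theorem. The vectors of the lower span that are carried
into it by every `x` include `v`, and they are stable under a negative root vector `F` because `x F
w = [x, F] w ± F x w`; by minimality they are the whole lower span. The grading is treated in the
same way. -/
theorem IsHighest.isSubmodule_lowerSpan {lam : Module.Dual ℂ (cartan G)} {v : V}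
    (hv : D.IsHighest ρ lam v) : ρ.IsSubmodule (D.lowerSpan ρ v) := by
  set P := D.lowerSpan ρ v with hP
  constructor
  · have : P ≤ P ⊓ ⨅ p, P.comap (ρ.proj p) := by
      refine lowerSpan_le ?_ ?_
      · simp only [Submodule.mem_inf, Submodule.mem_iInf, Submodule.mem_comap]
        refine ⟨mem_lowerSpan v, fun p => ?_⟩
        rw [Grading.proj_of_mem hv.mem_part]
        split_ifs
        · exact mem_lowerSpan v
        · exact P.zero_mem
      · intro i j hij w hw
        simp only [Submodule.mem_inf, Submodule.mem_iInf, Submodule.mem_comap] at hw ⊢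
        refine ⟨act_F_mem_lowerSpan hw.1 hij, fun p => ?_⟩
        have := ρ.act_proj (D.F_mem_part i j) (p - (par i + par j)) w
        rw [add_sub_cancel] at this
        rw [← this]
        exact act_F_mem_lowerSpan (hw.2 _) hij
    intro p w hw
    have := (this hw).2
    simp only [SetLike.mem_coe, Submodule.mem_iInf, Submodule.mem_comap] at this
    exact this p
  · have : P ≤ P ⊓ ⨅ x, P.comap (ρ.act x) := by
      refine lowerSpan_le ?_ ?_
      · simp only [Submodule.mem_inf, Submodule.mem_iInf, Submodule.mem_comap]
        refine ⟨mem_lowerSpan v, fun x => ?_⟩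
        refine D.induction_F (P := fun x => ρ.act x v ∈ P) (fun i j => ?_) ?_ ?_ x
        · rcases lt_trichotomy (D.r i) (D.r j) with h | h | h
          · exact act_F_mem_lowerSpan (mem_lowerSpan v) h
          · rw [D.r_inj h, hv.mem_weight ⟨D.F j j, D.F_self_mem j⟩]
            exact P.smul_mem _ (mem_lowerSpan v)
          · rw [hv.act_F i j h]; exact P.zero_mem
        · intro x y hx hy; rw [map_add]; exact P.add_mem hx hy
        · intro c x hx; rw [map_smul]; exact P.smul_mem c hx
      · intro i j hij w hw
        simp only [Submodule.mem_inf, Submodule.mem_iInf, Submodule.mem_comap] at hw ⊢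
        refine ⟨act_F_mem_lowerSpan hw.1 hij, fun x => ?_⟩
        refine (osp G).toGrading.induction
          (P := fun x => ρ.act x (ρ.act (D.F i j) w) ∈ P) ?_ ?_ x
        · intro x y hx hy; rw [map_add]; exact P.add_mem hx hy
        · intro p x hx
          have := ρ.act_bracket p _ x hx _ (D.F_mem_part i j) w
          rw [eq_add_of_sub_eq this.symm]
          exact P.add_mem (hw.2 _) (P.smul_mem _ (act_F_mem_lowerSpan (hw.2 x) hij))
    intro x w hw
    have := (this hw).2
    simp only [SetLike.mem_coe, Submodule.mem_iInf, Submodule.mem_comap] at this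
    exact this x

theorem act_F_mem_eigenspace {c : ℂ} {w : V}
    (hw : w ∈ Module.End.eigenspace (ρ.act (D.h0 : ospSpace G)) c) (i j : a ⊕ b) :
    ρ.act (D.F i j) w ∈
      Module.End.eigenspace (ρ.act (D.h0 : ospSpace G)) (c + (D.r i - D.r j)) := by
  rw [Module.End.mem_eigenspace_iff] at *
  have := ρ.act_bracket 0 _ _ (D.cartan_mem_part D.h0) _ (D.F_mem_part i j) w
  rw [sgn_zero_left, one_smul, hw, D.bracket_cartan_F, map_smul, LinearMap.smul_apply,
    map_smul, LinearMap.sub_apply, D.entry_h0, D.entry_h0] at this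
  rw [add_smul, this]
  abel

/-- Negative root vectors lower the eigenvalue of `h0` by positive integers, so everything generated
beyond `v` lies in strictly lower eigenspaces. -/
theorem IsHighest.gen_le {lam : Module.Dual ℂ (cartan G)} {v : V} (hv : D.IsHighest ρ lam v) :
    ρ.gen v ≤ Submodule.span ℂ {v} ⊔
      ⨆ n : ℕ, Module.End.eigenspace (ρ.act (D.h0 : ospSpace G)) (lam D.h0 - (n + 1)) := by
  refine (Rep.gen_le hv.isSubmodule_lowerSpan (mem_lowerSpan v)).trans (lowerSpan_le ?_ ?_)
  · exact Submodule.mem_sup_left (Submodule.mem_span_singleton_self v)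
  · intro i j hij w hw
    -- The drop of the eigenvalue is `d + 1`, in accordance with the indexing of the supremum by `n
    -- + 1`.
    obtain ⟨d, hd⟩ := Int.eq_ofNat_of_zero_le (a := D.r j - D.r i - 1) (by omega)
    have hd' : (D.r i : ℂ) - D.r j = -((d : ℂ) + 1) := by
      have : ((D.r j - D.r i - 1 : ℤ) : ℂ) = (d : ℤ) := congrArg _ hd
      push_cast at this
      linear_combination -this
    refine Submodule.mem_sup_right ?_
    rw [← Submodule.mem_comap]
    refine (sup_le ?_ (iSup_le fun m => ?_) : _ ≤ Submodule.comap _ _) hw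
    · rw [Submodule.span_singleton_le_iff_mem, Submodule.mem_comap]
      have h1 : v ∈ Module.End.eigenspace (ρ.act (D.h0 : ospSpace G)) (lam D.h0) :=
        Module.End.mem_eigenspace_iff.2 (hv.mem_weight D.h0)
      have h2 := act_F_mem_eigenspace h1 i j
      refine Submodule.mem_iSup_of_mem d ?_
      rwa [hd', ← sub_eq_add_neg] at h2
    · intro u hu
      rw [Submodule.mem_comap]
      have h2 := act_F_mem_eigenspace hu i j
      refine Submodule.mem_iSup_of_mem (m + d + 1) ?_
      have e : lam D.h0 - (((m + d + 1 : ℕ) : ℂ) + 1) =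
          lam D.h0 - ((m : ℂ) + 1) + (D.r i - D.r j) := by
        rw [hd']; push_cast; ring
      rwa [e]

/-- In a module generated by a highest weight vector, the highest weight space is a line. -/
theorem IsHighest.mem_span {lam : Module.Dual ℂ (cartan G)} {v w : V}
    (hv : D.IsHighest ρ lam v) (hw : w ∈ ρ.gen v)
    (hw' : ρ.act (D.h0 : ospSpace G) w = lam D.h0 • w) :
    w ∈ Submodule.span ℂ {v} := by
  obtain ⟨x, hx, y, hy, rfl⟩ := Submodule.mem_sup.1 (hv.gen_le hw)
  obtain ⟨c, rfl⟩ := Submodule.mem_span_singleton.1 hx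
  have hd := (Module.End.eigenspaces_iSupIndep (ρ.act (D.h0 : ospSpace G))) (lam D.h0)
  have h1 : y ∈ Module.End.eigenspace (ρ.act (D.h0 : ospSpace G)) (lam D.h0) := by
    rw [Module.End.mem_eigenspace_iff]
    rw [map_add, map_smul, hv.mem_weight D.h0, smul_add, smul_comm] at hw'
    exact add_left_cancel hw'
  have h2 : y ∈ ⨆ j, ⨆ (_ : j ≠ lam D.h0), Module.End.eigenspace (ρ.act (D.h0 : ospSpace G)) j := by
    refine (iSup_le fun n => ?_ : (⨆ n : ℕ, Module.End.eigenspace (ρ.act (D.h0 : ospSpace G))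
      (lam D.h0 - (n + 1))) ≤ _) hy
    refine le_iSup₂_of_le (lam D.h0 - (n + 1)) ?_ le_rfl
    intro h
    rw [sub_eq_self] at h
    exact Nat.cast_add_one_ne_zero n h
  have : y = 0 := (Submodule.disjoint_def.1 hd) y h1 h2
  rw [this, add_zero]
  exact hx

variable {τ : Rep (osp G) W}

/-- The pair `(v, u)` is a highest weight vector of the direct sum. The submodule `N` it generates
projects onto the module generated by `v`, and simplicity of the second factor makes this projection
injective, so `N` is the graph of the required map. -/
theorem exists_hom_of_isHighest {lam : Module.Dual ℂ (cartan G)} {v : V} {u : W}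
    (hv : D.IsHighest ρ lam v) (hτ : τ.IsSimple) (hu : D.IsHighest τ lam u) :
    ∃ f : ρ.gen v →ₗ[ℂ] W, (ρ.restrict _ (ρ.gen_isSubmodule v)).IsHom τ f ∧
      Function.Surjective f ∧ f ⟨v, ρ.mem_gen v⟩ = u := by
  have hvu : D.IsHighest (ρ.directSum τ) lam (v, u) := by
    refine ⟨fun h => Prod.ext (hv.mem_weight h) (hu.mem_weight h),
      Grading.mem_part.2 (Prod.ext (Grading.mem_part.1 hv.mem_part)
        (Grading.mem_part.1 hu.mem_part)),
      fun h => hv.ne_zero (congrArg Prod.fst h),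
      fun i j h => Prod.ext (hv.act_F i j h) (hu.act_F i j h)⟩
  set N := (ρ.directSum τ).gen (v, u) with hN
  have hNs : (ρ.directSum τ).IsSubmodule N := Rep.gen_isSubmodule _ _
  have hmem : (v, u) ∈ N := Rep.mem_gen _ _
  have hfst : ∀ n ∈ N, n.1 ∈ ρ.gen v := by
    have : N ≤ (ρ.gen v).comap (LinearMap.fst ℂ V W) :=
      Rep.gen_le ((ρ.isHom_fst τ).isSubmodule_comap (ρ.gen_isSubmodule v)) (ρ.mem_gen v)
    exact fun n hn => this hn
  -- The intersection of `N` with the second factor is zero or everything. In the latter case `(0,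
  -- u)` would lie in `N`, hence in the line of `(v, u)`, although `v ≠ 0`.
  have hzero : ∀ w, ((0 : V), w) ∈ N → w = 0 := by
    have hK := (ρ.isHom_inr τ).isSubmodule_comap hNs
    rcases hτ.2 _ hK with h | h
    · intro w hw
      have : w ∈ N.comap (LinearMap.inr ℂ V W) := hw
      rwa [h, Submodule.mem_bot] at this
    · exfalso
      have h0u : ((0 : V), u) ∈ N := by
        have : u ∈ N.comap (LinearMap.inr ℂ V W) := by rw [h]; trivial
        exact this
      have := hvu.mem_span h0u (Prod.ext (by simp [Rep.directSum]) (hu.mem_weight D.h0))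
      obtain ⟨c, hc⟩ := Submodule.mem_span_singleton.1 this
      have h1 : c • v = 0 := congrArg Prod.fst hc
      have h2 : c • u = u := congrArg Prod.snd hc
      rw [(smul_eq_zero.1 h1).resolve_right hv.ne_zero, zero_smul] at h2
      exact hu.ne_zero h2.symm
  let p : N →ₗ[ℂ] ρ.gen v := (LinearMap.fst ℂ V W ∘ₗ N.subtype).codRestrict _ fun n => hfst n n.2
  have hp : Function.Bijective p := by
    constructor
    · rw [← LinearMap.ker_eq_bot, LinearMap.ker_eq_bot']
      rintro ⟨⟨x, w⟩, hn⟩ h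
      have hx : x = 0 := congrArg Subtype.val h
      subst hx
      have := hzero w hn
      subst this; rfl
    · rintro ⟨x, hx⟩
      have : x ∈ N.map (LinearMap.fst ℂ V W) :=
        Rep.gen_le ((ρ.isHom_fst τ).isSubmodule_map hNs) ⟨_, hmem, rfl⟩ hx
      obtain ⟨n, hn, rfl⟩ := this
      exact ⟨⟨n, hn⟩, rfl⟩
  let e := LinearEquiv.ofBijective p hp
  let f : ρ.gen v →ₗ[ℂ] W := LinearMap.snd ℂ V W ∘ₗ N.subtype ∘ₗ e.symm.toLinearMap
  have hf : ∀ n (hn : n ∈ N), f ⟨n.1, hfst n hn⟩ = n.2 := by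
    intro n hn
    have : e.symm ⟨n.1, hfst n hn⟩ = ⟨n, hn⟩ := by
      rw [LinearEquiv.symm_apply_eq]; rfl
    simp only [f, LinearMap.comp_apply, LinearEquiv.coe_coe, this]; rfl
  have hex : ∀ x : ρ.gen v, ∃ w, ((x : V), w) ∈ N := by
    intro x
    obtain ⟨n, hn⟩ := hp.2 x
    refine ⟨n.1.2, ?_⟩
    rw [← hn]; exact n.2
  refine ⟨f, ⟨?_, ?_⟩, ?_, hf _ hmem⟩
  · intro q x
    obtain ⟨w, hw⟩ := hex x
    rw [show x = ⟨_, hfst _ hw⟩ from rfl, hf _ hw]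
    exact hf _ (hNs.1 q _ hw)
  · intro q x
    obtain ⟨w, hw⟩ := hex x
    rw [show x = ⟨_, hfst _ hw⟩ from rfl, hf _ hw]
    exact hf _ (hNs.2 q _ hw)
  · intro w
    have hM := (ρ.isHom_snd τ).isSubmodule_map hNs
    rcases hτ.2 _ hM with h | h
    · exfalso
      have : u ∈ N.map (LinearMap.snd ℂ V W) := ⟨_, hmem, rfl⟩
      rw [h, Submodule.mem_bot] at this
      exact hu.ne_zero this
    · have : w ∈ N.map (LinearMap.snd ℂ V W) := by rw [h]; trivial
      obtain ⟨n, hn, rfl⟩ := this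
      exact ⟨_, hf n hn⟩

/-! ### The Casimir operator -/

variable (D ρ) in
/-- The Casimir operator. -/
def casimir : V →ₗ[ℂ] V :=
  ∑ i, ∑ j, sgn (par j) (par j) • (ρ.act (D.F i j) ∘ₗ ρ.act (D.F j i))

variable (D ρ) in
theorem casimir_apply (v : V) : D.casimir ρ v =
    ∑ i, ∑ j, sgn (par j) (par j) • ρ.act (D.F i j) (ρ.act (D.F j i) v) := by
  simp [casimir, LinearMap.sum_apply]

/-- Moving `x` through both factors of `F i j F j i` gives four commutator sums by `bracket_F`;
after relabelling they cancel in pairs. -/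
theorem act_casimir (x : ospSpace G) (v : V) :
    ρ.act x (D.casimir ρ v) = D.casimir ρ (ρ.act x v) := by
  refine (osp G).toGrading.induction
    (P := fun x => ρ.act x (D.casimir ρ v) = D.casimir ρ (ρ.act x v)) ?_ ?_ x
  · intro x y hx hy; simp only [map_add, LinearMap.add_apply, hx, hy]
  intro p x hx
  have hcomm : ∀ i j w, ρ.act x (ρ.act (D.F i j) w) =
      ∑ s, x.1 s i • ρ.act (D.F s j) w - sgn p (par i + par j) • ∑ t, x.1 j t • ρ.act (D.F i t) w +
        sgn p (par i + par j) • ρ.act (D.F i j) (ρ.act x w) := by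
    intro i j w
    have := ρ.act_bracket p _ x hx _ (D.F_mem_part i j) w
    rw [eq_add_of_sub_eq this.symm, D.bracket_F hx]
    simp only [map_sub, map_smul, map_sum, LinearMap.sub_apply, LinearMap.smul_apply,
      LinearMap.sum_apply]
  have hterm : ∀ i j, ρ.act x (ρ.act (D.F i j) (ρ.act (D.F j i) v)) =
      ∑ s, x.1 s i • ρ.act (D.F s j) (ρ.act (D.F j i) v)
      - sgn p (par i + par j) • ∑ t, x.1 j t • ρ.act (D.F i t) (ρ.act (D.F j i) v)
      + sgn p (par i + par j) • ∑ s, x.1 s j • ρ.act (D.F i j) (ρ.act (D.F s i) v)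
      - ∑ t, x.1 i t • ρ.act (D.F i j) (ρ.act (D.F j t) v)
      + ρ.act (D.F i j) (ρ.act (D.F j i) (ρ.act x v)) := by
    intro i j
    rw [hcomm i j, hcomm j i, add_comm (par j)]
    simp only [map_add, map_sub, map_smul, map_sum, smul_add, smul_sub, smul_smul, sgn_mul_self,
      one_smul]
    abel
  rw [casimir_apply, casimir_apply]
  simp only [map_sum, map_smul, hterm, smul_add, smul_sub, Finset.sum_add_distrib,
    Finset.sum_sub_distrib]
  have e1 : ∑ i, ∑ j, sgn (par j) (par j) • ∑ s, x.1 s i • ρ.act (D.F s j) (ρ.act (D.F j i) v) =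
      ∑ i, ∑ j, sgn (par j) (par j) • ∑ t, x.1 i t • ρ.act (D.F i j) (ρ.act (D.F j t) v) := by
    simp only [Finset.smul_sum]
    rw [Finset.sum_comm]
    conv_rhs => rw [Finset.sum_comm]
    refine Finset.sum_congr rfl fun j _ => ?_
    rw [Finset.sum_comm]
  -- Only entries with `|j| + |t| = p` contribute. For these the sign `(-1)^{|j|}` in the Casimir
  -- operator is precisely what makes the two sums agree.
  have e2 : ∑ i, ∑ j, sgn (par j) (par j) • sgn p (par i + par j) •
        ∑ t, x.1 j t • ρ.act (D.F i t) (ρ.act (D.F j i) v) =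
      ∑ i, ∑ j, sgn (par j) (par j) • sgn p (par i + par j) •
        ∑ s, x.1 s j • ρ.act (D.F i j) (ρ.act (D.F s i) v) := by
    refine Finset.sum_congr rfl fun i _ => ?_
    simp only [Finset.smul_sum]
    rw [Finset.sum_comm]
    refine Finset.sum_congr rfl fun t _ => Finset.sum_congr rfl fun j _ => ?_
    simp only [smul_smul]
    by_cases h : par j + par t = p
    · congr 1
      subst h
      rcases zmod2_cases (par i) with h1 | h1 <;> rcases zmod2_cases (par j) with h2 | h2 <;>
        rcases zmod2_cases (par t) with h3 | h3 <;> simp [h1, h2, h3, sgn, zmod2_add_self]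
    · rw [D.apply_eq_zero hx h]; simp
  rw [e1, e2]
  abel

theorem casimir_proj (p : ZMod 2) (v : V) :
    D.casimir ρ (ρ.proj p v) = ρ.proj p (D.casimir ρ v) := by
  rw [casimir_apply, casimir_apply]
  simp only [map_sum, map_smul]
  refine Finset.sum_congr rfl fun i _ => Finset.sum_congr rfl fun j _ => ?_
  rw [ρ.act_proj (D.F_mem_part j i), ρ.act_proj (D.F_mem_part i j), add_comm (par j), ← add_assoc,
    zmod2_add_self, zero_add]

end OspData

end

/-! ### The Casimir eigenvalue and modules of dimension at most one -/

section

variable {a b : Type*} [Fintype a] [Fintype b] [DecidableEq a] [DecidableEq b]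

namespace OspData

variable {G : Matrix (a ⊕ b) (a ⊕ b) ℂ} (D : OspData G)
  {V W : Type*} [AddCommGroup V] [Module ℂ V] [AddCommGroup W] [Module ℂ W]
  {ρ : Rep (osp G) V}
include D

variable (a b) in
omit [DecidableEq a] [DecidableEq b] D in
/-- The superdimension of the standard module. -/
def sdim : ℂ := ∑ i : a ⊕ b, sgn (par i) (par i)

variable {D}

theorem lt_top {i j : a ⊕ b} (h : D.r j < D.r i) : j ≠ D.top := by
  rintro rfl; exact absurd (D.r_le i) (not_le.2 h)

theorem σ_top_lt {i j : a ⊕ b} (h : D.r j < D.r i) : i ≠ D.σ D.top := by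
  rintro rfl
  have := D.r_le (D.σ j)
  rw [D.r_σ] at *; omega

theorem r_top_pos : 0 < D.r D.top := by
  have h1 := D.r_le (D.σ D.top)
  rw [D.r_σ] at h1
  rcases lt_or_eq_of_le (show 0 ≤ D.r D.top by omega) with h | h
  · exact h
  · exact absurd (D.r_inj (by rw [D.r_σ, ← h, neg_zero])) D.σ_top

/-- In each summand either the inner factor raises the weight and kills `v`, or the factors are
Cartan elements, or the product may be replaced by its bracket, which acts on `v` by a scalar. The
diagonal terms contribute 8 and the others `2 (2 sdim - 4)`. -/
theorem IsHighest.casimir_eq {v : V} (hv : D.IsHighest ρ (2 • entry G D.top) v) :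
    D.casimir ρ v = (4 * sdim a b) • v := by
  set t := D.top with ht
  have hl : ∀ i, ρ.act (D.F i i) v =
      (2 * ((if t = i then 1 else 0) - if t = D.σ i then 1 else 0) : ℂ) • v := by
    intro i
    have := hv.mem_weight ⟨D.F i i, D.F_self_mem i⟩
    rw [LinearMap.smul_apply, D.entry_F_self] at this
    rw [nsmul_eq_mul] at this
    exact this
  have hστ : ∀ i, t = D.σ i ↔ i = D.σ t := fun i => by
    rw [D.eq_σ_iff]; exact eq_comm
  simp only [hστ] at hl
  -- The scalar by which the `(i, j)` term acts. The first two lines are the squares of `F i i` at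
  -- `i = t` and `i = σ t`. The others are the brackets with `i = t` or `j = σ t`, where the weight
  -- is nonzero; the subtracted corrections cancel the contributions of the diagonal pairs and of
  -- `(t, σ t)`, where `F t (σ t) = 0`.
  let κ : a ⊕ b → a ⊕ b → ℂ := fun i j =>
    (if i = j then if i = t then 4 else 0 else 0) +
    (if i = j then if i = D.σ t then 4 else 0 else 0) +
    (if i = t then 2 * sgn (par j) (par j) - (if j = t then 2 else 0) - (if j = D.σ t then 2 else 0)
      else 0) +
    (if j = D.σ t then
      2 * sgn (par i) (par i) - (if i = t then 2 else 0) - (if i = D.σ t then 2 else 0) else 0)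
  have hpt : sgn (par t) (par t) = 1 := by rw [ht, D.par_top, sgn_zero_left]
  have hpt' : sgn (par (D.σ t)) (par (D.σ t)) = 1 := by rw [D.par_σ, hpt]
  have htt : t ≠ D.σ t := D.σ_top.symm
  have key : ∀ i j, sgn (par j) (par j) • ρ.act (D.F i j) (ρ.act (D.F j i) v) = κ i j • v := by
    intro i j
    rcases lt_trichotomy (D.r i) (D.r j) with h | h | h
    · have h1 : i ≠ t := lt_top h
      have h2 : j ≠ D.σ t := σ_top_lt h
      have h3 : i ≠ j := by rintro rfl; exact lt_irrefl _ h
      rw [hv.act_F j i h]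
      simp [κ, h1, h2, h3]
    · have := D.r_inj h
      subst this
      rw [hl, map_smul, hl, smul_smul, smul_smul]
      congr 1
      by_cases h1 : i = t
      · subst h1
        simp only [κ, hpt, htt, if_true, if_false]; norm_num
      · by_cases h2 : i = D.σ t
        · have h3 : ¬ t = i := fun h => h1 h.symm
          simp only [κ, h2, hpt', htt, htt.symm, if_true, if_false]; norm_num
        · have h3 : ¬ t = i := fun h => h1 h.symm
          simp [κ, h1, h2, h3]
    · have h1 : j ≠ t := lt_top h
      have h2 : i ≠ D.σ t := σ_top_lt h
      have h3 : i ≠ j := by rintro rfl; exact lt_irrefl _ h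
      have hbr := ρ.act_bracket _ _ _ (D.F_mem_part i j) _ (D.F_mem_part j i) v
      rw [hv.act_F i j h, map_zero, smul_zero, sub_zero] at hbr
      rw [← hbr]
      have h1' : ¬ t = j := fun h => h1 h.symm
      by_cases hσ : j = D.σ i
      · subst hσ
        rcases zmod2_cases (par i) with hi | hi
        · rw [D.F_σ_of_even hi]
          simp only [map_zero, LinearMap.zero_apply, smul_zero]
          by_cases hit : i = t
          · subst hit
            simp [κ, h3, hpt, hpt', htt.symm]
          · have : D.σ i ≠ D.σ t := by rwa [Ne, D.σ_inj]
            simp [κ, h3, hit, this]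
        · have hit : i ≠ t := by rintro rfl; rw [ht, D.par_top] at hi; exact zero_ne_one hi
          have hit' : D.σ i ≠ D.σ t := by rwa [Ne, D.σ_inj]
          have hit'' : ¬ t = i := fun h => hit h.symm
          rw [D.bracket_F_σ_of_odd hi, map_smul, map_sub, LinearMap.smul_apply,
            LinearMap.sub_apply, hl, hl]
          have h4 : D.σ i ≠ t := h1
          have h5 : ¬ t = D.σ i := fun h => h4 h.symm
          simp [κ, h3, hit, hit', hit'', h2, h5]
      · rw [D.bracket_F_F hσ, map_sub, map_smul, LinearMap.sub_apply, LinearMap.smul_apply, hl, hl,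
          smul_smul, ← sub_smul, smul_smul]
        congr 1
        by_cases hit : i = t
        · subst hit
          simp [κ, h3, h1, hσ, htt, mul_comm]
        · have hit'' : ¬ t = i := fun h => hit h.symm
          by_cases hj : j = D.σ t
          · have h6 : ¬ i = D.σ t := h2
            have hp0 : par t = 0 := D.par_top
            simp only [κ, h6, hj, hit, hit'', htt, htt.symm, if_true, if_false, D.par_σ, hp0, add_zero,
              sgn_zero_left]
            ring
          · have h6 : ¬ i = D.σ t := h2
            simp [κ, h3, h1', h6, hj, hit, hit'']
  rw [casimir_apply]
  simp only [key, ← Finset.sum_smul]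
  congr 1
  simp only [κ, Finset.sum_add_distrib]
  simp only [Finset.sum_ite_eq, Finset.mem_univ, if_true]
  rw [Finset.sum_comm (f := fun i j => if j = D.σ t then _ else _)]
  have e : ∀ (s : a ⊕ b) (f : a ⊕ b → a ⊕ b → ℂ),
      ∑ i, ∑ j, (if i = s then f i j else 0) = ∑ j, f s j := by
    intro s f
    rw [Finset.sum_eq_single s]
    · simp
    · intro i _ hi; simp [hi]
    · simp
  rw [e t, e (D.σ t) (fun j i => 2 * sgn (par i) (par i) - (if i = t then 2 else 0) -
    (if i = D.σ t then 2 else 0))]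
  simp only [Finset.sum_sub_distrib, Finset.sum_ite_eq', Finset.mem_univ, if_true,
    ← Finset.mul_sum]
  rw [sdim]; ring

theorem F_σσ_self (i : a ⊕ b) : D.F (D.σ i) (D.σ i) = -D.F i i := by
  apply Subtype.ext; ext x y
  change (D.F (D.σ i) (D.σ i)).1 x y = -(D.F i i).1 x y
  rw [D.F_apply, D.F_apply, D.coef_self, D.coef_self, D.σσ]; ring

/-- The brackets of opposite root vectors give `F i i v = ± F j j v` for `j` of the other parity.
Replacing `j` by `σ j` preserves the sign but negates `F j j`, so `F i i v` equals its own negative.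
-/
theorem act_eq_zero_of_F {v : V} (h : ∀ i j, i ≠ j → ρ.act (D.F i j) v = 0) (x : ospSpace G) :
    ρ.act x v = 0 := by
  have key : ∀ i j, j ≠ i → j ≠ D.σ i → ρ.act (D.F i i) v =
      sgn (par i + par j) (par i + par j) • ρ.act (D.F j j) v := by
    intro i j h1 h2
    have := ρ.act_bracket _ _ _ (D.F_mem_part i j) _ (D.F_mem_part j i) v
    rw [h i j h1.symm, h j i h1, map_zero, map_zero, smul_zero, sub_zero, D.bracket_F_F h2,
      map_sub, map_smul, LinearMap.sub_apply, LinearMap.smul_apply] at this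
    exact sub_eq_zero.1 this
  refine D.induction_F (P := fun x => ρ.act x v = 0) (fun i j => ?_) ?_ ?_ x
  · by_cases hij : i = j
    · subst hij
      obtain ⟨j, hj⟩ : ∃ j : a ⊕ b, par j ≠ par i := by
        rcases zmod2_cases (par i) with hi | hi
        · obtain ⟨y⟩ := D.nonempty_odd
          exact ⟨Sum.inr y, by rw [hi]; exact one_ne_zero⟩
        · exact ⟨D.top, by rw [hi, D.par_top]; exact zero_ne_one⟩
      have h1 : j ≠ i := by rintro rfl; exact hj rfl
      have h2 : j ≠ D.σ i := by rintro rfl; exact hj (D.par_σ i)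
      have h3 : D.σ j ≠ i := by rintro rfl; exact hj (D.par_σ j).symm
      have h4 : D.σ j ≠ D.σ i := by rwa [Ne, D.σ_inj]
      have e1 := key i j h1 h2
      have e2 := key i (D.σ j) h3 h4
      rw [F_σσ_self, map_neg, LinearMap.neg_apply, smul_neg, D.par_σ, ← e1] at e2
      have h5 : (2 : ℂ) • ρ.act (D.F i i) v = 0 := by
        rw [two_smul]; exact add_eq_zero_iff_eq_neg.2 e2
      exact (smul_eq_zero.1 h5).resolve_left two_ne_zero
    · exact h i j hij
  · intro x y hx hy; rw [map_add, LinearMap.add_apply, hx, hy, add_zero]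
  · intro c x hx; rw [map_smul, LinearMap.smul_apply, hx, smul_zero]

/-- All operators are scalars and commute, so the bracket of `h0` with `F i j`, which is `(r i - r
j) F i j`, acts by zero. -/
theorem act_eq_zero_of_finrank_le_one [FiniteDimensional ℂ V] (h : Module.finrank ℂ V ≤ 1)
    (x : ospSpace G) (v : V) : ρ.act x v = 0 := by
  have hs : ∀ f : V →ₗ[ℂ] V, ∃ c : ℂ, ∀ w, f w = c • w := by
    intro f
    obtain ⟨u, hu⟩ := finrank_le_one_iff.1 h
    obtain ⟨c, hc⟩ := hu (f u)
    refine ⟨c, fun w => ?_⟩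
    obtain ⟨d, rfl⟩ := hu w
    rw [map_smul, ← hc, smul_comm]
  refine act_eq_zero_of_F (D := D) (fun i j hij => ?_) x
  have := ρ.act_bracket 0 _ _ (D.cartan_mem_part D.h0) _ (D.F_mem_part i j) v
  obtain ⟨c, hc⟩ := hs (ρ.act (D.h0 : ospSpace G))
  rw [sgn_zero_left, one_smul, D.bracket_cartan_F, map_smul, hc, hc, map_smul, sub_self,
    LinearMap.smul_apply, LinearMap.sub_apply, D.entry_h0, D.entry_h0] at this
  refine (smul_eq_zero.1 this).resolve_left ?_
  intro e
  exact hij (D.r_inj (by exact_mod_cast sub_eq_zero.1 e))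

theorem casimir_eq_zero {v : V} (h : ∀ x, ρ.act x v = 0) : D.casimir ρ v = 0 := by
  rw [casimir_apply]; simp [h]

theorem casimir_mem {N : Submodule ℂ V} (hN : ρ.IsSubmodule N) {v : V}
    (h : ∀ x, ρ.act x v ∈ N) : D.casimir ρ v ∈ N := by
  rw [casimir_apply]
  exact N.sum_mem fun i _ => N.sum_mem fun j _ => N.smul_mem _ (hN.2 _ _ (h _))

theorem casimir_of_mem_gen {v w : V} {c : ℂ} (hv : D.casimir ρ v = c • v) (hw : w ∈ ρ.gen v) :
    D.casimir ρ w = c • w := by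
  have : ρ.IsSubmodule (LinearMap.eqLocus (D.casimir ρ) (c • LinearMap.id)) := by
    constructor
    · intro p u hu
      simp only [LinearMap.mem_eqLocus, LinearMap.smul_apply, LinearMap.id_apply] at hu ⊢
      rw [casimir_proj, hu, map_smul]
    · intro x u hu
      simp only [LinearMap.mem_eqLocus, LinearMap.smul_apply, LinearMap.id_apply] at hu ⊢
      rw [← act_casimir, hu, map_smul]
  exact Rep.gen_le this hv hw

end OspData

end

section

/-! ### Bases of weight vectors -/

theorem finrank_eq_card_of_basis {J V : Type*} [AddCommGroup V] [Module ℂ V] [Fintype J]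
    (B : Module.Basis J ℂ V) (S : Submodule ℂ V) (P : J → Prop)
    (h : ∀ v, v ∈ S ↔ ∀ j, B.repr v j ≠ 0 → P j) : Module.finrank ℂ S = Nat.card {j // P j} := by
  classical
  have : S = Submodule.span ℂ (Set.range fun j : {j // P j} => B j) := by
    ext v
    have e : (Set.range fun j : {j // P j} => B j) = B '' {j | P j} := by
      ext x; simp
    rw [h, e, Module.Basis.mem_span_image]
    simp [Set.subset_def]
  rw [this, Nat.card_eq_fintype_card]
  exact finrank_span_eq_card (B.linearIndependent.comp _ Subtype.val_injective)

namespace Rep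

variable {g : Type*} [AddCommGroup g] [Module ℂ g] {L : LieSuperalgebra g}
  {V : Type*} [AddCommGroup V] [Module ℂ V] {𝔥 : Submodule ℂ g}

/-- A basis of homogeneous weight vectors. -/
structure IsWeightBasis {J : Type*} (ρ : Rep L V) (𝔥 : Submodule ℂ g) (B : Module.Basis J ℂ V)
    (wt : J → Module.Dual ℂ 𝔥) (pr : J → ZMod 2) : Prop where
  mem_weight : ∀ j, B j ∈ ρ.weightSpace 𝔥 (wt j)
  mem_part : ∀ j, B j ∈ ρ.part (pr j)

variable {J : Type*} [Fintype J] {ρ : Rep L V} {B : Module.Basis J ℂ V}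
  {wt : J → Module.Dual ℂ 𝔥} {pr : J → ZMod 2}

theorem IsWeightBasis.repr_act (hB : ρ.IsWeightBasis 𝔥 B wt pr) (h : 𝔥) (v : V) (j : J) :
    B.repr (ρ.act h v) j = wt j h * B.repr v j := by
  classical
  conv_lhs => rw [← B.sum_repr v]
  rw [map_sum, map_sum, Finsupp.finsetSum_apply, Finset.sum_eq_single j]
  · rw [map_smul, hB.mem_weight j h]; simp [mul_comm]
  · intro i _ hi
    rw [map_smul, hB.mem_weight i h]; simp [hi.symm]
  · simp

theorem IsWeightBasis.repr_proj (hB : ρ.IsWeightBasis 𝔥 B wt pr) (p : ZMod 2) (v : V) (j : J) :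
    B.repr (ρ.proj p v) j = if pr j = p then B.repr v j else 0 := by
  classical
  conv_lhs => rw [← B.sum_repr v]
  rw [map_sum, map_sum, Finsupp.finsetSum_apply, Finset.sum_eq_single j]
  · rw [map_smul, Grading.proj_of_mem (hB.mem_part j)]
    by_cases h : pr j = p
    · simp [h]
    · simp [h, Ne.symm h]
  · intro i _ hi
    rw [map_smul, Grading.proj_of_mem (hB.mem_part i)]
    split_ifs <;> simp [hi.symm]
  · simp

theorem IsWeightBasis.mem_weightSpace_iff (hB : ρ.IsWeightBasis 𝔥 B wt pr)
    {lam : Module.Dual ℂ 𝔥} {v : V} :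
    v ∈ ρ.weightSpace 𝔥 lam ↔ ∀ j, B.repr v j ≠ 0 → wt j = lam := by
  constructor
  · intro hv j hj
    ext h
    have := hB.repr_act h v j
    rw [hv h, map_smul, Finsupp.smul_apply, smul_eq_mul] at this
    exact (mul_right_cancel₀ hj this).symm
  · intro hv h
    refine B.repr.injective (Finsupp.ext fun j => ?_)
    rw [hB.repr_act, map_smul, Finsupp.smul_apply, smul_eq_mul]
    by_cases hj : B.repr v j = 0
    · rw [hj, mul_zero, mul_zero]
    · rw [hv j hj]

theorem IsWeightBasis.mem_part_iff (hB : ρ.IsWeightBasis 𝔥 B wt pr) {p : ZMod 2} {v : V} :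
    v ∈ ρ.part p ↔ ∀ j, B.repr v j ≠ 0 → pr j = p := by
  rw [Grading.mem_part]
  constructor
  · intro hv j hj
    have := hB.repr_proj p v j
    rw [hv] at this
    by_contra h
    rw [if_neg h] at this
    exact hj this
  · intro hv
    refine B.repr.injective (Finsupp.ext fun j => ?_)
    rw [hB.repr_proj]
    by_cases hj : B.repr v j = 0
    · simp [hj]
    · rw [if_pos (hv j hj)]

theorem IsWeightBasis.ch_eq (hB : ρ.IsWeightBasis 𝔥 B wt pr) (lam : Module.Dual ℂ 𝔥) :
    ρ.ch 𝔥 lam = Nat.card {j // wt j = lam} :=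
  finrank_eq_card_of_basis B _ _ fun _ => hB.mem_weightSpace_iff

theorem IsWeightBasis.chPart_eq (hB : ρ.IsWeightBasis 𝔥 B wt pr) (p : ZMod 2)
    (lam : Module.Dual ℂ 𝔥) : ρ.chPart 𝔥 p lam = Nat.card {j // wt j = lam ∧ pr j = p} := by
  refine finrank_eq_card_of_basis B _ _ fun v => ?_
  rw [Submodule.mem_inf, hB.mem_weightSpace_iff]
  refine (and_congr Iff.rfl hB.mem_part_iff).trans ?_
  exact ⟨fun h j hj => ⟨h.1 j hj, h.2 j hj⟩,
    fun h => ⟨fun j hj => (h j hj).1, fun j hj => (h j hj).2⟩⟩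

theorem IsWeightBasis.hasCharacter (hB : ρ.IsWeightBasis 𝔥 B wt pr) : ρ.HasCharacter 𝔥 := by
  have := Module.Finite.of_basis B
  refine ⟨?_, fun _ => inferInstance⟩
  rw [eq_top_iff, ← B.span_eq, Submodule.span_le]
  rintro _ ⟨j, rfl⟩
  exact Submodule.mem_iSup_of_mem (wt j) (hB.mem_weight j)

/-- A subspace stable under `𝔥` contains each basis vector of multiplicity-free weight which
occurs in one of its members. -/
theorem IsWeightBasis.mem_of_repr_ne_zero (hB : ρ.IsWeightBasis 𝔥 B wt pr) {N : Submodule ℂ V}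
    (hN : ∀ x, ∀ v ∈ N, ρ.act x v ∈ N) {m : V} (hm : m ∈ N) {j : J} (hj : B.repr m j ≠ 0)
    (hsep : ∀ i, i ≠ j → wt i ≠ wt j) : B j ∈ N := by
  classical
  have key : ∀ A : Finset J, j ∉ A → ∃ m ∈ N, B.repr m j ≠ 0 ∧ ∀ i ∈ A, B.repr m i = 0 := by
    intro A
    induction A using Finset.induction_on with
    | empty => intro _; exact ⟨m, hm, hj, by simp⟩
    | insert i A hi ih =>
      intro hjA
      rw [Finset.mem_insert, not_or] at hjA
      obtain ⟨n, hn, hnj, hnA⟩ := ih hjA.2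
      obtain ⟨h, hh⟩ : ∃ h, wt i h ≠ wt j h := by
        by_contra hc
        push Not at hc
        exact hsep i (Ne.symm hjA.1) (LinearMap.ext hc)
      -- The operator `h - wt i h` removes the coordinate `i`, rescales the coordinate `j` by a
      -- nonzero number because `h` separates the two weights, and leaves vanishing coordinates
      -- zero.
      refine ⟨ρ.act h n - wt i h • n, N.sub_mem (hN _ _ hn) (N.smul_mem _ hn), ?_, ?_⟩
      · rw [map_sub, map_smul, Finsupp.sub_apply, hB.repr_act, Finsupp.smul_apply, smul_eq_mul,
          ← sub_mul]
        exact mul_ne_zero (sub_ne_zero.2 hh.symm) hnj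
      · intro k hk
        rw [map_sub, map_smul, Finsupp.sub_apply, hB.repr_act, Finsupp.smul_apply, smul_eq_mul,
          ← sub_mul]
        rcases Finset.mem_insert.1 hk with rfl | hk
        · rw [sub_self, zero_mul]
        · rw [hnA k hk, mul_zero]
  obtain ⟨n, hn, hnj, hn0⟩ := key (Finset.univ.erase j) (by simp)
  have : n = B.repr n j • B j := by
    conv_lhs => rw [← B.sum_repr n]
    refine Finset.sum_eq_single j (fun i _ hi => ?_) (by simp)
    rw [hn0 i (by simp [hi]), zero_smul]
  rw [this] at hn
  exact (N.smul_mem_iff hnj).1 hn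

theorem act_rootSpace_mem {lam α : Module.Dual ℂ 𝔥} {x : g} (h0 : ∀ h : 𝔥, (h : g) ∈ L.part 0)
    (hx : x ∈ L.rootSpace 𝔥 α) {v : V} (hv : v ∈ ρ.weightSpace 𝔥 lam) :
    ρ.act x v ∈ ρ.weightSpace 𝔥 (lam + α) := by
  intro h
  have key : ∀ y, ρ.act (L.bracket h y) v = ρ.act h (ρ.act y v) - ρ.act y (ρ.act h v) := by
    refine L.toGrading.induction ?_ ?_
    · intro y z hy hz; simp only [map_add, LinearMap.add_apply, hy, hz]; abel
    · intro p y hy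
      rw [ρ.act_bracket 0 p _ (h0 h) _ hy, sgn_zero_left, one_smul]
  have := key x
  rw [hx h, hv h, map_smul, map_smul, LinearMap.smul_apply] at this
  rw [LinearMap.add_apply, add_smul, this]
  abel

end Rep

variable {a b : Type*} [Fintype a] [Fintype b] [DecidableEq a] [DecidableEq b]

/-- The base `S` of simple roots is adapted to the order given by the rank function. -/
structure OspData.Adapted {G : Matrix (a ⊕ b) (a ⊕ b) ℂ} (D : OspData G)
    (S : Set (Module.Dual ℂ (cartan G))) : Prop where
  pos : ∀ α ∈ S, ∃ n : ℕ, 0 < n ∧ α D.h0 = n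
  mem : ∀ i j, D.r j < D.r i → entry G i - entry G j ∈ AddSubmonoid.closure S

namespace OspData

variable {G : Matrix (a ⊕ b) (a ⊕ b) ℂ} {D : OspData G} {S : Set (Module.Dual ℂ (cartan G))}
  {V W : Type*} [AddCommGroup V] [Module ℂ V] [AddCommGroup W] [Module ℂ W]
  {ρ : Rep (osp G) V}

theorem Adapted.pos_of_mem (hS : D.Adapted S) {α : Module.Dual ℂ (cartan G)}
    (hα : α ∈ AddSubmonoid.closure S) (h0 : α ≠ 0) : ∃ n : ℕ, 0 < n ∧ α D.h0 = n := by
  have : α = 0 ∨ ∃ n : ℕ, 0 < n ∧ α D.h0 = n := by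
    clear h0
    induction hα using AddSubmonoid.closure_induction with
    | mem x hx => exact Or.inr (hS.pos x hx)
    | zero => exact Or.inl rfl
    | add x y _ _ hx hy =>
      rcases hx with rfl | ⟨n, hn, hx⟩
      · rwa [zero_add]
      · rcases hy with rfl | ⟨m, hm, hy⟩
        · rw [add_zero]; exact Or.inr ⟨n, hn, hx⟩
        · exact Or.inr ⟨n + m, by omega, by rw [LinearMap.add_apply, hx, hy]; push_cast; rfl⟩
  exact this.resolve_left h0

theorem Adapted.exists_isHighest (hS : D.Adapted S) {lam : Module.Dual ℂ (cartan G)}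
    (h : ρ.IsSimpleOfHighestWeight (cartan G) S lam) : ∃ v, D.IsHighest ρ lam v := by
  obtain ⟨-, v, hv, hv0, hk⟩ := h
  refine ⟨v, hv.1, hv.2, hv0, fun i j hij => ?_⟩
  refine hk _ (hS.mem i j hij) ?_ _ (D.F_mem_rootSpace i j)
  rw [sub_ne_zero]
  intro e
  rw [D.entry_injective e] at hij
  exact lt_irrefl _ hij

/-- The vector already has the maximal eigenvalue `c` of `h0`, and a positive root would raise it.
This verifies the highest weight condition for whole root spaces without determining them. -/
theorem Adapted.act_eq_zero (hS : D.Adapted S) {J : Type*} [Fintype J] {B : Module.Basis J ℂ V}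
    {wt : J → Module.Dual ℂ (cartan G)} {pr : J → ZMod 2}
    (hB : ρ.IsWeightBasis (cartan G) B wt pr) {lam : Module.Dual ℂ (cartan G)} {m : J → ℤ} {c : ℤ}
    (hwt : ∀ j, wt j D.h0 = m j) (hlam : lam D.h0 = c) (hm : ∀ j, m j ≤ c)
    {v : V} (hv : v ∈ ρ.weightSpace (cartan G) lam) {α : Module.Dual ℂ (cartan G)}
    (hα : α ∈ AddSubmonoid.closure S) (hα0 : α ≠ 0) {x : ospSpace G}
    (hx : x ∈ (osp G).rootSpace (cartan G) α) : ρ.act x v = 0 := by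
  have h1 := Rep.act_rootSpace_mem (D.cartan_mem_part) hx hv
  rw [hB.mem_weightSpace_iff] at h1
  refine B.repr.injective (Finsupp.ext fun j => ?_)
  rw [map_zero, Finsupp.zero_apply]
  by_contra hj
  have h2 := LinearMap.congr_fun (h1 j hj) D.h0
  obtain ⟨n, hn, hαn⟩ := hS.pos_of_mem hα hα0
  rw [hwt, LinearMap.add_apply, hlam, hαn] at h2
  have h3 : m j = c + n := by exact_mod_cast h2
  have := hm j
  omega

/-! ### The standard module -/

/-- The standard basis vectors. -/
def stdVec (i : a ⊕ b) : a ⊕ b → ℂ := Pi.single i 1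

omit [Fintype a] [Fintype b] in
theorem stdVec_mem_part (i : a ⊕ b) : stdVec i ∈ (vecGrading a b).part (par i) := by
  rw [mem_vecPart]
  intro j hj
  rw [stdVec, Pi.single_eq_of_ne]
  rintro rfl; exact hj rfl

theorem standard_act_stdVec (x : ospSpace G) (i : a ⊕ b) :
    (standard G).act x (stdVec i) = ∑ s, x.1 s i • stdVec s := by
  change Matrix.toLin' x.1 (Pi.single i 1) = _
  rw [Matrix.toLin'_apply, Matrix.mulVec_single_one]
  ext j
  simp [stdVec, Finset.sum_apply, Pi.single_apply]

theorem standard_act_F (i j c : a ⊕ b) : (standard G).act (D.F i j) (stdVec c) =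
    (if c = j then stdVec i else 0) - if c = D.σ i then D.coef i j • stdVec (D.σ j) else 0 := by
  rw [standard_act_stdVec]
  simp only [F_apply, sub_smul, Finset.sum_sub_distrib, ite_and]
  congr 1
  · simp
  · rw [Finset.sum_eq_single (D.σ j)]
    · simp
    · intro s _ hs; simp [hs]
    · simp

theorem standard_isWeightBasis (D : OspData G) : (standard G).IsWeightBasis (cartan G)
    (Pi.basisFun ℂ (a ⊕ b)) (entry G) par := by
  constructor
  · intro j h
    rw [Pi.basisFun_apply]
    refine (standard_act_stdVec _ j).trans ?_
    rw [Finset.sum_eq_single j]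
    · rfl
    · intro s _ hs
      rw [D.cartan_apply, if_neg hs, zero_smul]
    · simp
  · intro j
    rw [Pi.basisFun_apply]
    exact stdVec_mem_part j

theorem exists_ne (D : OspData G) (i : a ⊕ b) : ∃ j, j ≠ i ∧ j ≠ D.σ i := by
  obtain ⟨j, hj⟩ : ∃ j : a ⊕ b, par j ≠ par i := by
    rcases zmod2_cases (par i) with hi | hi
    · obtain ⟨y⟩ := D.nonempty_odd
      exact ⟨Sum.inr y, by rw [hi]; exact one_ne_zero⟩
    · exact ⟨D.top, by rw [hi, D.par_top]; exact zero_ne_one⟩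
  exact ⟨j, by rintro rfl; exact hj rfl, by rintro rfl; exact hj (D.par_σ i)⟩

theorem standard_isSimple (D : OspData G) : (standard G).IsSimple := by
  refine ⟨⟨stdVec D.top, 0, by simp [stdVec]⟩, fun N hN => ?_⟩
  have hB := D.standard_isWeightBasis
  by_cases h : N = ⊥
  · exact Or.inl h
  right
  obtain ⟨m, hm, hm0⟩ := Submodule.exists_mem_ne_zero_of_ne_bot h
  obtain ⟨j, hj⟩ : ∃ j, (Pi.basisFun ℂ (a ⊕ b)).repr m j ≠ 0 := by
    by_contra hc
    push Not at hc
    exact hm0 ((Pi.basisFun ℂ (a ⊕ b)).repr.injective (Finsupp.ext (by simpa using hc)))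
  have h1 := hB.mem_of_repr_ne_zero hN.2 hm hj fun i hi e => hi (D.entry_injective e)
  rw [Pi.basisFun_apply] at h1
  -- For `i ≠ σ c` the element `F i c` carries `e_c` to `e_i`. The excluded vector `e_{σ j}` is
  -- reached from `e_j` through an intermediate index.
  have step : ∀ i c, i ≠ D.σ c → stdVec c ∈ N → stdVec i ∈ N := by
    intro i c hi hc
    have := hN.2 (D.F i c) _ hc
    rw [standard_act_F, if_pos rfl, if_neg (fun h => hi (D.eq_σ_iff.2 h.symm)), sub_zero] at this
    exact this
  obtain ⟨c, hc, hc'⟩ := D.exists_ne j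
  have h2 := step c j hc' h1
  have hall : ∀ i, stdVec i ∈ N := by
    intro i
    by_cases hi : i = D.σ j
    · exact step i c (by rw [hi, Ne, D.σ_inj]; exact hc.symm) h2
    · exact step i j hi h1
  rw [eq_top_iff, ← (Pi.basisFun ℂ (a ⊕ b)).span_eq, Submodule.span_le]
  rintro _ ⟨i, rfl⟩
  rw [Pi.basisFun_apply]; exact hall i

theorem Adapted.standard (hS : D.Adapted S) :
    (standard G).IsSimpleOfHighestWeight (cartan G) S (entry G D.top) := by
  have hB := D.standard_isWeightBasis
  have h1 := hB.mem_weight D.top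
  have h2 := hB.mem_part D.top
  rw [D.par_top] at h2
  refine ⟨D.standard_isSimple, _, ⟨h1, h2⟩, (Pi.basisFun ℂ (a ⊕ b)).ne_zero _, ?_⟩
  intro α hα hα0 x hx
  exact hS.act_eq_zero hB D.entry_h0 (D.entry_h0 _) D.r_le h1 hα hα0 hx

end OspData

end

/-! ### The symmetric square: action, basis and character -/

section

variable {a b : Type*} [Fintype a] [Fintype b] [DecidableEq a] [DecidableEq b]

namespace OspData

/-- The symmetric square of the standard module. -/
abbrev sq (G : Matrix (a ⊕ b) (a ⊕ b) ℂ) : Rep (osp G) (standard G).symSq := (standard G).symSquare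

omit [DecidableEq a] [DecidableEq b] [Fintype a] [Fintype b] in
theorem flip_stdVec [DecidableEq a] [DecidableEq b] (i j : a ⊕ b) :
    (vecGrading a b).flip (stdVec i ⊗ₜ stdVec j) = sgn (par i) (par j) • (stdVec j ⊗ₜ stdVec i) :=
  Grading.flip_tmul (stdVec_mem_part i) (stdVec_mem_part j)

/-- The symmetric product of two standard basis vectors. -/
def q (G : Matrix (a ⊕ b) (a ⊕ b) ℂ) (i j : a ⊕ b) : (standard G).symSq :=
  ⟨stdVec i ⊗ₜ stdVec j + sgn (par i) (par j) • (stdVec j ⊗ₜ stdVec i), by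
    rw [Grading.mem_symSq]
    change (vecGrading a b).flip _ = _
    rw [map_add, map_smul, flip_stdVec, flip_stdVec, smul_smul, sgn_comm (par j), sgn_mul_self,
      one_smul, add_comm]⟩

variable {G : Matrix (a ⊕ b) (a ⊕ b) ℂ} {D : OspData G} {S : Set (Module.Dual ℂ (cartan G))}

theorem coe_q (i j : a ⊕ b) : (q G i j : (a ⊕ b → ℂ) ⊗[ℂ] (a ⊕ b → ℂ)) =
    stdVec i ⊗ₜ stdVec j + sgn (par i) (par j) • (stdVec j ⊗ₜ stdVec i) := rfl

theorem q_comm (i j : a ⊕ b) : q G i j = sgn (par i) (par j) • q G j i := by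
  apply Subtype.ext
  rw [SetLike.val_smul, coe_q, coe_q, smul_add, smul_smul, sgn_comm (par j), sgn_mul_self, one_smul,
    add_comm]

theorem q_self_of_odd {i : a ⊕ b} (hi : par i = 1) : q G i i = 0 := by
  apply Subtype.ext
  rw [coe_q, hi, sgn, if_pos ⟨rfl, rfl⟩]
  exact (congrArg (fun t => stdVec i ⊗ₜ[ℂ] stdVec i + t) (neg_one_smul ℂ _)).trans (add_neg_cancel _)

theorem q_mem_part (i j : a ⊕ b) : q G i j ∈ (sq G).part (par i + par j) := by
  refine Grading.mem_restrict_part.2 ?_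
  rw [coe_q]
  refine Submodule.add_mem _ (Grading.tmul_mem_tensor (stdVec_mem_part i) (stdVec_mem_part j))
    (Submodule.smul_mem _ _ ?_)
  rw [add_comm]
  exact Grading.tmul_mem_tensor (stdVec_mem_part j) (stdVec_mem_part i)

theorem sq_act_q {p : ZMod 2} {x : ospSpace G} (hx : x ∈ (osp G).part p) (i j : a ⊕ b) :
    ((sq G).act x (q G i j) : (a ⊕ b → ℂ) ⊗[ℂ] (a ⊕ b → ℂ)) =
      (standard G).act x (stdVec i) ⊗ₜ stdVec j +
        sgn p (par i) • (stdVec i ⊗ₜ (standard G).act x (stdVec j)) +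
      sgn (par i) (par j) • ((standard G).act x (stdVec j) ⊗ₜ stdVec i +
        sgn p (par j) • (stdVec j ⊗ₜ (standard G).act x (stdVec i))) := by
  change (standard G).tensorAct (standard G) x (q G i j).1 = _
  rw [coe_q, map_add, map_smul, Rep.tensorAct_tmul _ _ hx (stdVec_mem_part i),
    Rep.tensorAct_tmul _ _ hx (stdVec_mem_part j)]

theorem q_mem_weightSpace (D : OspData G) (i j : a ⊕ b) :
    q G i j ∈ (sq G).weightSpace (cartan G) (entry G i + entry G j) := by
  intro h
  have hw : ∀ i, (standard G).act h (stdVec i) = entry G i h • stdVec i := by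
    intro i
    have := D.standard_isWeightBasis.mem_weight i h
    rwa [Pi.basisFun_apply] at this
  apply Subtype.ext
  rw [sq_act_q (D.cartan_mem_part h), hw, hw, SetLike.val_smul, coe_q]
  simp only [sgn_zero_left, LinearMap.add_apply, ← TensorProduct.smul_tmul', one_smul,
    TensorProduct.tmul_smul]
  module

/-- The hypotheses keep the twisted half of `F i j` from acting, so it merely replaces `j` by `i`:
once if `d ≠ j`, twice if `d = j`. The product of an odd vector with itself is zero, whence the
nonvanishing condition. -/
theorem act_F_q {i j d : a ⊕ b} (h1 : j ≠ D.σ i) (h2 : d ≠ D.σ i) :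
    ∃ c : ℂ, c ≠ 0 ∧ (q G j d ≠ 0 → (sq G).act (D.F i j) (q G j d) = c • q G i d) := by
  by_cases hd : d = j
  · subst hd
    refine ⟨2, two_ne_zero, fun hq => ?_⟩
    rcases zmod2_cases (par d) with hp | hp
    · apply Subtype.ext
      rw [sq_act_q (D.F_mem_part i d), standard_act_F, if_pos rfl, if_neg h1, sub_zero,
        SetLike.val_smul, coe_q, hp]
      simp only [sgn_zero_right, one_smul]
      module
    · exact absurd (q_self_of_odd hp) hq
  · refine ⟨1, one_ne_zero, fun _ => ?_⟩
    apply Subtype.ext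
    rw [sq_act_q (D.F_mem_part i j), standard_act_F, standard_act_F, if_pos rfl, if_neg h1,
      if_neg hd, if_neg h2, sub_zero, sub_zero, one_smul, coe_q]
    simp only [TensorProduct.tmul_zero, TensorProduct.zero_tmul, smul_zero, add_zero, zero_add,
      smul_smul]
    rw [sgn_add_left, mul_left_comm, sgn_mul_self, mul_one]

/-- Here the twisted half does act, on the second factor. The lemma links the weight-zero products
for `i` and `j` modulo any submodule containing the product on the left. -/
theorem act_F_q_dual {i j : a ⊕ b} (h1 : j ≠ D.σ i) :
    ∃ c : ℂ, (sq G).act (D.F i j) (q G j (D.σ i)) = q G i (D.σ i) + c • q G j (D.σ j) := by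
  refine ⟨-(sgn (par i + par j) (par j) * D.coef i j), ?_⟩
  apply Subtype.ext
  rw [sq_act_q (D.F_mem_part i j), standard_act_F, standard_act_F, if_pos rfl, if_neg h1,
    if_neg (Ne.symm h1), if_pos rfl, sub_zero, zero_sub, Submodule.coe_add, SetLike.val_smul,
    coe_q, coe_q, D.par_σ, D.par_σ]
  simp only [TensorProduct.tmul_neg, TensorProduct.neg_tmul, TensorProduct.tmul_smul,
    ← TensorProduct.smul_tmul']
  have hi := sgn_mul_self (par i) (par j)
  have hj := sgn_mul_self (par j) (par j)
  rw [sgn_add_left, sgn_add_left, sgn_comm (par j) (par i)]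
  match_scalars <;> first
    | ring1
    | linear_combination (sgn (par i) (par i)) * hi
    | linear_combination (sgn (par i) (par j) * D.coef i j) * hj

/-! ### A basis of the symmetric square -/

variable (D) in
/-- The index set of a basis of the symmetric square. -/
abbrev Pairs : Type _ :=
  {x : (a ⊕ b) × (a ⊕ b) // D.r x.2 ≤ D.r x.1 ∧ ¬(x.1 = x.2 ∧ par x.1 = 1)}

variable (a b) in
/-- The basis of the tensor square of the standard module. -/
abbrev tensorBasis : Module.Basis ((a ⊕ b) × (a ⊕ b)) ℂ ((a ⊕ b → ℂ) ⊗[ℂ] (a ⊕ b → ℂ)) :=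
  (Pi.basisFun ℂ (a ⊕ b)).tensorProduct (Pi.basisFun ℂ (a ⊕ b))

theorem tensorBasis_apply (i j : a ⊕ b) : tensorBasis a b (i, j) = stdVec i ⊗ₜ stdVec j := by
  rw [Module.Basis.tensorProduct_apply, Pi.basisFun_apply, Pi.basisFun_apply]; rfl

theorem repr_q (i j c d : a ⊕ b) : (tensorBasis a b).repr (q G i j).1 (c, d) =
    (if c = i ∧ d = j then 1 else 0) + sgn (par i) (par j) * if c = j ∧ d = i then 1 else 0 := by
  rw [coe_q, ← tensorBasis_apply, ← tensorBasis_apply, map_add, map_smul, Module.Basis.repr_self,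
    Module.Basis.repr_self, Finsupp.add_apply, Finsupp.smul_apply, Finsupp.single_apply,
    Finsupp.single_apply]
  simp only [Prod.mk.injEq, smul_eq_mul, eq_comm (a := c), eq_comm (a := d)]

omit [Fintype a] [Fintype b] [DecidableEq a] [DecidableEq b] in
theorem not_and_swap {i j : a ⊕ b} (h : ¬(i = j ∧ par i = 1)) : ¬(j = i ∧ par j = 1) := by
  rintro ⟨rfl, hp⟩; exact h ⟨rfl, hp⟩

theorem repr_q_pair (x y : Pairs D) (h : x ≠ y) :
    (tensorBasis a b).repr (q G x.1.1 x.1.2).1 y.1 = 0 := by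
  obtain ⟨⟨i, j⟩, hx, hx'⟩ := x
  obtain ⟨⟨c, d⟩, hy, hy'⟩ := y
  rw [repr_q, if_neg, if_neg, mul_zero, add_zero]
  · rintro ⟨rfl, rfl⟩
    have := D.r_inj (le_antisymm hx hy)
    simp only at this
    subst this; exact h rfl
  · rintro ⟨rfl, rfl⟩; exact h rfl

theorem repr_q_self (x : Pairs D) :
    (tensorBasis a b).repr (q G x.1.1 x.1.2).1 x.1 ≠ 0 := by
  obtain ⟨⟨i, j⟩, hx, hx'⟩ := x
  rw [repr_q, if_pos ⟨rfl, rfl⟩]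
  by_cases h : i = j
  · subst h
    have : par i = 0 := (zmod2_cases _).resolve_right fun h => hx' ⟨rfl, h⟩
    simp [this, sgn]
  · simp [h]

/-- The product attached to a pair has tensor coordinates only at that pair and its swap. Of these
just one is ordered by rank, so the coordinates indexed by `Pairs` form a diagonal matrix. -/
theorem q_linearIndependent (D : OspData G) :
    LinearIndependent ℂ fun x : Pairs D => q G x.1.1 x.1.2 := by
  rw [Fintype.linearIndependent_iffₛ]
  intro f f' hf x
  have key : ∀ f : Pairs D → ℂ, (tensorBasis a b).repr (∑ x, f x • q G x.1.1 x.1.2 :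
      (standard G).symSq).1 x.1 = f x * (tensorBasis a b).repr (q G x.1.1 x.1.2).1 x.1 := by
    intro f
    simp only [AddSubmonoidClass.coe_finsetSum, map_sum, SetLike.val_smul, map_smul,
      Finsupp.finsetSum_apply, Finsupp.smul_apply]
    exact Finset.sum_eq_single x (fun y _ hy => by rw [repr_q_pair y x hy, smul_zero]) (by simp)
  refine mul_right_cancel₀ (repr_q_self x) ?_
  rw [← key, ← key, hf]

theorem mem_span_q (t : (standard G).symSq) :
    t ∈ Submodule.span ℂ (Set.range fun x : (a ⊕ b) × (a ⊕ b) => q G x.1 x.2) := by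
  have key : (2 : ℂ)⁻¹ • ∑ x : (a ⊕ b) × (a ⊕ b), (tensorBasis a b).repr t.1 x • q G x.1 x.2 = t := by
    apply Subtype.ext
    have h1 := (tensorBasis a b).sum_repr t.1
    have h2 : (vecGrading a b).flip t.1 = t.1 := Grading.mem_symSq.1 t.2
    -- Each product is a basis tensor plus its flip, so the sum is `t` plus the flip of `t`, and `t`
    -- is fixed by the flip.
    have h3 : ∑ x : (a ⊕ b) × (a ⊕ b), (tensorBasis a b).repr t.1 x • (q G x.1 x.2).1 = t.1 + t.1 := by
      have h4 : t.1 = ∑ x, (tensorBasis a b).repr t.1 x • (vecGrading a b).flip (tensorBasis a b x) := by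
        simp only [← map_smul, ← map_sum]
        rw [h1, h2]
      calc _ = ∑ x, (tensorBasis a b).repr t.1 x • tensorBasis a b x +
            ∑ x, (tensorBasis a b).repr t.1 x • (vecGrading a b).flip (tensorBasis a b x) := by
            rw [← Finset.sum_add_distrib]
            refine Finset.sum_congr rfl fun x _ => ?_
            rw [show x = (x.1, x.2) from rfl, tensorBasis_apply, flip_stdVec, coe_q, smul_add]
        _ = t.1 + t.1 := by rw [h1, ← h4]
    rw [SetLike.val_smul, AddSubmonoidClass.coe_finsetSum]
    simp only [SetLike.val_smul]
    rw [h3, ← two_smul ℂ t.1, smul_smul, inv_mul_cancel₀ two_ne_zero, one_smul]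
  rw [← key]
  exact Submodule.smul_mem _ _ (Submodule.sum_mem _ fun x _ =>
    Submodule.smul_mem _ _ (Submodule.subset_span ⟨x, rfl⟩))

theorem q_cases (D : OspData G) {P : (standard G).symSq → Prop} (h0 : P 0)
    (hs : ∀ (c : ℂ) t, P t → P (c • t)) (h : ∀ x : Pairs D, P (q G x.1.1 x.1.2)) (i j : a ⊕ b) :
    P (q G i j) := by
  by_cases hij : i = j ∧ par i = 1
  · obtain ⟨rfl, hp⟩ := hij
    rw [q_self_of_odd hp]; exact h0
  · rcases le_total (D.r j) (D.r i) with hr | hr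
    · exact h ⟨(i, j), hr, hij⟩
    · rw [q_comm]
      exact hs _ _ (h ⟨(j, i), hr, not_and_swap hij⟩)

variable (D) in
/-- The basis of the symmetric square consisting of symmetric products of standard basis vectors. -/
def qBasis : Module.Basis (Pairs D) ℂ (standard G).symSq :=
  Module.Basis.mk D.q_linearIndependent (by
    rintro t -
    have hle : Submodule.span ℂ (Set.range fun x : (a ⊕ b) × (a ⊕ b) => q G x.1 x.2) ≤
        Submodule.span ℂ (Set.range fun x : Pairs D => q G x.1.1 x.1.2) := by
      rw [Submodule.span_le]
      rintro _ ⟨⟨i, j⟩, rfl⟩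
      exact q_cases D
        (P := fun t => t ∈ Submodule.span ℂ (Set.range fun x : Pairs D => q G x.1.1 x.1.2))
        (Submodule.zero_mem _) (fun c t ht => Submodule.smul_mem _ c ht)
        (fun x => Submodule.subset_span ⟨x, rfl⟩) i j
    exact hle (mem_span_q t))

theorem qBasis_apply (x : Pairs D) : D.qBasis x = q G x.1.1 x.1.2 := by simp [qBasis]

theorem sq_isWeightBasis (D : OspData G) : (sq G).IsWeightBasis (cartan G) D.qBasis
    (fun x => entry G x.1.1 + entry G x.1.2) (fun x => par x.1.1 + par x.1.2) := by
  constructor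
  · intro x; rw [qBasis_apply]; exact D.q_mem_weightSpace _ _
  · intro x; rw [qBasis_apply]; exact q_mem_part _ _

theorem entry_add_eq_zero (D : OspData G) {i j : a ⊕ b} :
    entry G i + entry G j = 0 ↔ j = D.σ i := by
  rw [add_comm, add_eq_zero_iff_eq_neg, ← D.entry_σ, D.entry_injective.eq_iff]

/-- This is multiplicity one for the nonzero weights of the symmetric square. When `i ≠ σ i`, a
Cartan element detecting `i` shows that `i` is `c` or `d`. Otherwise `e_i` has weight zero and `j`
plays this role; both cannot have weight zero. -/
theorem entry_add_eq_entry_add (D : OspData G) {i j c d : a ⊕ b}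
    (h : entry G i + entry G j = entry G c + entry G d)
    (h0 : entry G i + entry G j ≠ 0) : (i = c ∧ j = d) ∨ (i = d ∧ j = c) := by
  have key : ∀ i j c d : a ⊕ b, i ≠ D.σ i → entry G i + entry G j = entry G c + entry G d →
      entry G i + entry G j ≠ 0 → i = c ∨ i = d := by
    intro i j c d hi h h0
    rw [Ne, D.entry_add_eq_zero] at h0
    -- As `j ≠ σ i`, the left-hand weight takes a value at least 1 on this element; if `c` and `d`
    -- both differ from `i`, the right-hand one takes a value at most 0.
    let f : a ⊕ b → ℂ := fun x => (if x = i then 1 else 0) - if x = D.σ i then 1 else 0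
    have hf : ∀ x, f (D.σ x) = -f x := by
      intro x
      have e : D.σ x = i ↔ x = D.σ i := by rw [D.eq_σ_iff]
      simp only [f, D.σ_inj, e]; ring
    have h1 := LinearMap.congr_fun h (D.cart f hf)
    simp only [LinearMap.add_apply, D.entry_cart] at h1
    by_contra hc
    push Not at hc
    simp only [f, if_true, if_neg hi, if_neg h0, if_neg hc.1.symm, if_neg hc.2.symm] at h1
    split_ifs at h1 <;> norm_num at h1
  have fin : ∀ i j c d : a ⊕ b, entry G i + entry G j = entry G c + entry G d → i = c ∨ i = d →
      (i = c ∧ j = d) ∨ (i = d ∧ j = c) := by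
    rintro i j c d h (rfl | rfl)
    · exact Or.inl ⟨rfl, D.entry_injective (add_left_cancel h)⟩
    · rw [add_comm (entry G c)] at h
      exact Or.inr ⟨rfl, D.entry_injective (add_left_cancel h)⟩
  by_cases hi : i = D.σ i
  · by_cases hj : j = D.σ j
    · exfalso
      have e : ∀ x, x = D.σ x → entry G x = 0 := by
        intro x hx
        have := D.entry_σ x
        rw [← hx] at this
        have h2 : (2 : ℂ) • entry G x = 0 := by
          rw [two_smul]; exact add_eq_zero_iff_eq_neg.2 this
        exact (smul_eq_zero.1 h2).resolve_left two_ne_zero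
      rw [e i hi, e j hj, add_zero] at h0
      exact h0 rfl
    · rw [add_comm (entry G i)] at h h0
      rcases fin _ _ _ _ h (key j i c d hj h h0) with ⟨h1, h2⟩ | ⟨h1, h2⟩
      · exact Or.inr ⟨h2, h1⟩
      · exact Or.inl ⟨h2, h1⟩
  · exact fin _ _ _ _ h (key i j c d hi h h0)

theorem entry_add_injOn {x y : Pairs D}
    (h : entry G x.1.1 + entry G x.1.2 = entry G y.1.1 + entry G y.1.2)
    (h0 : entry G x.1.1 + entry G x.1.2 ≠ 0) : x = y := by
  obtain ⟨⟨i, j⟩, hx, hx'⟩ := x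
  obtain ⟨⟨c, d⟩, hy, hy'⟩ := y
  rcases D.entry_add_eq_entry_add h h0 with ⟨h1, h2⟩ | ⟨h1, h2⟩
  · simp only at h1 h2; subst h1 h2; rfl
  · simp only at h1 h2; subst h1 h2
    have := D.r_inj (le_antisymm hx hy)
    simp only at this; subst this; rfl

theorem card_zero_weight (D : OspData G) :
    Nat.card {x : Pairs D // entry G x.1.1 + entry G x.1.2 = 0} = Nat.card {i // 0 ≤ D.r i} := by
  refine Nat.card_congr
    { toFun := fun x => ⟨x.1.1.1, ?_⟩
      invFun := fun i => ⟨⟨(i.1, D.σ i.1), ?_, ?_⟩, ?_⟩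
      left_inv := ?_
      right_inv := ?_ }
  · have h1 := x.1.2.1
    rw [D.entry_add_eq_zero.1 x.2, D.r_σ] at h1
    omega
  · have := i.2
    change D.r (D.σ i) ≤ D.r i
    rw [D.r_σ]; omega
  -- An odd index fixed by `σ` would satisfy `η i = -η i`, so that the form would degenerate.
  · rintro ⟨h, hp⟩
    have h1 := D.η_σ i.1
    simp only at h
    rw [← h, hp] at h1
    have h2 := D.η_ne i.1
    simp only [sgn, and_self, if_true, neg_one_mul] at h1
    have h3 : (2 : ℂ) * D.η i.1 = 0 := by linear_combination h1
    exact h2 ((mul_eq_zero.1 h3).resolve_left two_ne_zero)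
  · exact D.entry_add_eq_zero.2 rfl
  · rintro ⟨⟨⟨i, j⟩, hx, hx'⟩, h⟩
    have := D.entry_add_eq_zero.1 h
    simp only at this; subst this; rfl
  · intro i; rfl

theorem sq_ch (D : OspData G) : (sq G).ch (cartan G) = charSum (Nat.card {i // 0 ≤ D.r i})
    {α | α ≠ 0 ∧ ∃ i j : a ⊕ b, ¬(i = j ∧ par i = 1) ∧ α = entry G i + entry G j} := by
  funext lam
  rw [D.sq_isWeightBasis.ch_eq, charSum]
  by_cases h : lam = 0
  · subst h
    rw [D.card_zero_weight]; simp
  · rw [if_neg h, zero_add]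
    have hsub : Subsingleton {x : Pairs D // entry G x.1.1 + entry G x.1.2 = lam} :=
      ⟨fun x y => Subtype.ext (entry_add_injOn (x.2.trans y.2.symm) (x.2.symm ▸ h))⟩
    split_ifs with hc
    · obtain ⟨-, i, j, hij, rfl⟩ := hc
      rw [Nat.card_eq_one_iff_unique]
      refine ⟨hsub, ?_⟩
      rcases le_total (D.r j) (D.r i) with hr | hr
      · exact ⟨⟨(i, j), hr, hij⟩, rfl⟩
      · exact ⟨⟨(j, i), hr, not_and_swap hij⟩, add_comm _ _⟩
    · rw [Nat.card_eq_zero]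
      left
      constructor
      rintro ⟨x, hx⟩
      exact hc ⟨h, _, _, x.2.2, hx.symm⟩

theorem sq_chPart (D : OspData G) (p : ZMod 2) : (sq G).chPart (cartan G) p =
    charSum (if p = 0 then Nat.card {i // 0 ≤ D.r i} else 0)
    {α | α ≠ 0 ∧ ∃ i j : a ⊕ b, ¬(i = j ∧ par i = 1) ∧ par i + par j = p ∧
      α = entry G i + entry G j} := by
  funext lam
  rw [D.sq_isWeightBasis.chPart_eq, charSum]
  by_cases h : lam = 0
  · subst h
    have e : ∀ x : Pairs D, entry G x.1.1 + entry G x.1.2 = 0 → par x.1.1 + par x.1.2 = 0 := by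
      intro x hx
      rw [D.entry_add_eq_zero.1 hx, D.par_σ, zmod2_add_self]
    rw [if_pos rfl]
    split_ifs with hp
    · rename_i h; exact absurd rfl h.1
    · subst hp
      rw [← D.card_zero_weight, add_zero]
      exact Nat.card_congr (Equiv.subtypeEquivRight fun x => ⟨And.left, fun h => ⟨h, e x h⟩⟩)
    · rename_i h; exact absurd rfl h.1
    · rw [Nat.card_eq_zero]
      left
      constructor
      rintro ⟨x, hx, hx'⟩
      exact hp (hx'.symm.trans (e x hx))
  · rw [if_neg h, zero_add]
    have hsub : Subsingleton
        {x : Pairs D // entry G x.1.1 + entry G x.1.2 = lam ∧ par x.1.1 + par x.1.2 = p} :=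
      ⟨fun x y => Subtype.ext (entry_add_injOn (x.2.1.trans y.2.1.symm) (x.2.1.symm ▸ h))⟩
    split_ifs with hc
    · obtain ⟨-, i, j, hij, hp, rfl⟩ := hc
      rw [Nat.card_eq_one_iff_unique]
      refine ⟨hsub, ?_⟩
      rcases le_total (D.r j) (D.r i) with hr | hr
      · exact ⟨⟨(i, j), hr, hij⟩, rfl, hp⟩
      · exact ⟨⟨(j, i), hr, not_and_swap hij⟩, add_comm _ _,
          (add_comm _ _).trans hp⟩
    · rw [Nat.card_eq_zero]
      left
      constructor
      rintro ⟨x, hx, hx'⟩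
      exact hc ⟨h, _, _, x.2.2, hx', hx.symm⟩

end OspData

end

/-! ### Submodules of the symmetric square and the dimension of `L(2ε₁)` -/

section

variable {a b : Type*} [Fintype a] [Fintype b] [DecidableEq a] [DecidableEq b]

namespace OspData

variable {G : Matrix (a ⊕ b) (a ⊕ b) ℂ} {D : OspData G} {S : Set (Module.Dual ℂ (cartan G))}

theorem q_ne_zero (D : OspData G) {i j : a ⊕ b} (h : ¬(i = j ∧ par i = 1)) : q G i j ≠ 0 := by
  rcases le_total (D.r j) (D.r i) with hr | hr
  · rw [← D.qBasis_apply ⟨(i, j), hr, h⟩]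
    exact D.qBasis.ne_zero _
  · rw [q_comm, ← D.qBasis_apply ⟨(j, i), hr, not_and_swap h⟩]
    exact smul_ne_zero (sgn_ne_zero _ _) (D.qBasis.ne_zero _)

theorem q_ne_zero_of_ne (D : OspData G) {i j : a ⊕ b} (h : i ≠ j) : q G i j ≠ 0 :=
  D.q_ne_zero fun e => h e.1

theorem Adapted.q_top_killed (hS : D.Adapted S) {α : Module.Dual ℂ (cartan G)}
    (hα : α ∈ AddSubmonoid.closure S) (hα0 : α ≠ 0) {x : ospSpace G}
    (hx : x ∈ (osp G).rootSpace (cartan G) α) : (sq G).act x (q G D.top D.top) = 0 := by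
  refine hS.act_eq_zero D.sq_isWeightBasis (m := fun x => D.r x.1.1 + D.r x.1.2)
    (c := D.r D.top + D.r D.top) ?_ ?_ ?_ (D.q_mem_weightSpace _ _) hα hα0 hx
  · intro x
    rw [LinearMap.add_apply, D.entry_h0, D.entry_h0]; push_cast; rfl
  · rw [LinearMap.add_apply, D.entry_h0]; push_cast; rfl
  · intro x; exact add_le_add (D.r_le _) (D.r_le _)

theorem q_top_mem_weightSpace (D : OspData G) :
    q G D.top D.top ∈ (sq G).weightSpace (cartan G) (2 • entry G D.top) := by
  rw [two_smul]; exact D.q_mem_weightSpace _ _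

theorem q_top_mem_part (D : OspData G) : q G D.top D.top ∈ (sq G).part 0 := by
  have := q_mem_part (G := G) D.top D.top
  rwa [zmod2_add_self] at this

theorem q_top_ne_zero (D : OspData G) : q G D.top D.top ≠ 0 :=
  D.q_ne_zero fun e => by rw [D.par_top] at e; exact zero_ne_one e.2

theorem Adapted.q_top_isHighest (hS : D.Adapted S) :
    D.IsHighest (sq G) (2 • entry G D.top) (q G D.top D.top) := by
  refine ⟨D.q_top_mem_weightSpace, D.q_top_mem_part, D.q_top_ne_zero, fun i j hij => ?_⟩
  refine hS.q_top_killed (hS.mem i j hij) ?_ (D.F_mem_rootSpace i j)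
  rw [sub_ne_zero]
  intro e
  rw [D.entry_injective e] at hij
  exact lt_irrefl _ hij

omit [DecidableEq a] [DecidableEq b] in
theorem exists_notMem [DecidableEq a] [DecidableEq b] (hc : 5 ≤ Fintype.card (a ⊕ b))
    (i j k l : a ⊕ b) : ∃ e, e ≠ i ∧ e ≠ j ∧ e ≠ k ∧ e ≠ l := by
  obtain ⟨e, -, he⟩ := Finset.exists_mem_notMem_of_card_lt_card
    (s := {i, j, k, l}) (t := (Finset.univ : Finset (a ⊕ b)))
    ((Finset.card_le_four).trans_lt (by rw [Finset.card_univ]; omega))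
  simp only [Finset.mem_insert, Finset.mem_singleton, not_or] at he
  exact ⟨e, he⟩

theorem _root_.Submodule.mem_of_add_smul_mem {V : Type*} [AddCommGroup V] [Module ℂ V]
    {P : Submodule ℂ V} {x z : V} {c : ℂ} (h : x + c • z ∈ P) (hz : z ∈ P) : x ∈ P :=
  (P.add_mem_iff_left (P.smul_mem c hz)).1 h

section Submodule

variable {N : Submodule ℂ (Super.standard G).symSq} (hN : (sq G).IsSubmodule N)
include hN

theorem q_mem_step (D : OspData G) {i j d : a ⊕ b} (hq : q G j d ∈ N) (h0 : q G j d ≠ 0)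
    (h1 : j ≠ D.σ i) (h2 : d ≠ D.σ i) : q G i d ∈ N := by
  obtain ⟨c, hc, h⟩ := act_F_q (D := D) (d := d) h1 h2
  have := hN.2 (D.F i j) _ hq
  rw [h h0] at this
  exact (N.smul_mem_iff hc).1 this

omit hN in
theorem q_mem_symm {i j : a ⊕ b} (h : q G i j ∈ N) : q G j i ∈ N := by
  rw [q_comm]; exact N.smul_mem _ h

/-- A submodule of the symmetric square which contains one nonzero symmetric product of nonzero
weight contains all of them. -/
theorem q_mem_of_q_mem (D : OspData G) (hc : 5 ≤ Fintype.card (a ⊕ b)) {j d : a ⊕ b}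
    (hq : q G j d ∈ N) (h0 : q G j d ≠ 0) (hjd : d ≠ D.σ j) (i c : a ⊕ b) (hic : c ≠ D.σ i) :
    q G i c ∈ N := by
  have step : ∀ {j d : a ⊕ b}, q G j d ∈ N → q G j d ≠ 0 → d ≠ D.σ j → ∀ i, d ≠ D.σ i →
      q G i d ∈ N := by
    intro j d hq h0 hjd i hi
    by_cases hij : j = D.σ i
    · obtain ⟨e, h1, h2, h3, h4⟩ := exists_notMem hc j (D.σ j) d (D.σ d)
      have he : q G e d ∈ N := q_mem_step hN D hq h0 (fun h => h2 (by rw [h, D.σσ]))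
        (fun h => h4 (by rw [h, D.σσ]))
      exact q_mem_step hN D he (D.q_ne_zero_of_ne h3) (by rwa [← hij]) hi
    · exact q_mem_step hN D hq h0 hij hi
  -- One factor is changed at a time, along `(j, d)`, `(e, d)`, `(e, c)`, `(i, c)`, with `e` chosen
  -- so that the intermediate products have nonzero weight and do not vanish.
  obtain ⟨e, h1, h2, h3, h4⟩ := exists_notMem hc d (D.σ d) c (D.σ c)
  have e1 : q G e d ∈ N := step hq h0 hjd e fun h => h2 (by rw [h, D.σσ])
  have e2 : q G c e ∈ N := step (q_mem_symm e1) (D.q_ne_zero_of_ne h1.symm) h2 c h4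
  exact step (q_mem_symm e2) (D.q_ne_zero_of_ne h3) (fun h => h4 (by rw [h, D.σσ])) i hic

/-- All products of nonzero weight lie in `N`. Applying `F i top` to the product of `e_top` and
`e_{σ i}` shows by `act_F_q_dual` that each weight-zero product is, modulo `N`, a multiple of the
one for `top`; the index `i = σ top` is covered by symmetry. -/
theorem sup_span_eq_top (D : OspData G) (hc : 5 ≤ Fintype.card (a ⊕ b))
    (hq : q G D.top D.top ∈ N) : N ⊔ Submodule.span ℂ {q G D.top (D.σ D.top)} = ⊤ := by
  have hall := q_mem_of_q_mem hN D hc hq D.q_top_ne_zero D.σ_top.symm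
  rw [eq_top_iff]
  rintro t -
  have hle : Submodule.span ℂ (Set.range fun x : (a ⊕ b) × (a ⊕ b) => q G x.1 x.2) ≤
      N ⊔ Submodule.span ℂ {q G D.top (D.σ D.top)} := by
    rw [Submodule.span_le]
    rintro _ ⟨⟨i, j⟩, rfl⟩
    have hz : q G D.top (D.σ D.top) ∈ N ⊔ Submodule.span ℂ {q G D.top (D.σ D.top)} :=
      Submodule.mem_sup_right (Submodule.mem_span_singleton_self _)
    by_cases hj : j = D.σ i
    · subst hj
      by_cases h1 : i = D.top
      · rw [h1]; exact hz
      by_cases h2 : D.top = D.σ i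
      · have : i = D.σ D.top := by rw [h2, D.σσ]
        change q G i (D.σ i) ∈ _
        rw [← h2, this, q_comm (D.σ D.top)]
        exact Submodule.smul_mem _ _ hz
      · obtain ⟨c, hc⟩ := act_F_q_dual (D := D) h2
        have h3 : D.σ i ≠ D.σ D.top := by rwa [Ne, D.σ_inj]
        have h4 := hN.2 (D.F i D.top) _ (hall D.top (D.σ i) h3)
        rw [hc] at h4
        exact Submodule.mem_of_add_smul_mem (V := (Super.standard G).symSq) (Submodule.mem_sup_left h4) hz
    · exact Submodule.mem_sup_left (hall i j hj)
  exact hle (mem_span_q t)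

end Submodule

/-! ### The invariant form on the symmetric square -/

variable (G) in
/-- The invariant form, as a functional on the tensor square. -/
def form : (a ⊕ b → ℂ) ⊗[ℂ] (a ⊕ b → ℂ) →ₗ[ℂ] ℂ := (tensorBasis a b).constr ℂ fun x => G x.1 x.2

theorem form_stdVec (i j : a ⊕ b) : form G (stdVec i ⊗ₜ stdVec j) = G i j := by
  rw [← tensorBasis_apply, form, Module.Basis.constr_basis]

theorem form_act (x : ospSpace G) (t : (a ⊕ b → ℂ) ⊗[ℂ] (a ⊕ b → ℂ)) :
    form G ((Super.standard G).tensorAct (Super.standard G) x t) = 0 := by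
  refine (osp G).toGrading.induction
    (P := fun x => form G ((Super.standard G).tensorAct (Super.standard G) x t) = 0) ?_ ?_ x
  · intro x y hx hy; rw [map_add, LinearMap.add_apply, map_add, hx, hy, add_zero]
  intro p x hx
  have : form G ∘ₗ (Super.standard G).tensorAct (Super.standard G) x = 0 := by
    refine (tensorBasis a b).ext fun y => ?_
    obtain ⟨i, j⟩ := y
    rw [tensorBasis_apply, LinearMap.comp_apply, Rep.tensorAct_tmul _ _ hx (stdVec_mem_part i),
      standard_act_stdVec, standard_act_stdVec, TensorProduct.sum_tmul, TensorProduct.tmul_sum]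
    simp only [map_add, map_sum, map_smul, ← TensorProduct.smul_tmul', TensorProduct.tmul_smul,
      form_stdVec, smul_eq_mul, LinearMap.zero_apply]
    have h : x.1.transpose * G + signMat a b p * G * x.1 = 0 :=
      (mem_ospSpace_of_mem (Grading.mem_restrict_part.1 hx)).1 x.2
    have h' := congrFun (congrFun h i) j
    rw [Matrix.add_apply, Matrix.mul_assoc, signMat, Matrix.diagonal_mul, Matrix.mul_apply,
      Matrix.mul_apply] at h'
    simp only [Matrix.transpose_apply] at h'
    refine Eq.trans ?_ h'
    congr 1
    congr 1
    exact Finset.sum_congr rfl fun s _ => mul_comm _ _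
  exact LinearMap.congr_fun this t

/-- The invariant form defines a proper submodule containing the highest product, since `e_top` is
isotropic. -/
theorem gen_q_top_ne_top (D : OspData G) : (sq G).gen (q G D.top D.top) ≠ ⊤ := by
  -- The form is required to vanish on both homogeneous components, which makes stability under the
  -- grading immediate.
  let K : Submodule ℂ (Super.standard G).symSq :=
    ⨅ p, LinearMap.ker (form G ∘ₗ (Super.standard G).symSq.subtype ∘ₗ (sq G).proj p)
  have hK : ∀ t, t ∈ K ↔ ∀ p, form G ((sq G).proj p t).1 = 0 := by
    intro t; simp [K]
  have hKs : (sq G).IsSubmodule K := by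
    constructor
    · intro p t ht
      rw [hK] at *
      intro r
      rw [(sq G).proj_proj]
      split_ifs
      · exact ht p
      · simp
    · intro x t ht
      refine (osp G).toGrading.induction (P := fun x => (sq G).act x t ∈ K) ?_ ?_ x
      · intro x y hx hy; rw [map_add]; exact K.add_mem hx hy
      · intro p x hx
        rw [hK]
        intro r
        have := (sq G).act_proj hx (r - p) t
        rw [add_sub_cancel] at this
        rw [← this]
        exact form_act x _
  have hq : q G D.top D.top ∈ K := by
    rw [hK]
    intro p
    rw [Grading.proj_of_mem D.q_top_mem_part]
    split_ifs
    · rw [coe_q, map_add, map_smul, form_stdVec, D.G_apply, if_neg D.σ_top.symm]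
      simp
    · simp
  intro htop
  have h1 : q G D.top (D.σ D.top) ∈ K := Rep.gen_le hKs hq (by rw [htop]; trivial)
  have hp := q_mem_part (G := G) D.top (D.σ D.top)
  rw [D.par_σ, zmod2_add_self] at hp
  have h2 := (hK _).1 h1 0
  -- The form takes the nonzero value `2 η top` on the product of `e_top` with its partner.
  rw [Grading.proj_of_mem hp, if_pos rfl, coe_q, map_add, map_smul, form_stdVec, form_stdVec,
    D.G_apply, D.G_apply, if_pos rfl, D.σσ, if_pos rfl, D.η_σ, D.par_σ, D.par_top, sgn_zero_left,
    one_smul, one_mul, ← two_mul] at h2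
  exact D.η_ne _ ((mul_eq_zero.1 h2).resolve_left two_ne_zero)

theorem finite_symSq (D : OspData G) : Module.Finite ℂ (Super.standard G).symSq :=
  Module.Finite.of_basis D.qBasis

theorem _root_.Submodule.finrank_add_one_eq {V : Type*} [AddCommGroup V] [Module ℂ V]
    [Module.Finite ℂ V] {N : Submodule ℂ V} {z : V} (h1 : N ≠ ⊤)
    (h2 : N ⊔ Submodule.span ℂ {z} = ⊤) : Module.finrank ℂ N + 1 = Module.finrank ℂ V := by
  apply le_antisymm
  · exact Submodule.finrank_lt h1
  · have h3 := Submodule.finrank_add_le_finrank_add_finrank N (Submodule.span ℂ {z})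
    rw [h2, finrank_top] at h3
    have h4 := finrank_span_le_card (R := ℂ) ({z} : Set V)
    rw [Set.toFinset_singleton, Finset.card_singleton] at h4
    omega

theorem finrank_gen_q_top (D : OspData G) (hc : 5 ≤ Fintype.card (a ⊕ b)) :
    Module.finrank ℂ ((sq G).gen (q G D.top D.top)) + 1 =
      Module.finrank ℂ (Super.standard G).symSq := by
  have := D.finite_symSq
  exact Submodule.finrank_add_one_eq (V := (Super.standard G).symSq) D.gen_q_top_ne_top
    (sup_span_eq_top ((sq G).gen_isSubmodule _) D hc ((sq G).mem_gen _))

/-- The surjection from the generated module onto `U` is injective: its kernel `M` misses `v`, so by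
`hconn` it has only the weight zero, and the Casimir operator excludes nonzero invariant vectors. -/
theorem IsHighest.finrank_gen_eq {V U : Type*} [AddCommGroup V] [Module ℂ V] [AddCommGroup U]
    [Module ℂ U] {ρ : Rep (osp G) V} {τ : Rep (osp G) U} {J : Type*} [Fintype J]
    {B : Module.Basis J ℂ V} {wt : J → Module.Dual ℂ (cartan G)} {pr : J → ZMod 2}
    (hB : ρ.IsWeightBasis (cartan G) B wt pr) (hsep : ∀ i j, wt i = wt j → wt j ≠ 0 → i = j)
    {v : V} (hv : D.IsHighest ρ (2 • entry G D.top) v)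
    (hconn : ∀ M, ρ.IsSubmodule M → ∀ j, wt j ≠ 0 → B j ∈ M → v ∈ M) (hs : sdim a b ≠ 0)
    {u : U} (hτ : τ.IsSimple) (hu : D.IsHighest τ (2 • entry G D.top) u) :
    Module.Finite ℂ U ∧ Module.finrank ℂ U = Module.finrank ℂ (ρ.gen v) := by
  have hfin := Module.Finite.of_basis B
  have hNs := ρ.gen_isSubmodule v
  obtain ⟨f, hf, hsurj, hfv⟩ := exists_hom_of_isHighest hv hτ hu
  have hMs := (Rep.isHom_subtype ρ hNs).isSubmodule_map (hf.isSubmodule_comap τ.isSubmodule_bot)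
  set M := (Submodule.comap f ⊥).map (ρ.gen v).subtype with hM
  have hMN : ∀ m ∈ M, m ∈ ρ.gen v := by
    rintro _ ⟨m, -, rfl⟩; exact m.2
  have hqM : v ∉ M := by
    rintro ⟨m, hm, hm'⟩
    have e : m = ⟨_, ρ.mem_gen _⟩ := Subtype.ext hm'
    have : f m = 0 := hm
    rw [e, hfv] at this
    exact hu.ne_zero this
  -- A nonzero coordinate of nonzero weight would put that basis vector into `M`, by multiplicity
  -- one, and then also `v`.
  have hw : ∀ m ∈ M, m ∈ ρ.weightSpace (cartan G) 0 := by
    intro m hm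
    rw [hB.mem_weightSpace_iff]
    intro x hx
    by_contra h0
    exact hqM (hconn M hMs x h0 (hB.mem_of_repr_ne_zero hMs.2 hm hx fun y hy e =>
      hy (hsep y x e h0)))
  -- On `M` a root vector changes the weight and yet remains in weight zero, so it acts by zero.
  -- Thus `Ω m` is zero, but it is also `4 sdim` times `m`.
  have hM0 : ∀ m ∈ M, m = 0 := by
    intro m hm
    have h1 : ∀ x, ρ.act x m = 0 := by
      refine act_eq_zero_of_F (D := D) fun i j hij => ?_
      have h2 := D.act_F_mem_weightSpace ρ (hw m hm) i j D.h0
      have h3 := hw _ (hMs.2 (D.F i j) m hm) D.h0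
      rw [h3, LinearMap.zero_apply, zero_smul, zero_add, LinearMap.sub_apply, D.entry_h0,
        D.entry_h0, eq_comm, smul_eq_zero] at h2
      refine h2.resolve_left fun e => hij (D.r_inj (by exact_mod_cast sub_eq_zero.1 e))
    have h2 := casimir_of_mem_gen hv.casimir_eq (hMN m hm)
    rw [casimir_eq_zero h1] at h2
    exact (smul_eq_zero.1 h2.symm).resolve_left (mul_ne_zero (by norm_num) hs)
  have hinj : Function.Injective f := by
    rw [← LinearMap.ker_eq_bot, LinearMap.ker_eq_bot']
    intro m hm
    exact Subtype.ext (hM0 m ⟨m, hm, rfl⟩)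
  let e := LinearEquiv.ofBijective f ⟨hinj, hsurj⟩
  exact ⟨Module.Finite.equiv e, e.finrank_eq.symm⟩

theorem Adapted.finrank_add_one (hS : D.Adapted S) (hc : 5 ≤ Fintype.card (a ⊕ b))
    (hs : sdim a b ≠ 0) {U : Type*} [AddCommGroup U] [Module ℂ U] {τ : Rep (osp G) U} {u : U}
    (hτ : τ.IsSimple) (hu : D.IsHighest τ (2 • entry G D.top) u) :
    Module.Finite ℂ U ∧ Module.finrank ℂ U + 1 = Module.finrank ℂ (Super.standard G).symSq := by
  have h := hS.q_top_isHighest.finrank_gen_eq D.sq_isWeightBasis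
    (fun x y e h0 => entry_add_injOn e (e ▸ h0))
    (fun M hM x h0 hx => by
      rw [qBasis_apply] at hx
      exact q_mem_of_q_mem hM D hc hx (D.q_ne_zero x.2.2)
        (fun e => h0 (D.entry_add_eq_zero.2 e)) _ _ D.σ_top.symm) hs hτ hu
  exact ⟨h.1, by rw [h.2, D.finrank_gen_q_top hc]⟩

/-! ### Modules with the character of the symmetric square -/

theorem act_comm (D : OspData G) {V : Type*} [AddCommGroup V] [Module ℂ V] (ρ : Rep (osp G) V)
    (h h' : cartan G) (v : V) :
    ρ.act (h : ospSpace G) (ρ.act (h' : ospSpace G) v) = ρ.act h' (ρ.act h v) := by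
  have h1 := ρ.act_bracket 0 0 _ (D.cartan_mem_part h) _ (D.cartan_mem_part h') v
  have h2 : (osp G).bracket (h : ospSpace G) h' = 0 := by
    apply Subtype.ext
    change superComm a b h.1.1 h'.1.1 = 0
    rw [superComm_apply (Grading.mem_restrict_part.1 (D.cartan_mem_part h))
      (Grading.mem_restrict_part.1 (D.cartan_mem_part h')), sgn_zero_left, one_smul]
    have e1 : Matrix.diagonal h.1.1.diag = h.1.1 := Matrix.IsDiag.diagonal_diag h.2
    have e2 : Matrix.diagonal h'.1.1.diag = h'.1.1 := Matrix.IsDiag.diagonal_diag h'.2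
    rw [← e1, ← e2, Matrix.diagonal_mul_diagonal, Matrix.diagonal_mul_diagonal]
    simp only [mul_comm, sub_self]
  rw [h2, map_zero, LinearMap.zero_apply, sgn_zero_left, one_smul] at h1
  exact sub_eq_zero.1 h1.symm

/-- Weight spaces lie in simultaneous generalized eigenspaces of the commuting operators given by
the Cartan subalgebra, and these are independent. -/
theorem iSupIndep_weightSpace (D : OspData G) {V : Type*} [AddCommGroup V] [Module ℂ V]
    (ρ : Rep (osp G) V) : iSupIndep (ρ.weightSpace (cartan G)) := by
  have h1 := Module.End.independent_iInf_maxGenEigenspace_of_forall_mapsTo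
    (fun h : cartan G => (ρ.act (h : ospSpace G) : Module.End ℂ V)) (by
      intro h h' c
      exact Module.End.mapsTo_maxGenEigenspace_of_comm
        (LinearMap.ext fun v => D.act_comm ρ h' h v) c)
  have h2 := h1.comp (f := fun lam : Module.Dual ℂ (cartan G) => (lam : cartan G → ℂ))
    DFunLike.coe_injective
  refine h2.mono fun lam v hv => ?_
  simp only [Function.comp_apply, Submodule.mem_iInf]
  intro h
  exact (Module.End.genEigenspace _ _).mono le_top (Module.End.mem_eigenspace_iff.2 (hv h))

/-- Only a linear isomorphism, assembled weight by weight. It supplies finite-dimensionality and the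
dimension of a module whose character alone is known. -/
theorem nonempty_equiv_of_ch_eq (D : OspData G) {V W : Type*} [AddCommGroup V] [Module ℂ V]
    [AddCommGroup W] [Module ℂ W] {ρ : Rep (osp G) V} {σ : Rep (osp G) W}
    (hρ : ρ.HasCharacter (cartan G)) (hσ : σ.HasCharacter (cartan G))
    (h : ρ.ch (cartan G) = σ.ch (cartan G)) : Nonempty (V ≃ₗ[ℂ] W) := by
  classical
  have h1 : Function.Bijective (DirectSum.coeLinearMap (ρ.weightSpace (cartan G))) :=
    DirectSum.isInternal_submodule_of_iSupIndep_of_iSup_eq_top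
    (D.iSupIndep_weightSpace ρ) hρ.1
  have h2 : Function.Bijective (DirectSum.coeLinearMap (σ.weightSpace (cartan G))) :=
    DirectSum.isInternal_submodule_of_iSupIndep_of_iSup_eq_top
    (D.iSupIndep_weightSpace σ) hσ.1
  have e : ∀ lam, Nonempty (ρ.weightSpace (cartan G) lam ≃ₗ[ℂ] σ.weightSpace (cartan G) lam) := by
    intro lam
    have := hρ.2 lam
    have := hσ.2 lam
    exact FiniteDimensional.nonempty_linearEquiv_of_finrank_eq (congrFun h lam)
  have e := fun lam => (e lam).some
  exact ⟨(LinearEquiv.ofBijective _ h1).symm ≪≫ₗ DFinsupp.mapRange.linearEquiv e ≪≫ₗ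
    LinearEquiv.ofBijective _ h2⟩

end OspData

end

/-! ### Existence of the simple module and splitting of modules with the given character -/

section

namespace Rep

variable {g : Type*} [AddCommGroup g] [Module ℂ g] {L : LieSuperalgebra g}
  {V W : Type*} [AddCommGroup V] [Module ℂ V] [AddCommGroup W] [Module ℂ W]
  {ρ : Rep L V} {σ : Rep L W}

theorem IsHom.isIso_of_bijective {f : W →ₗ[ℂ] V} (hf : σ.IsHom ρ f) (hb : Function.Bijective f) :
    ρ.IsIso σ := by
  refine ⟨(LinearEquiv.ofBijective f hb).symm, fun p v => ?_, fun x v => ?_⟩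
  · rw [LinearEquiv.symm_apply_eq, LinearEquiv.ofBijective_apply, hf.1]
    congr 1
    exact ((LinearEquiv.ofBijective f hb).apply_symm_apply v).symm
  · rw [LinearEquiv.symm_apply_eq, LinearEquiv.ofBijective_apply, hf.2]
    congr 1
    exact ((LinearEquiv.ofBijective f hb).apply_symm_apply v).symm

/-- The module generated by `v` is divided by a submodule maximal among those avoiding `v`. A
strictly larger submodule contains the generator, so the quotient is simple. No condition on the
superdimension is involved. -/
theorem exists_isSimpleOfHighestWeight {V : Type} [AddCommGroup V] [Module ℂ V]
    [Module.Finite ℂ V] (ρ : Rep L V) {𝔥 : Submodule ℂ g} {S : Set (Module.Dual ℂ 𝔥)}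
    {lam : Module.Dual ℂ 𝔥} {v : V} (hw : v ∈ ρ.weightSpace 𝔥 lam) (hp : v ∈ ρ.part 0) (h0 : v ≠ 0)
    (hk : ∀ α ∈ AddSubmonoid.closure S, α ≠ 0 → ∀ x ∈ L.rootSpace 𝔥 α, ρ.act x v = 0) :
    ∃ (U : Type) (_ : AddCommGroup U) (_ : Module ℂ U) (τ : Rep L U),
      τ.IsSimpleOfHighestWeight 𝔥 S lam := by
  set N := ρ.gen v with hN
  have hNs := ρ.gen_isSubmodule v
  set v' : N := ⟨v, ρ.mem_gen v⟩ with hv'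
  -- Finite dimension gives the ascending chain condition, and the zero submodule starts the chain.
  obtain ⟨M, ⟨hMs, hvM⟩, hmax⟩ :=
    (wellFounded_gt : WellFounded ((· > ·) : Submodule ℂ N → _)).has_min
    {M | (ρ.restrict N hNs).IsSubmodule M ∧ v' ∉ M}
    ⟨⊥, isSubmodule_bot _, fun h => h0 (congrArg Subtype.val ((Submodule.mem_bot ℂ).1 h))⟩
  have hq := isHom_mkQ (ρ.restrict N hNs) hMs
  refine ⟨N ⧸ M, inferInstance, inferInstance, (ρ.restrict N hNs).quotient M hMs, ⟨?_, ?_⟩, ?_⟩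
  · refine ⟨M.mkQ v', 0, fun h => hvM ?_⟩
    rwa [Submodule.mkQ_apply, Submodule.Quotient.mk_eq_zero] at h
  · intro K hK
    have hKs := hq.isSubmodule_comap hK
    have hmap : (K.comap M.mkQ).map M.mkQ = K :=
      Submodule.map_comap_eq_of_surjective M.mkQ_surjective K
    have hMK : M ≤ K.comap M.mkQ := Submodule.le_comap_mkQ M K
    by_cases h : v' ∈ K.comap M.mkQ
    · right
      have h1 := gen_le ((isHom_subtype ρ hNs).isSubmodule_map hKs) (Submodule.mem_map_of_mem h)
      have h2 : K.comap M.mkQ = ⊤ := by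
        rw [eq_top_iff]
        rintro n -
        obtain ⟨m, hm, e⟩ := h1 n.2
        rw [← (Subtype.ext e : m = n)]
        exact hm
      rw [← hmap, h2, Submodule.map_top, Submodule.range_mkQ]
    · left
      have h2 : K.comap M.mkQ = M := by
        by_contra hne
        exact hmax _ ⟨hKs, h⟩ (lt_of_le_of_ne hMK (Ne.symm hne))
      rw [← hmap, h2, Submodule.mkQ_map_self]
  · refine ⟨M.mkQ v', ⟨fun h => ?_, ?_⟩, fun h => hvM ?_, fun α hα hα0 x hx => ?_⟩
    · rw [← hq.2, ← map_smul]
      exact congrArg _ (Subtype.ext (hw h))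
    · refine Grading.mem_part.2 ?_
      rw [← hq.1]
      exact congrArg _ (Subtype.ext (Grading.mem_part.1 hp))
    · rwa [Submodule.mkQ_apply, Submodule.Quotient.mk_eq_zero] at h
    · rw [← hq.2]
      have : (ρ.restrict N hNs).act x v' = 0 := Subtype.ext (hk α hα hα0 x hx)
      rw [this, map_zero]

theorem HasCharacter.eq_zero_of_ch_eq_zero {𝔥 : Submodule ℂ g} (hρ : ρ.HasCharacter 𝔥)
    {lam : Module.Dual ℂ 𝔥} (h : ρ.ch 𝔥 lam = 0) {v : V} (hv : v ∈ ρ.weightSpace 𝔥 lam) :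
    v = 0 := by
  have := hρ.2 lam
  rwa [Submodule.finrank_eq_zero.1 h] at hv

theorem HasCharacter.eq_zero_of_chPart_eq_zero {𝔥 : Submodule ℂ g} (hρ : ρ.HasCharacter 𝔥)
    {lam : Module.Dual ℂ 𝔥} {p : ZMod 2} (h : ρ.chPart 𝔥 p lam = 0) {v : V}
    (hv : v ∈ ρ.weightSpace 𝔥 lam) (hp : v ∈ ρ.part p) : v = 0 := by
  have := hρ.2 lam
  have := Submodule.finiteDimensional_inf_left (ρ.weightSpace 𝔥 lam) (ρ.part p)
  have hm : v ∈ ρ.weightSpace 𝔥 lam ⊓ ρ.part p := Submodule.mem_inf.2 ⟨hv, hp⟩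
  rwa [Submodule.finrank_eq_zero.1 h] at hm

theorem triv_shift_proj (p t : ZMod 2) (z : ℂ) :
    ((triv L).shift t).proj p z = if p = t then z else 0 := by
  change (if p + t = 0 then (LinearMap.id : ℂ →ₗ[ℂ] ℂ) else 0) z = _
  have : p + t = 0 ↔ p = t := by revert p t; decide
  simp only [this]
  split_ifs <;> rfl

end Rep

variable {a b : Type*} [Fintype a] [Fintype b] [DecidableEq a] [DecidableEq b]

namespace OspData

variable {G : Matrix (a ⊕ b) (a ⊕ b) ℂ} {D : OspData G} {S : Set (Module.Dual ℂ (cartan G))}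
  {V U : Type*} [AddCommGroup V] [Module ℂ V] [AddCommGroup U] [Module ℂ U]
  {ρ : Rep (osp G) V} {τ : Rep (osp G) U}

/-- A module with a highest weight vector of weight twice that of the standard module and with one
dimension more than the simple module of this highest weight splits. -/
theorem IsHighest.exists_isIso {v : V} {u : U} [Module.Finite ℂ V]
    (hv : D.IsHighest ρ (2 • entry G D.top) v) (hτ : τ.IsSimple)
    (hu : D.IsHighest τ (2 • entry G D.top) u) (hs : sdim a b ≠ 0)
    (hfr : Module.finrank ℂ U + 1 = Module.finrank ℂ V) :
    ∃ t : ZMod 2, ρ.IsIso (τ.directSum ((Rep.triv (osp G)).shift t)) := by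
  have hNs := ρ.gen_isSubmodule v
  have hc : (4 * sdim a b : ℂ) ≠ 0 := mul_ne_zero (by norm_num) hs
  have hΩ : ∀ n ∈ ρ.gen v, D.casimir ρ n = (4 * sdim a b) • n :=
    fun n hn => casimir_of_mem_gen hv.casimir_eq hn
  obtain ⟨f, hf, hsurj, -⟩ := exists_hom_of_isHighest hv hτ hu
  have hrank := LinearMap.finrank_range_add_finrank_ker f
  rw [LinearMap.range_eq_top.2 hsurj, finrank_top] at hrank
  have hle := Submodule.finrank_le (ρ.gen v)
  have hKs : (ρ.restrict _ hNs).IsSubmodule (LinearMap.ker f) :=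
    hf.isSubmodule_comap τ.isSubmodule_bot
  -- The generated module has dimension at most `dim U + 1`, so the kernel of `f` has dimension at
  -- most one. It is therefore invariant, and zero by the Casimir argument.
  have hinj : Function.Injective f := by
    rw [← LinearMap.ker_eq_bot, LinearMap.ker_eq_bot']
    intro m hm
    have h1 : ∀ x, ρ.act x m = 0 := fun x => congrArg (fun y => ((y : ρ.gen v) : V))
      (congrArg Subtype.val (act_eq_zero_of_finrank_le_one (D := D)
        (ρ := (ρ.restrict _ hNs).restrict _ hKs) (by omega) x ⟨m, hm⟩))
    have h2 := hΩ m m.2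
    rw [casimir_eq_zero h1] at h2
    exact Subtype.ext ((smul_eq_zero.1 h2.symm).resolve_left hc)
  let e := LinearEquiv.ofBijective f ⟨hinj, hsurj⟩
  have hN : Module.finrank ℂ (ρ.gen v) = Module.finrank ℂ U := e.finrank_eq
  -- The quotient of `V` by the generated module is one-dimensional, hence trivial.
  have hquot : ∀ x w, ρ.act x w ∈ ρ.gen v := by
    intro x w
    have h1 := Submodule.finrank_quotient_add_finrank (ρ.gen v)
    have h2 := act_eq_zero_of_finrank_le_one (D := D) (ρ := ρ.quotient _ hNs) (by omega) x
      ((ρ.gen v).mkQ w)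
    rwa [← (Rep.isHom_mkQ ρ hNs).2, Submodule.mkQ_apply, Submodule.Quotient.mk_eq_zero] at h2
  set K := LinearMap.ker (D.casimir ρ) with hK
  have hinter : ∀ n ∈ ρ.gen v, n ∈ K → n = 0 := by
    intro n hn hnK
    have h2 := hΩ n hn
    rw [LinearMap.mem_ker.1 hnK] at h2
    exact (smul_eq_zero.1 h2.symm).resolve_left hc
  -- The vector `x k` lies in the generated module and, as `Ω` commutes with `x`, in the kernel of
  -- `Ω`; these two meet only in zero.
  have hKact : ∀ x, ∀ k ∈ K, ρ.act x k = 0 := by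
    intro x k hk
    refine hinter _ (hquot x k) ?_
    rw [LinearMap.mem_ker, ← act_casimir, LinearMap.mem_ker.1 hk, map_zero]
  have hne : ρ.gen v ≠ ⊤ := by
    intro h
    rw [h, finrank_top] at hN
    omega
  obtain ⟨w, hw⟩ : ∃ w, w ∉ ρ.gen v := by
    by_contra hcon
    push Not at hcon
    exact hne (eq_top_iff.2 fun w _ => hcon w)
  -- The projection of `w` to the kernel of `Ω`: its image `Ω w` lies in the generated module, where
  -- `Ω` is multiplication by `4 sdim`.
  set k := w - (4 * sdim a b)⁻¹ • D.casimir ρ w with hk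
  have hcas : D.casimir ρ w ∈ ρ.gen v := casimir_mem hNs fun x => hquot x w
  have hkK : k ∈ K := by
    rw [LinearMap.mem_ker, hk, map_sub, map_smul, hΩ _ hcas, smul_smul, inv_mul_cancel₀ hc,
      one_smul, sub_self]
  have hk0 : k ≠ 0 := by
    intro h
    rw [hk, sub_eq_zero] at h
    exact hw (h ▸ (ρ.gen v).smul_mem _ hcas)
  -- A homogeneous vector is needed for an even isomorphism. Since `Ω` is even, components of `k`
  -- remain in its kernel, and the parity of the chosen one is the shift of the trivial summand.
  obtain ⟨t, ht⟩ : ∃ t, ρ.proj t k ≠ 0 := by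
    by_contra hcon
    push Not at hcon
    exact hk0 (by rw [← ρ.proj_add k, hcon, hcon, add_zero])
  have hk'K : ρ.proj t k ∈ K := by
    rw [LinearMap.mem_ker, casimir_proj, LinearMap.mem_ker.1 hkK, map_zero]
  have hk'p : ρ.proj t k ∈ ρ.part t := ρ.toGrading.proj_mem t k
  generalize ρ.proj t k = k' at ht hk'K hk'p
  refine ⟨t, ?_⟩
  have hsymm : ∀ y, f (e.symm y) = y := fun y => e.apply_symm_apply y
  let F : U × ℂ →ₗ[ℂ] V := (ρ.gen v).subtype ∘ₗ e.symm.toLinearMap ∘ₗ LinearMap.fst ℂ U ℂ +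
    (LinearMap.snd ℂ U ℂ).smulRight k'
  have hF : ∀ y, F y = (e.symm y.1 : V) + y.2 • k' := fun y => rfl
  have hFinj : Function.Injective F := by
    rw [← LinearMap.ker_eq_bot, LinearMap.ker_eq_bot']
    rintro ⟨y, z⟩ h
    rw [hF] at h
    have h1 : z • k' ∈ ρ.gen v := by
      rw [← neg_eq_of_add_eq_zero_right h]
      exact (ρ.gen v).neg_mem (e.symm y).2
    have h2 := hinter _ h1 (K.smul_mem z hk'K)
    have h3 : z = 0 := (smul_eq_zero.1 h2).resolve_right ht
    rw [h2, add_zero] at h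
    have h4 : e.symm y = 0 := Subtype.ext h
    rw [LinearEquiv.map_eq_zero_iff] at h4
    simp [h3, h4]
  have hUfin : Module.Finite ℂ U := Module.Finite.equiv e
  have hFbij : Function.Bijective F := by
    refine ⟨hFinj, ?_⟩
    refine (LinearMap.injective_iff_surjective_of_finrank_eq_finrank ?_).1 hFinj
    rw [Module.finrank_prod, Module.finrank_self, hfr]
  refine Rep.IsHom.isIso_of_bijective (f := F) ⟨fun p y => ?_, fun x y => ?_⟩ hFbij
  · have h1 : e.symm (τ.proj p y.1) = (ρ.restrict _ hNs).proj p (e.symm y.1) := by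
      rw [LinearEquiv.symm_apply_eq]
      change _ = f _
      rw [hf.1, hsymm]
    rw [hF, hF, map_add, map_smul, Grading.proj_of_mem hk'p]
    change ((e.symm (τ.proj p y.1) : ρ.gen v) : V) +
      (((Rep.triv (osp G)).shift t).proj p y.2 : ℂ) • k' = _
    rw [h1, Rep.triv_shift_proj]
    congr 1
    split_ifs
    · rfl
    · rw [zero_smul, smul_zero]
  · have h1 : e.symm (τ.act x y.1) = (ρ.restrict _ hNs).act x (e.symm y.1) := by
      rw [LinearEquiv.symm_apply_eq]
      change _ = f _
      rw [hf.2, hsymm]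
    rw [hF, hF, map_add, map_smul, hKact x _ hk'K, smul_zero, add_zero]
    change ((e.symm (τ.act x y.1) : ρ.gen v) : V) + (0 : ℂ) • k' = _
    rw [h1, zero_smul, add_zero]
    rfl

theorem sq_ch_eq_zero (D : OspData G) {lam : Module.Dual ℂ (cartan G)}
    (h : ∀ i j : a ⊕ b, lam ≠ entry G i + entry G j) : (sq G).ch (cartan G) lam = 0 := by
  rw [D.sq_ch, charSum, if_neg, if_neg]
  · rintro ⟨-, i, j, -, e⟩; exact h i j e
  · rintro rfl
    refine h D.top (D.σ D.top) ?_
    rw [D.entry_σ, add_neg_cancel]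

/-- A positive root vector would lead to a weight with `h0`-value above `2 r top`, the maximum over
the weights of the symmetric square. -/
theorem isHighest_of_ch_eq (D : OspData G) (hρ : ρ.HasCharacter (cartan G))
    (hch : ρ.ch (cartan G) = (sq G).ch (cartan G)) {v : V}
    (hw : v ∈ ρ.weightSpace (cartan G) (2 • entry G D.top)) (hp : v ∈ ρ.part 0) (h0 : v ≠ 0) :
    D.IsHighest ρ (2 • entry G D.top) v := by
  refine ⟨hw, hp, h0, fun i j hij => ?_⟩
  refine hρ.eq_zero_of_ch_eq_zero ?_ (D.act_F_mem_weightSpace ρ hw i j)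
  rw [hch]
  refine D.sq_ch_eq_zero fun c d e => ?_
  have h1 := LinearMap.congr_fun e D.h0
  simp only [LinearMap.add_apply, LinearMap.sub_apply, LinearMap.smul_apply, D.entry_h0,
    nsmul_eq_mul] at h1
  have h2 : 2 * D.r D.top + (D.r i - D.r j) = D.r c + D.r d := by exact_mod_cast h1
  have := D.r_le c
  have := D.r_le d
  omega

theorem proj_mem_weightSpace (D : OspData G) {lam : Module.Dual ℂ (cartan G)} {v : V}
    (hv : v ∈ ρ.weightSpace (cartan G) lam) (p : ZMod 2) :
    ρ.proj p v ∈ ρ.weightSpace (cartan G) lam := by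
  intro h
  rw [ρ.act_proj (D.cartan_mem_part h), zero_add, hv h, map_smul]

/-- The modules with the character of the symmetric square of the standard module. -/
theorem Adapted.isIso_of_ch_eq (hS : D.Adapted S) (hc : 5 ≤ Fintype.card (a ⊕ b))
    (hs : sdim a b ≠ 0)
    (hτ : τ.IsSimpleOfHighestWeight (cartan G) S (2 • entry G D.top))
    (hρ : ρ.HasCharacter (cartan G)) (hch : ρ.ch (cartan G) = (sq G).ch (cartan G)) :
    (∃ s t : ZMod 2, ρ.IsIso ((τ.shift s).directSum ((Rep.triv (osp G)).shift t))) ∧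
    ((∀ p, ρ.chPart (cartan G) p = (sq G).chPart (cartan G) p) →
      ρ.IsIso (τ.directSum (Rep.triv (osp G)))) := by
  obtain ⟨u, hu⟩ := hS.exists_isHighest hτ
  have hUf := hS.finrank_add_one hc hs hτ.1 hu
  obtain ⟨eV⟩ := D.nonempty_equiv_of_ch_eq hρ D.sq_isWeightBasis.hasCharacter hch
  have := D.finite_symSq
  have hVfin : Module.Finite ℂ V := Module.Finite.equiv eV.symm
  have hfr : Module.finrank ℂ U + 1 = Module.finrank ℂ V := by rw [hUf.2, eV.finrank_eq]
  constructor
  · obtain ⟨v, hv, hv0⟩ : ∃ v ∈ ρ.weightSpace (cartan G) (2 • entry G D.top), v ≠ 0 := by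
      by_contra hcon
      push Not at hcon
      have h1 : ρ.weightSpace (cartan G) (2 • entry G D.top) = ⊥ := (Submodule.eq_bot_iff _).2 hcon
      have h2 : ρ.ch (cartan G) (2 • entry G D.top) = 0 := by
        change Module.finrank ℂ _ = 0
        rw [h1, finrank_bot]
      rw [hch] at h2
      exact D.q_top_ne_zero (D.sq_isWeightBasis.hasCharacter.eq_zero_of_ch_eq_zero h2
        D.q_top_mem_weightSpace)
    obtain ⟨s, hs0⟩ : ∃ s, ρ.proj s v ≠ 0 := by
      by_contra hcon
      push Not at hcon
      exact hv0 (by rw [← ρ.proj_add v, hcon, hcon, add_zero])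
    -- The vector may be odd in `ρ`, so the splitting is applied to the shift by its parity, in
    -- which it is even; the ungraded character is unaffected.
    have hp : ρ.proj s v ∈ (ρ.shift s).part 0 := by
      rw [Grading.mem_part]
      change ρ.proj (0 + s) (ρ.proj s v) = _
      rw [zero_add, ρ.proj_proj, if_pos rfl]
    have hH := D.isHighest_of_ch_eq (ρ := ρ.shift s) hρ hch
      (D.proj_mem_weightSpace hv s) hp hs0
    obtain ⟨t, e, he1, he2⟩ := hH.exists_isIso hτ.1 hu hs hfr
    -- Shifting back by `s` changes the parity of both summands, and shifting twice by `s` is the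
    -- identity.
    refine ⟨s, t + s, e, fun p v => ?_, he2⟩
    have h1 := he1 (p + s) v
    have h2 : (ρ.shift s).proj (p + s) = ρ.proj p := by
      change ρ.proj (p + s + s) = _
      rw [add_assoc, zmod2_add_self, add_zero]
    rw [h2] at h1
    rw [h1]
    refine Prod.ext rfl ?_
    change ((Rep.triv (osp G)).shift t).proj (p + s) (e v).2 =
      ((Rep.triv (osp G)).shift (t + s)).proj p (e v).2
    rw [Rep.triv_shift_proj, Rep.triv_shift_proj]
    have : ∀ p s t : ZMod 2, p + s = t ↔ p = t + s := by decide
    simp only [this]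
  · intro hpart
    obtain ⟨v, hv, hv0⟩ : ∃ v ∈ ρ.weightSpace (cartan G) (2 • entry G D.top) ⊓ ρ.part 0, v ≠ 0 := by
      by_contra hcon
      push Not at hcon
      have h1 := (Submodule.eq_bot_iff _).2 hcon
      have h2 : ρ.chPart (cartan G) 0 (2 • entry G D.top) = 0 := by
        change Module.finrank ℂ _ = 0
        rw [h1, finrank_bot]
      rw [hpart] at h2
      exact D.q_top_ne_zero (D.sq_isWeightBasis.hasCharacter.eq_zero_of_chPart_eq_zero h2
        D.q_top_mem_weightSpace D.q_top_mem_part)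
    have hH := D.isHighest_of_ch_eq hρ hch hv.1 hv.2 hv0
    obtain ⟨t, e, he1, he2⟩ := hH.exists_isIso hτ.1 hu hs hfr
    -- If `t` were 1, the trivial summand would provide a nonzero odd vector of weight zero, whereas
    -- the weight-zero space of the symmetric square is even.
    have ht : t = 0 := by
      by_contra ht
      have ht1 : t = 1 := (zmod2_cases t).resolve_left ht
      subst ht1
      have h1 : e.symm (0, 1) ∈ ρ.weightSpace (cartan G) 0 := by
        intro h
        apply e.injective
        rw [he2, e.apply_symm_apply, LinearMap.zero_apply, zero_smul, map_zero]
        exact Prod.ext (map_zero (τ.act h)) rfl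
      have hp : e.symm (0, 1) ∈ ρ.part 1 := by
        rw [Grading.mem_part]
        apply e.injective
        rw [he1, e.apply_symm_apply]
        exact Prod.ext (map_zero (τ.proj 1)) 
          ((Rep.triv_shift_proj (L := osp G) 1 1 1).trans (if_pos rfl))
      have h2 : ρ.chPart (cartan G) 1 0 = 0 := by
        rw [hpart, D.sq_chPart, charSum, if_pos rfl, if_neg one_ne_zero,
          if_neg fun h => h.1 rfl]
      have h3 := hρ.eq_zero_of_chPart_eq_zero h2 h1 hp
      rw [LinearEquiv.map_eq_zero_iff] at h3
      exact one_ne_zero (congrArg Prod.snd h3)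
    subst ht
    refine ⟨e, fun p v => ?_, he2⟩
    rw [he1]
    refine Prod.ext rfl ?_
    change ((Rep.triv (osp G)).shift 0).proj p (e v).2 = (Rep.triv (osp G)).proj p (e v).2
    change (Rep.triv (osp G)).proj (p + 0) (e v).2 = _
    rw [add_zero]

/-- The assertions about the symmetric square for an orthosymplectic Lie superalgebra of nonzero
superdimension. -/
theorem Adapted.symSquare_isIso (hS : D.Adapted S) (hc : 5 ≤ Fintype.card (a ⊕ b))
    (hs : sdim a b ≠ 0) (hτ : τ.IsSimpleOfHighestWeight (cartan G) S (2 • entry G D.top)) :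
    (sq G).IsIso (τ.directSum (Rep.triv (osp G))) :=
  (hS.isIso_of_ch_eq hc hs hτ D.sq_isWeightBasis.hasCharacter rfl).2 fun _ => rfl

end OspData

theorem OspData.Adapted.exists_simple {a b : Type} [Fintype a] [Fintype b] [DecidableEq a]
    [DecidableEq b] {G : Matrix (a ⊕ b) (a ⊕ b) ℂ} {D : OspData G}
    {S : Set (Module.Dual ℂ (cartan G))} (hS : D.Adapted S) :
    ∃ (U : Type) (_ : AddCommGroup U) (_ : Module ℂ U) (τ : Rep (osp G) U),
      τ.IsSimpleOfHighestWeight (cartan G) S (2 • entry G D.top) := by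
  have := D.finite_symSq
  exact Rep.exists_isSimpleOfHighestWeight (OspData.sq G) D.q_top_mem_weightSpace D.q_top_mem_part
    D.q_top_ne_zero fun α hα hα0 x hx => hS.q_top_killed hα hα0 hx

end

/-! ### Simple roots read off from an ordered list of weights -/

section

theorem mem_consecutive {M : Type*} [AddCommGroup M] {s : List M} {α : M} :
    α ∈ consecutive s ↔ ∃ m x y, s[m]? = some x ∧ s[m + 1]? = some y ∧ α = x - y := by
  change α ∈ List.zipWith (fun x y => x - y) s s.tail ↔ _
  rw [List.mem_iff_getElem?]
  refine exists_congr fun m => ?_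
  simp only [List.getElem?_zipWith, List.getElem?_tail]
  rcases s[m]? with _ | x <;> rcases s[m + 1]? with _ | y <;> simp [eq_comm]

variable {a b : Type*} [Fintype a] [Fintype b] [DecidableEq a] [DecidableEq b]

namespace OspData

variable {G : Matrix (a ⊕ b) (a ⊕ b) ℂ} {D : OspData G} {s : List (Module.Dual ℂ (cartan G))}

theorem entry_eq_zero (D : OspData G) {i : a ⊕ b} (h : D.σ i = i) : entry G i = 0 := by
  have h1 := (D.entry_add_eq_zero (i := i)).2 h.symm
  rw [← two_smul ℂ, smul_eq_zero] at h1
  exact h1.resolve_left two_ne_zero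

/-- The list `s` enumerates the weights of positive rank, in the order of decreasing rank. -/
structure Enum (D : OspData G) (s : List (Module.Dual ℂ (cartan G))) : Prop where
  le : ∀ i, D.r i ≤ s.length
  surj : ∀ m < s.length, ∃ i, D.r i = s.length - m
  getElem? : ∀ i, 0 < D.r i → s[s.length - (D.r i).toNat]? = some (entry G i)

theorem Enum.exists_of_getElem? (hs : D.Enum s) {m : ℕ} {x : Module.Dual ℂ (cartan G)}
    (h : s[m]? = some x) : ∃ i, D.r i = s.length - m ∧ x = entry G i := by
  obtain ⟨hm, -⟩ := List.getElem?_eq_some_iff.1 h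
  obtain ⟨i, hi⟩ := hs.surj m hm
  refine ⟨i, hi, Option.some_injective _ ?_⟩
  rw [← h, ← hs.getElem? i (by omega)]
  congr 1
  omega

/-- The difference telescopes through the intermediate ranks, all of which occur in the list. -/
theorem Enum.sub_mem (hs : D.Enum s) {i j : a ⊕ b} (hj : 0 < D.r j) (hij : D.r j ≤ D.r i) :
    entry G i - entry G j ∈ AddSubmonoid.closure (consecutive s) := by
  obtain ⟨d, hd⟩ : ∃ d : ℕ, D.r i = D.r j + d := ⟨(D.r i - D.r j).toNat, by omega⟩
  induction d generalizing i with
  | zero =>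
    rw [D.r_inj (by omega : D.r i = D.r j), sub_self]
    exact AddSubmonoid.zero_mem _
  | succ d ih =>
    have hle := hs.le i
    obtain ⟨c, hc⟩ := hs.surj (s.length - (D.r i).toNat + 1) (by omega)
    rw [← sub_add_sub_cancel (entry G i) (entry G c)]
    refine AddSubmonoid.add_mem _ (AddSubmonoid.subset_closure (mem_consecutive.2
      ⟨_, _, _, hs.getElem? i (by omega), ?_, rfl⟩)) (ih (by omega) (by omega))
    rw [← hs.getElem? c (by omega)]
    congr 1
    omega

theorem Enum.getLast? (hs : D.Enum s) {x : Module.Dual ℂ (cartan G)} (h : s.getLast? = some x) :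
    ∃ i, D.r i = 1 ∧ x = entry G i := by
  have h0 : s ≠ [] := by rintro rfl; simp at h
  have h1 := List.length_pos_of_ne_nil h0
  rw [List.getLast?_eq_getElem?] at h
  obtain ⟨i, hi, hx⟩ := hs.exists_of_getElem? h
  exact ⟨i, by omega, hx⟩

theorem Enum.length_pos (hs : D.Enum s) : 0 < s.length := by
  have := hs.le D.top
  have := D.r_top_pos
  omega

theorem Enum.exists_getLast? (hs : D.Enum s) :
    ∃ i, D.r i = 1 ∧ s.getLast? = some (entry G i) := by
  have h1 := hs.length_pos
  obtain ⟨i, hi⟩ := hs.surj (s.length - 1) (by omega)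
  refine ⟨i, by omega, ?_⟩
  rw [List.getLast?_eq_getElem?, ← hs.getElem? i (by omega)]
  congr 1
  omega

theorem Enum.pos_of_mem_consecutive (hs : D.Enum s) {α : Module.Dual ℂ (cartan G)}
    (h : α ∈ consecutive s) : ∃ n : ℕ, 0 < n ∧ α D.h0 = n := by
  obtain ⟨m, x, y, hx, hy, rfl⟩ := mem_consecutive.1 h
  obtain ⟨i, hi, rfl⟩ := hs.exists_of_getElem? hx
  obtain ⟨j, hj, rfl⟩ := hs.exists_of_getElem? hy
  refine ⟨1, one_pos, ?_⟩
  rw [LinearMap.sub_apply, D.entry_h0, D.entry_h0, ← Int.cast_sub]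
  exact_mod_cast (by omega : D.r i - D.r j = 1)

/-- Two positive ranks are covered by `Enum.sub_mem`, and two negative ones reduce to this by `σ`.
In the mixed case the difference is a sum of two weights of nonnegative rank; only this case depends
on the last simple root, and it is left as a hypothesis. -/
theorem Enum.mem_closure (hs : D.Enum s) {S : Set (Module.Dual ℂ (cartan G))}
    (hS : consecutive s ⊆ S)
    (h : ∀ i j, i ≠ D.σ j → 0 ≤ D.r i → 0 ≤ D.r j → entry G i + entry G j ∈ AddSubmonoid.closure S)
    (i j : a ⊕ b) (hij : D.r j < D.r i) : entry G i - entry G j ∈ AddSubmonoid.closure S := by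
  have hi := D.r_σ i
  have hj := D.r_σ j
  rcases lt_or_ge 0 (D.r j) with h1 | h1
  · exact AddSubmonoid.closure_mono hS (hs.sub_mem h1 hij.le)
  rcases lt_or_ge (D.r i) 0 with h2 | h2
  · have := AddSubmonoid.closure_mono hS
      (hs.sub_mem (i := D.σ j) (j := D.σ i) (by omega) (by omega))
    rwa [D.entry_σ, D.entry_σ, neg_sub_neg] at this
  · have := h i (D.σ j) (fun e => by rw [e, D.σσ] at hij; omega) h2 (by omega)
    rwa [D.entry_σ, ← sub_eq_add_neg] at this

theorem Enum.adapted_union_last (hs : D.Enum s) :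
    D.Adapted (consecutive s ∪ {α | s.getLast? = some α}) where
  pos α hα := by
    rcases hα with hα | hα
    · exact hs.pos_of_mem_consecutive hα
    · obtain ⟨i, hi, rfl⟩ := hs.getLast? hα
      exact ⟨1, one_pos, by rw [D.entry_h0, hi]; rfl⟩
  mem := by
    obtain ⟨z, hz, hl⟩ := hs.exists_getLast?
    have key : ∀ i, 0 ≤ D.r i → entry G i ∈
        AddSubmonoid.closure (consecutive s ∪ {α | s.getLast? = some α}) := by
      intro i hi
      rcases hi.eq_or_lt with h0 | h0
      · rw [D.entry_eq_zero (D.r_inj (by rw [D.r_σ, ← h0, neg_zero]))]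
        exact AddSubmonoid.zero_mem _
      · rw [← sub_add_cancel (entry G i) (entry G z)]
        exact AddSubmonoid.add_mem _ (AddSubmonoid.closure_mono Set.subset_union_left
          (hs.sub_mem (by omega) (by omega))) (AddSubmonoid.subset_closure (Or.inr hl))
    exact hs.mem_closure Set.subset_union_left fun i j _ hi hj =>
      AddSubmonoid.add_mem _ (key i hi) (key j hj)

theorem Enum.adapted_union_two_last (hs : D.Enum s) (h0 : ∀ i, D.r i ≠ 0) :
    D.Adapted (consecutive s ∪ {α | ∃ β, s.getLast? = some β ∧ α = 2 • β}) where
  pos α hα := by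
    rcases hα with hα | ⟨β, hβ, rfl⟩
    · exact hs.pos_of_mem_consecutive hα
    · obtain ⟨i, hi, rfl⟩ := hs.getLast? hβ
      exact ⟨2, two_pos, by rw [LinearMap.smul_apply, D.entry_h0, hi]; simp⟩
  mem := by
    obtain ⟨z, hz, hl⟩ := hs.exists_getLast?
    refine hs.mem_closure Set.subset_union_left fun i j _ hi hj => ?_
    have h1 := h0 i
    have h2 := h0 j
    -- No weight has rank zero here, so both terms can be compared with the last weight `z` of the
    -- list, leaving exactly the simple root twice `z`.
    have e : entry G i + entry G j =
        (entry G i - entry G z) + (entry G j - entry G z) + 2 • entry G z := by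
      rw [two_nsmul]; abel
    rw [e]
    exact AddSubmonoid.add_mem _ (AddSubmonoid.add_mem _
      (AddSubmonoid.closure_mono Set.subset_union_left (hs.sub_mem (by omega) (by omega)))
      (AddSubmonoid.closure_mono Set.subset_union_left (hs.sub_mem (by omega) (by omega))))
      (AddSubmonoid.subset_closure (Or.inr ⟨_, hl, rfl⟩))

theorem card_nonneg_rank (D : OspData G) {m n : ℕ}
    (h : ∀ x : ℤ, (∃ i, 0 ≤ D.r i ∧ D.r i = x) ↔ (m : ℤ) ≤ x ∧ x ≤ n) :
    Nat.card {i // 0 ≤ D.r i} = n + 1 - m := by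
  have h1 : D.r '' {i | 0 ≤ D.r i} = ↑(Finset.Icc (m : ℤ) n) := by
    ext x
    rw [Finset.coe_Icc]
    exact h x
  change Nat.card ↥{i | 0 ≤ D.r i} = _
  rw [Nat.card_coe_set_eq, ← Set.ncard_image_of_injective _ D.r_inj, h1, Set.ncard_coe_finset,
    Int.card_Icc]
  omega

/-- The nonzero weights of parity `p` in the symmetric square of the standard module. -/
def sqSet (G : Matrix (a ⊕ b) (a ⊕ b) ℂ) (p : ZMod 2) : Set (Module.Dual ℂ (cartan G)) :=
  {α | α ≠ 0 ∧ ∃ i j : a ⊕ b, ¬(i = j ∧ par i = 1) ∧ par i + par j = p ∧ α = entry G i + entry G j}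

theorem add_mem_sqSet (D : OspData G) {p : ZMod 2} {i j : a ⊕ b} (h : ¬(i = j ∧ par i = 1))
    (hp : par i + par j = p) (hσ : j ≠ D.σ i) {α : Module.Dual ℂ (cartan G)}
    (e : α = entry G i + entry G j) : α ∈ sqSet G p :=
  ⟨fun h0 => hσ ((D.entry_add_eq_zero).1 (e.symm.trans h0)), i, j, h, hp, e⟩

theorem pmpm_subset_sqSet (D : OspData G) {p : ZMod 2} {i j : a ⊕ b} (h1 : i ≠ j)
    (h2 : j ≠ D.σ i) (hp : par i + par j = p) : pmpm (entry G i) (entry G j) ⊆ sqSet G p := by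
  have hi := D.entry_σ i
  have hj := D.entry_σ j
  have h3 : D.σ i ≠ D.σ j := fun h => h1 (D.σ_inj.1 h)
  have h4 : i ≠ D.σ j := fun h => h2 (D.eq_σ_iff.1 h).symm
  have hpi := D.par_σ i
  have hpj := D.par_σ j
  rintro α (rfl | rfl | rfl | rfl)
  · exact D.add_mem_sqSet (fun h => h1 h.1) hp h2 rfl
  · exact D.add_mem_sqSet (fun h => h4 h.1) (hpj ▸ hp) h3.symm (by rw [hj, sub_eq_add_neg])
  · exact D.add_mem_sqSet (fun h => h2 h.1.symm) (hpi ▸ hp) (by rwa [D.σσ, ne_comm]) (by rw [hi])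
  · exact D.add_mem_sqSet (fun h => h3 h.1) (hpi ▸ hpj ▸ hp) (by rw [D.σσ]; exact h4.symm)
      (by rw [hi, hj, sub_eq_add_neg])

theorem pm_two_subset_sqSet (D : OspData G) {i : a ⊕ b} (h : i ≠ D.σ i) (hp : par i = 0) :
    pm (2 • entry G i) ⊆ sqSet G 0 := by
  have hpi := D.par_σ i
  rintro α (rfl | rfl)
  · exact D.add_mem_sqSet (i := i) (by simp [hp]) (by rw [hp, add_zero]) h (two_nsmul _)
  · exact D.add_mem_sqSet (i := D.σ i) (by simp [hp, hpi]) (by rw [hpi, hp, add_zero])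
      (by rw [D.σσ]; exact h.symm) (by rw [D.entry_σ, two_nsmul, neg_add])

/-- These weights arise from products with the self-paired vector `e_z`, whose weight is zero. -/
theorem pm_subset_sqSet (D : OspData G) {p : ZMod 2} {i z : a ⊕ b} (hz : D.σ z = z) (h : i ≠ z)
    (hp : par i + par z = p) : pm (entry G i) ⊆ sqSet G p := by
  have h1 := D.pmpm_subset_sqSet (i := i) (j := z) h
    (fun e => h (D.σ_inj.1 (e.symm.trans hz.symm))) hp
  rw [D.entry_eq_zero hz] at h1
  rintro α (rfl | rfl)
  · exact h1 (Or.inl (add_zero _).symm)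
  · exact h1 (Or.inr (Or.inr (Or.inl (add_zero _).symm)))

theorem sq_ch_eq (D : OspData G) {n : ℕ} (hn : Nat.card {i // 0 ≤ D.r i} = n) :
    (sq G).ch (cartan G) = charSum n (sqSet G 0 ∪ sqSet G 1) := by
  rw [D.sq_ch, hn]
  congr 1
  ext α
  constructor
  · rintro ⟨h0, i, j, h, e⟩
    rcases zmod2_cases (par i + par j) with hp | hp
    · exact Or.inl ⟨h0, i, j, h, hp, e⟩
    · exact Or.inr ⟨h0, i, j, h, hp, e⟩
  · rintro (⟨h0, i, j, h, hp, e⟩ | ⟨h0, i, j, h, hp, e⟩) <;> exact ⟨h0, i, j, h, e⟩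

theorem sq_chPart_zero (D : OspData G) {n : ℕ} (hn : Nat.card {i // 0 ≤ D.r i} = n) :
    (sq G).chPart (cartan G) 0 = charSum n (sqSet G 0) := by
  rw [D.sq_chPart, hn, if_pos rfl]; rfl

theorem sq_chPart_one (D : OspData G) :
    (sq G).chPart (cartan G) 1 = charSum 0 (sqSet G 1) := by
  rw [D.sq_chPart, if_neg one_ne_zero]; rfl

end OspData

/-! ### The forms of `B(k|l)` and `D(k|l)` -/

section Instances

variable {k l : ℕ}

/-- The rank of `ε_i` for `B(k|l)`. -/
def rankEpsB (l : ℕ) (i : Fin k) : ℤ := if (i : ℕ) = 0 then k + l else k + l - 1 - i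

/-- The rank of `δ_g` for `B(k|l)`. -/
def rankDelB (k : ℕ) (g : Fin l) : ℤ := if (g : ℕ) = 0 then k + l - 1 else l - g

/-- The orthosymplectic form of `B(k|l)`. -/
def ospDataB (hk : 1 ≤ k) (hl : 1 ≤ l) : OspData (gramB k l) where
  σ := Sum.elim (fun x => Sum.inl (Sum.elim Sum.inl (fun y => Sum.inr y.swap) x))
    (fun g => Sum.inr g.swap)
  -- The 2 is the diagonal entry of `JB` at the vector of weight zero; the signs on the odd part are
  -- those of the symplectic matrix `J`.
  η := Sum.elim (Sum.elim (fun _ => 2) (fun _ => 1)) (Sum.elim (fun _ => -1) (fun _ => 1))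
  r := Sum.elim (Sum.elim (fun _ => 0) (Sum.elim (rankEpsB l) (fun i => -rankEpsB l i)))
    (Sum.elim (rankDelB k) (fun g => -rankDelB k g))
  top := Sum.inl (Sum.inr (Sum.inl ⟨0, hk⟩))
  σσ := by rintro ((_ | _ | _) | _ | _) <;> rfl
  par_σ := by rintro ((_ | _ | _) | _ | _) <;> rfl
  η_ne := by rintro ((_ | _ | _) | _ | _) <;> simp
  η_σ := by rintro ((_ | _ | _) | _ | _) <;> simp [par, sgn]
  G_apply := by
    rintro ((_ | _ | _) | _ | _) ((_ | _ | _) | _ | _) <;>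
      simp [gramB, LieAlgebra.Orthogonal.JB, LieAlgebra.Orthogonal.JD, Matrix.J, Matrix.one_apply,
        eq_comm, apply_ite]
  r_σ := by rintro ((_ | _ | _) | _ | _) <;> simp
  r_inj := by
    rintro ((_ | i | i) | i | i) ((_ | j | j) | j | j) h <;>
      simp only [Sum.elim_inl, Sum.elim_inr, rankEpsB, rankDelB] at h <;>
      simp only [Sum.inl.injEq, Sum.inr.injEq, Fin.ext_iff, reduceCtorEq] <;>
      split_ifs at h <;> omega
  r_le := by
    rintro ((_ | i | i) | i | i) <;>
      simp only [Sum.elim_inl, Sum.elim_inr, rankEpsB, rankDelB] <;>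
      split_ifs <;> omega
  par_top := rfl
  σ_top := by simp
  nonempty_odd := ⟨Sum.inl ⟨0, hl⟩⟩

/-- The orthosymplectic form of `D(k|l)`. -/
def ospDataD (hk : 1 ≤ k) (hl : 1 ≤ l) : OspData (gramD k l) where
  σ := Sum.elim (fun x => Sum.inl x.swap) (fun g => Sum.inr g.swap)
  η := Sum.elim (fun _ => 1) (Sum.elim (fun _ => -1) (fun _ => 1))
  r := Sum.elim (Sum.elim (fun i => k + l - i) (fun i => -(k + l - i)))
    (Sum.elim (fun g => l - g) (fun g => -(l - g)))
  top := Sum.inl (Sum.inl ⟨0, hk⟩)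
  σσ := by rintro ((_ | _) | _ | _) <;> rfl
  par_σ := by rintro ((_ | _) | _ | _) <;> rfl
  η_ne := by rintro ((_ | _) | _ | _) <;> simp
  η_σ := by rintro ((_ | _) | _ | _) <;> simp [par, sgn]
  G_apply := by
    rintro ((_ | _) | _ | _) ((_ | _) | _ | _) <;>
      simp [gramD, LieAlgebra.Orthogonal.JD, Matrix.J, Matrix.one_apply, eq_comm, apply_ite]
  r_σ := by rintro ((_ | _) | _ | _) <;> simp
  r_inj := by
    rintro ((i | i) | i | i) ((j | j) | j | j) h <;>
      simp only [Sum.elim_inl, Sum.elim_inr] at h <;>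
      simp only [Sum.inl.injEq, Sum.inr.injEq, Fin.ext_iff, reduceCtorEq] <;> omega
  r_le := by
    rintro ((i | i) | i | i) <;> simp only [Sum.elim_inl, Sum.elim_inr] <;> omega
  par_top := rfl
  σ_top := by simp
  nonempty_odd := ⟨Sum.inl ⟨0, hl⟩⟩

theorem length_orderB (hk : 1 ≤ k) (hl : 1 ≤ l) : (orderB k l).length = k + l := by
  simp only [orderB, List.length_append, List.length_take, List.length_drop, List.length_ofFn]
  omega

theorem length_orderD : (orderD k l).length = k + l := by
  simp [orderD]

/-- The rank of a listed weight is `k + l` minus its position counted from zero. -/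
theorem enum_orderB (hk : 1 ≤ k) (hl : 1 ≤ l) : (ospDataB hk hl).Enum (orderB k l) where
  le i := by
    rw [length_orderB hk hl]
    revert i
    rintro ((_ | i | i) | i | i) <;>
      simp only [ospDataB, Sum.elim_inl, Sum.elim_inr, rankEpsB, rankDelB] <;>
      (try split_ifs) <;> omega
  surj m hm := by
    rw [length_orderB hk hl] at hm ⊢
    -- Positions beyond `k` carry `δ_2, …, δ_l`, positions 2 to `k` carry `ε_2, …, ε_k`, and
    -- positions 0 and 1 carry `ε_1` and `δ_1`.
    rcases Nat.lt_or_ge k m with h | h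
    · refine ⟨Sum.inr (Sum.inl ⟨m - k, by omega⟩), ?_⟩
      simp only [ospDataB, Sum.elim_inl, Sum.elim_inr, rankDelB]
      split_ifs <;> omega
    · rcases Nat.lt_or_ge 1 m with h1 | h1
      · refine ⟨Sum.inl (Sum.inr (Sum.inl ⟨m - 1, by omega⟩)), ?_⟩
        simp only [ospDataB, Sum.elim_inl, Sum.elim_inr, rankEpsB]
        split_ifs <;> omega
      · rcases Nat.eq_zero_or_pos m with rfl | h2
        · refine ⟨Sum.inl (Sum.inr (Sum.inl ⟨0, hk⟩)), ?_⟩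
          simp [ospDataB, rankEpsB]
        · refine ⟨Sum.inr (Sum.inl ⟨0, hl⟩), ?_⟩
          simp only [ospDataB, Sum.elim_inl, Sum.elim_inr, rankDelB]
          split_ifs <;> omega
  getElem? i := by
    rw [length_orderB hk hl]
    revert i
    rintro ((_ | i | i) | i | i) h <;>
      simp only [ospDataB, Sum.elim_inl, Sum.elim_inr, rankEpsB, rankDelB] at h ⊢
    · omega
    · simp only [orderB, List.getElem?_append, List.getElem?_take, List.getElem?_drop,
        List.length_append, List.length_take, List.length_drop, List.length_ofFn,
        List.getElem?_ofFn]
      split_ifs at h ⊢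
      all_goals try (exfalso; omega)
      all_goals exact congrArg (fun j => some (epsB l j)) (Fin.ext (by dsimp only; omega))
    · split_ifs at h <;> omega
    · simp only [orderB, List.getElem?_append, List.getElem?_take, List.getElem?_drop,
        List.length_append, List.length_take, List.length_drop, List.length_ofFn,
        List.getElem?_ofFn]
      split_ifs at h ⊢
      all_goals try (exfalso; omega)
      all_goals exact congrArg (fun j => some (delB k j)) (Fin.ext (by dsimp only; omega))
    · split_ifs at h <;> omega

theorem enum_orderD (hk : 1 ≤ k) (hl : 1 ≤ l) : (ospDataD hk hl).Enum (orderD k l) where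
  le i := by
    rw [length_orderD]
    revert i
    rintro ((i | i) | i | i) <;> simp only [ospDataD, Sum.elim_inl, Sum.elim_inr] <;> omega
  surj m hm := by
    rw [length_orderD] at hm ⊢
    rcases Nat.lt_or_ge m k with h | h
    · refine ⟨Sum.inl (Sum.inl ⟨m, h⟩), ?_⟩
      simp [ospDataD]
    · refine ⟨Sum.inr (Sum.inl ⟨m - k, by omega⟩), ?_⟩
      simp only [ospDataD, Sum.elim_inl, Sum.elim_inr]
      omega
  getElem? i := by
    rw [length_orderD]
    revert i
    rintro ((i | i) | i | i) h <;> simp only [ospDataD, Sum.elim_inl, Sum.elim_inr] at h ⊢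
    · rw [show k + l - ((k : ℤ) + l - i).toNat = i by omega, orderD,
        List.getElem?_append_left (by simp), List.getElem?_ofFn, dif_pos i.2]
      rfl
    · omega
    · rw [show k + l - ((l : ℤ) - i).toNat = k + i by omega, orderD,
        List.getElem?_append_right (by simp), List.getElem?_ofFn, List.length_ofFn,
        Nat.add_sub_cancel_left, dif_pos i.2]
      rfl
    · omega

theorem card_nonneg_rankB (hk : 1 ≤ k) (hl : 1 ≤ l) :
    Nat.card {i // 0 ≤ (ospDataB hk hl).r i} = k + l + 1 := by
  refine (OspData.card_nonneg_rank _ (m := 0) (n := k + l) fun x => ⟨?_, fun hx => ?_⟩).trans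
    (by omega)
  · rintro ⟨i, hi, rfl⟩
    exact ⟨hi, length_orderB hk hl ▸ (enum_orderB hk hl).le i⟩
  · rcases hx.1.eq_or_lt with h | h
    · exact ⟨Sum.inl (Sum.inl ()), le_rfl, h⟩
    · obtain ⟨i, hi⟩ := (enum_orderB hk hl).surj (k + l - x.toNat)
        (by rw [length_orderB hk hl]; omega)
      rw [length_orderB hk hl] at hi
      exact ⟨i, by omega, by omega⟩

theorem ospDataD_rank_ne_zero (hk : 1 ≤ k) (hl : 1 ≤ l) (i) : (ospDataD hk hl).r i ≠ 0 := by
  revert i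
  rintro ((i | i) | i | i) <;> simp only [ospDataD, Sum.elim_inl, Sum.elim_inr] <;> omega

theorem card_nonneg_rankD (hk : 1 ≤ k) (hl : 1 ≤ l) :
    Nat.card {i // 0 ≤ (ospDataD hk hl).r i} = k + l := by
  refine (OspData.card_nonneg_rank _ (m := 1) (n := k + l) fun x => ⟨?_, fun hx => ?_⟩).trans
    (by omega)
  · rintro ⟨i, hi, rfl⟩
    have := ospDataD_rank_ne_zero hk hl i
    exact ⟨by omega, length_orderD (k := k) (l := l) ▸ (enum_orderD hk hl).le i⟩
  · obtain ⟨i, hi⟩ := (enum_orderD hk hl).surj (k + l - x.toNat) (by rw [length_orderD]; omega)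
    rw [length_orderD] at hi
    exact ⟨i, by omega, by omega⟩

/-- The superdimension `1 + 2k - 2l` is odd. -/
theorem sdim_B_ne_zero : OspData.sdim (Unit ⊕ Fin k ⊕ Fin k) (Fin l ⊕ Fin l) ≠ 0 := by
  have h : OspData.sdim (Unit ⊕ Fin k ⊕ Fin k) (Fin l ⊕ Fin l) =
      ((1 + (k + k) - (l + l) : ℤ) : ℂ) := by
    simp [OspData.sdim, Fintype.sum_sum_type, par, sgn]
    ring
  rw [h, Int.cast_ne_zero]
  omega

theorem sdim_D_ne_zero (hkl : k ≠ l) : OspData.sdim (Fin k ⊕ Fin k) (Fin l ⊕ Fin l) ≠ 0 := by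
  have h : OspData.sdim (Fin k ⊕ Fin k) (Fin l ⊕ Fin l) = ((k + k - (l + l) : ℤ) : ℂ) := by
    simp [OspData.sdim, Fintype.sum_sum_type, par, sgn]
    ring
  rw [h, Int.cast_ne_zero]
  omega

theorem entry_gramB_zero (hk : 1 ≤ k) (hl : 1 ≤ l) :
    entry (gramB k l) (Sum.inl (Sum.inl ())) = 0 :=
  (ospDataB hk hl).entry_eq_zero (i := Sum.inl (Sum.inl ())) rfl

theorem entry_gramB_eps (hk : 1 ≤ k) (hl : 1 ≤ l) (i : Fin k) :
    entry (gramB k l) (Sum.inl (Sum.inr (Sum.inr i))) = -epsB l i :=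
  (ospDataB hk hl).entry_σ (Sum.inl (Sum.inr (Sum.inl i)))

theorem entry_gramB_del (hk : 1 ≤ k) (hl : 1 ≤ l) (g : Fin l) :
    entry (gramB k l) (Sum.inr (Sum.inr g)) = -delB k g :=
  (ospDataB hk hl).entry_σ (Sum.inr (Sum.inl g))

theorem entry_gramD_eps (hk : 1 ≤ k) (hl : 1 ≤ l) (i : Fin k) :
    entry (gramD k l) (Sum.inl (Sum.inr i)) = -epsD l i :=
  (ospDataD hk hl).entry_σ (Sum.inl (Sum.inl i))

theorem entry_gramD_del (hk : 1 ≤ k) (hl : 1 ≤ l) (g : Fin l) :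
    entry (gramD k l) (Sum.inr (Sum.inr g)) = -delD k g :=
  (ospDataD hk hl).entry_σ (Sum.inr (Sum.inl g))

end Instances

end

/-! ### The nonzero weights of the symmetric squares -/

section

section Weights
variable {k l : ℕ}

/-- All pairs of basis vectors of equal parity are examined. The weights `±2δ_g` are absent because
the square of an odd basis vector vanishes, while `±ε_i` come from the vector of weight zero. -/
theorem sqSet_gramB_zero (hk : 1 ≤ k) (hl : 1 ≤ l) : OspData.sqSet (gramB k l) 0 = evenB k l := by
  have e0 := entry_gramB_zero hk hl
  have e1 := entry_gramB_eps hk hl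
  have e2 := entry_gramB_del hk hl
  have e3 (i : Fin k) : entry (gramB k l) (Sum.inl (Sum.inr (Sum.inl i))) = epsB l i := rfl
  have e4 (g : Fin l) : entry (gramB k l) (Sum.inr (Sum.inl g)) = delB k g := rfl
  ext α
  constructor
  · rintro ⟨h0, ((_ | i | i) | i | i), ((_ | j | j) | j | j), h, hp, rfl⟩ <;>
      simp only [par, Sum.elim_inl, Sum.elim_inr, add_zero, zero_add, one_ne_zero] at hp <;>
      simp only [par, Sum.elim_inr, and_true, Sum.inr.injEq, Sum.inl.injEq] at h <;>
      simp only [e0, e1, e2, e3, e4, add_zero, zero_add] at h0 ⊢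
    · exact absurd rfl h0
    · exact Or.inr (Or.inl ⟨j, by simp [pm]⟩)
    · exact Or.inr (Or.inl ⟨j, by simp [pm]⟩)
    · exact Or.inr (Or.inl ⟨i, by simp [pm]⟩)
    · by_cases hij : i = j
      · exact Or.inr (Or.inr (Or.inr ⟨i, by simp [pm, hij, two_nsmul]⟩))
      · exact Or.inl ⟨i, j, hij, by simp [pmpm]⟩
    · by_cases hij : i = j
      · exact absurd (by rw [hij, add_neg_cancel]) h0
      · exact Or.inl ⟨i, j, hij, by simp [pmpm, sub_eq_add_neg]⟩
    · exact Or.inr (Or.inl ⟨i, by simp [pm]⟩)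
    · by_cases hij : i = j
      · exact absurd (by rw [hij, neg_add_cancel]) h0
      · exact Or.inl ⟨i, j, hij, by simp [pmpm]⟩
    · by_cases hij : i = j
      · exact Or.inr (Or.inr (Or.inr ⟨i, by simp [pm, hij, two_nsmul]⟩))
      · exact Or.inl ⟨i, j, hij, by simp [pmpm, sub_eq_add_neg]⟩
    · exact Or.inr (Or.inr (Or.inl ⟨i, j, h, by simp [pmpm]⟩))
    · by_cases hij : i = j
      · exact absurd (by rw [hij, add_neg_cancel]) h0
      · exact Or.inr (Or.inr (Or.inl ⟨i, j, hij, by simp [pmpm, sub_eq_add_neg]⟩))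
    · by_cases hij : i = j
      · exact absurd (by rw [hij, neg_add_cancel]) h0
      · exact Or.inr (Or.inr (Or.inl ⟨i, j, hij, by simp [pmpm]⟩))
    · exact Or.inr (Or.inr (Or.inl ⟨i, j, h, by simp [pmpm, sub_eq_add_neg]⟩))
  · rintro (⟨i, j, hij, hα⟩ | ⟨i, hα⟩ | ⟨g, h, hgh, hα⟩ | ⟨i, hα⟩)
    · exact (ospDataB hk hl).pmpm_subset_sqSet (by simpa using hij) (by simp [ospDataB]) rfl hα
    · exact (ospDataB hk hl).pm_subset_sqSet (z := Sum.inl (Sum.inl ())) rfl (by simp) rfl hα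
    · exact (ospDataB hk hl).pmpm_subset_sqSet (by simpa using hgh) (by simp [ospDataB]) rfl hα
    · exact (ospDataB hk hl).pm_two_subset_sqSet (by simp [ospDataB]) rfl hα

theorem sqSet_gramB_one (hk : 1 ≤ k) (hl : 1 ≤ l) : OspData.sqSet (gramB k l) 1 = oddB k l := by
  have e0 := entry_gramB_zero hk hl
  have e1 := entry_gramB_eps hk hl
  have e2 := entry_gramB_del hk hl
  have e3 (i : Fin k) : entry (gramB k l) (Sum.inl (Sum.inr (Sum.inl i))) = epsB l i := rfl
  have e4 (g : Fin l) : entry (gramB k l) (Sum.inr (Sum.inl g)) = delB k g := rfl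
  ext α
  constructor
  · rintro ⟨h0, ((_ | i | i) | i | i), ((_ | j | j) | j | j), h, hp, rfl⟩ <;>
      simp only [par, Sum.elim_inl, Sum.elim_inr, add_zero, zmod2_add_self, zero_ne_one] at hp <;>
      simp only [e0, e1, e2, e3, e4, add_zero, zero_add]
    · exact Or.inl ⟨j, by simp [pm]⟩
    · exact Or.inl ⟨j, by simp [pm]⟩
    · exact Or.inr ⟨i, j, by simp [pmpm]⟩
    · exact Or.inr ⟨i, j, by simp [pmpm, sub_eq_add_neg]⟩
    · exact Or.inr ⟨i, j, by simp [pmpm]⟩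
    · exact Or.inr ⟨i, j, by simp [pmpm, sub_eq_add_neg]⟩
    · exact Or.inl ⟨i, by simp [pm]⟩
    · exact Or.inr ⟨j, i, by simp [pmpm, add_comm]⟩
    · exact Or.inr ⟨j, i, by simp [pmpm, add_comm]⟩
    · exact Or.inl ⟨i, by simp [pm]⟩
    · exact Or.inr ⟨j, i, by simp [pmpm, add_comm, sub_eq_add_neg]⟩
    · exact Or.inr ⟨j, i, by simp [pmpm, add_comm, sub_eq_add_neg]⟩
  · rintro (⟨g, hα⟩ | ⟨i, g, hα⟩)
    · exact (ospDataB hk hl).pm_subset_sqSet (z := Sum.inl (Sum.inl ())) rfl (by simp) rfl hα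
    · exact (ospDataB hk hl).pmpm_subset_sqSet (by simp) (by simp [ospDataB]) rfl hα

theorem sqSet_gramD_zero (hk : 1 ≤ k) (hl : 1 ≤ l) : OspData.sqSet (gramD k l) 0 = evenD k l := by
  have e1 := entry_gramD_eps hk hl
  have e2 := entry_gramD_del hk hl
  have e3 (i : Fin k) : entry (gramD k l) (Sum.inl (Sum.inl i)) = epsD l i := rfl
  have e4 (g : Fin l) : entry (gramD k l) (Sum.inr (Sum.inl g)) = delD k g := rfl
  ext α
  constructor
  · rintro ⟨h0, ((i | i) | i | i), ((j | j) | j | j), h, hp, rfl⟩ <;>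
      simp only [par, Sum.elim_inl, Sum.elim_inr, add_zero, zero_add, one_ne_zero] at hp <;>
      simp only [par, Sum.elim_inr, and_true, Sum.inr.injEq, Sum.inl.injEq] at h <;>
      simp only [e1, e2, e3, e4] at h0 ⊢
    · by_cases hij : i = j
      · exact Or.inr (Or.inr ⟨i, by simp [pm, hij, two_nsmul]⟩)
      · exact Or.inl ⟨i, j, hij, by simp [pmpm]⟩
    · by_cases hij : i = j
      · exact absurd (by rw [hij, add_neg_cancel]) h0
      · exact Or.inl ⟨i, j, hij, by simp [pmpm, sub_eq_add_neg]⟩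
    · by_cases hij : i = j
      · exact absurd (by rw [hij, neg_add_cancel]) h0
      · exact Or.inl ⟨i, j, hij, by simp [pmpm]⟩
    · by_cases hij : i = j
      · exact Or.inr (Or.inr ⟨i, by simp [pm, hij, two_nsmul]⟩)
      · exact Or.inl ⟨i, j, hij, by simp [pmpm, sub_eq_add_neg]⟩
    · exact Or.inr (Or.inl ⟨i, j, h, by simp [pmpm]⟩)
    · by_cases hij : i = j
      · exact absurd (by rw [hij, add_neg_cancel]) h0
      · exact Or.inr (Or.inl ⟨i, j, hij, by simp [pmpm, sub_eq_add_neg]⟩)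
    · by_cases hij : i = j
      · exact absurd (by rw [hij, neg_add_cancel]) h0
      · exact Or.inr (Or.inl ⟨i, j, hij, by simp [pmpm]⟩)
    · exact Or.inr (Or.inl ⟨i, j, h, by simp [pmpm, sub_eq_add_neg]⟩)
  · rintro (⟨i, j, hij, hα⟩ | ⟨g, h, hgh, hα⟩ | ⟨i, hα⟩)
    · exact (ospDataD hk hl).pmpm_subset_sqSet (by simpa using hij) (by simp [ospDataD]) rfl hα
    · exact (ospDataD hk hl).pmpm_subset_sqSet (by simpa using hgh) (by simp [ospDataD]) rfl hα
    · exact (ospDataD hk hl).pm_two_subset_sqSet (by simp [ospDataD]) rfl hα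

theorem sqSet_gramD_one (hk : 1 ≤ k) (hl : 1 ≤ l) : OspData.sqSet (gramD k l) 1 = oddD k l := by
  have e1 := entry_gramD_eps hk hl
  have e2 := entry_gramD_del hk hl
  have e3 (i : Fin k) : entry (gramD k l) (Sum.inl (Sum.inl i)) = epsD l i := rfl
  have e4 (g : Fin l) : entry (gramD k l) (Sum.inr (Sum.inl g)) = delD k g := rfl
  ext α
  constructor
  · rintro ⟨h0, ((i | i) | i | i), ((j | j) | j | j), h, hp, rfl⟩ <;>
      simp only [par, Sum.elim_inl, Sum.elim_inr, add_zero, zmod2_add_self, zero_ne_one] at hp <;>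
      simp only [e1, e2, e3, e4]
    · exact ⟨i, j, by simp [pmpm]⟩
    · exact ⟨i, j, by simp [pmpm, sub_eq_add_neg]⟩
    · exact ⟨i, j, by simp [pmpm]⟩
    · exact ⟨i, j, by simp [pmpm, sub_eq_add_neg]⟩
    · exact ⟨j, i, by simp [pmpm, add_comm]⟩
    · exact ⟨j, i, by simp [pmpm, add_comm]⟩
    · exact ⟨j, i, by simp [pmpm, add_comm, sub_eq_add_neg]⟩
    · exact ⟨j, i, by simp [pmpm, add_comm, sub_eq_add_neg]⟩
  · rintro ⟨i, g, hα⟩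
    exact (ospDataD hk hl).pmpm_subset_sqSet (by simp) (by simp [ospDataD]) rfl hα

end Weights

end

end Super

end

/-! ### The theorem for `B(k|l)` and `D(k|l)` -/

theorem mainTheorem7 (k l : ℕ) (hk : 1 ≤ k) (hl : 1 ≤ l) :
    -- the case of `B(k|l)`; the standard module is `L_B(ε_1)`
    ((Super.standard (Super.gramB k l)).IsSimpleOfHighestWeight (Super.hB k l) (Super.simpleB k l)
        (Super.epsB l ⟨0, hk⟩) ∧
      -- the character of its symmetric square
      (Super.standard (Super.gramB k l)).symSquare.HasCharacter (Super.hB k l) ∧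
      (Super.standard (Super.gramB k l)).symSquare.ch (Super.hB k l) =
        Super.charSum (k + l + 1) (Super.evenB k l ∪ Super.oddB k l) ∧
      (Super.standard (Super.gramB k l)).symSquare.chPart (Super.hB k l) 0 =
        Super.charSum (k + l + 1) (Super.evenB k l) ∧
      (Super.standard (Super.gramB k l)).symSquare.chPart (Super.hB k l) 1 =
        Super.charSum 0 (Super.oddB k l) ∧
      -- the module `L_B(2ε_1)` exists
      (∃ (U : Type) (_ : AddCommGroup U) (_ : Module ℂ U) (τ : Super.Rep (Super.B k l) U),
        τ.IsSimpleOfHighestWeight (Super.hB k l) (Super.simpleB k l)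
          (2 • Super.epsB l ⟨0, hk⟩)) ∧
      ∀ (U : Type*) [AddCommGroup U] [Module ℂ U] (τ : Super.Rep (Super.B k l) U),
        τ.IsSimpleOfHighestWeight (Super.hB k l) (Super.simpleB k l)
          (2 • Super.epsB l ⟨0, hk⟩) →
        (Super.standard (Super.gramB k l)).symSquare.IsIso
          (τ.directSum (Super.Rep.triv (Super.B k l))) ∧
        -- modules with the same character
        ∀ (V : Type*) [AddCommGroup V] [Module ℂ V] (ρ : Super.Rep (Super.B k l) V),
          ρ.HasCharacter (Super.hB k l) →
          ρ.ch (Super.hB k l) =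
            (Super.standard (Super.gramB k l)).symSquare.ch (Super.hB k l) →
          (∃ s t : ZMod 2, ρ.IsIso
            ((τ.shift s).directSum ((Super.Rep.triv (Super.B k l)).shift t))) ∧
          ((∀ p, ρ.chPart (Super.hB k l) p =
              (Super.standard (Super.gramB k l)).symSquare.chPart (Super.hB k l) p) →
            ρ.IsIso (τ.directSum (Super.Rep.triv (Super.B k l))))) ∧
    -- the case of `D(k|l)`; the standard module is `L_D(ε_1)`
    ((Super.standard (Super.gramD k l)).IsSimpleOfHighestWeight (Super.hD k l) (Super.simpleD k l)
        (Super.epsD l ⟨0, hk⟩) ∧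
      (Super.standard (Super.gramD k l)).symSquare.HasCharacter (Super.hD k l) ∧
      (Super.standard (Super.gramD k l)).symSquare.ch (Super.hD k l) =
        Super.charSum (k + l) (Super.evenD k l ∪ Super.oddD k l) ∧
      (Super.standard (Super.gramD k l)).symSquare.chPart (Super.hD k l) 0 =
        Super.charSum (k + l) (Super.evenD k l) ∧
      (Super.standard (Super.gramD k l)).symSquare.chPart (Super.hD k l) 1 =
        Super.charSum 0 (Super.oddD k l) ∧
      (∃ (U : Type) (_ : AddCommGroup U) (_ : Module ℂ U) (τ : Super.Rep (Super.D k l) U),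
        τ.IsSimpleOfHighestWeight (Super.hD k l) (Super.simpleD k l)
          (2 • Super.epsD l ⟨0, hk⟩)) ∧
      (k ≠ l →
        ∀ (U : Type*) [AddCommGroup U] [Module ℂ U] (τ : Super.Rep (Super.D k l) U),
          τ.IsSimpleOfHighestWeight (Super.hD k l) (Super.simpleD k l)
            (2 • Super.epsD l ⟨0, hk⟩) →
          (Super.standard (Super.gramD k l)).symSquare.IsIso
            (τ.directSum (Super.Rep.triv (Super.D k l))) ∧
          ∀ (V : Type*) [AddCommGroup V] [Module ℂ V] (ρ : Super.Rep (Super.D k l) V),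
            ρ.HasCharacter (Super.hD k l) →
            ρ.ch (Super.hD k l) =
              (Super.standard (Super.gramD k l)).symSquare.ch (Super.hD k l) →
            (∃ s t : ZMod 2, ρ.IsIso
              ((τ.shift s).directSum ((Super.Rep.triv (Super.D k l)).shift t))) ∧
            ((∀ p, ρ.chPart (Super.hD k l) p =
                (Super.standard (Super.gramD k l)).symSquare.chPart (Super.hD k l) p) →
              ρ.IsIso (τ.directSum (Super.Rep.triv (Super.D k l)))))) := by
  have hB := (Super.enum_orderB hk hl).adapted_union_last
  have hD := (Super.enum_orderD hk hl).adapted_union_two_last (Super.ospDataD_rank_ne_zero hk hl)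
  have cB := Super.card_nonneg_rankB hk hl
  have cD := Super.card_nonneg_rankD hk hl
  -- The bound is attained for `k = l = 1`.
  have nB : 5 ≤ Fintype.card ((Unit ⊕ Fin k ⊕ Fin k) ⊕ (Fin l ⊕ Fin l)) := by
    simp only [Fintype.card_sum, Fintype.card_fin, Fintype.card_unit]
    omega
  refine ⟨⟨hB.standard, (Super.ospDataB hk hl).sq_isWeightBasis.hasCharacter, ?_, ?_, ?_,
    hB.exists_simple, fun U _ _ τ hτ => ⟨hB.symSquare_isIso nB Super.sdim_B_ne_zero hτ,
      fun V _ _ ρ hρ hch => hB.isIso_of_ch_eq nB Super.sdim_B_ne_zero hτ hρ hch⟩⟩,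
    ⟨hD.standard, (Super.ospDataD hk hl).sq_isWeightBasis.hasCharacter, ?_, ?_, ?_,
    hD.exists_simple, fun hkl U _ _ τ hτ => ?_⟩⟩
  · rw [← Super.sqSet_gramB_zero hk hl, ← Super.sqSet_gramB_one hk hl]
    exact (Super.ospDataB hk hl).sq_ch_eq cB
  · rw [← Super.sqSet_gramB_zero hk hl]
    exact (Super.ospDataB hk hl).sq_chPart_zero cB
  · rw [← Super.sqSet_gramB_one hk hl]
    exact (Super.ospDataB hk hl).sq_chPart_one
  · rw [← Super.sqSet_gramD_zero hk hl, ← Super.sqSet_gramD_one hk hl]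
    exact (Super.ospDataD hk hl).sq_ch_eq cD
  · rw [← Super.sqSet_gramD_zero hk hl]
    exact (Super.ospDataD hk hl).sq_chPart_zero cD
  · rw [← Super.sqSet_gramD_one hk hl]
    exact (Super.ospDataD hk hl).sq_chPart_one
  -- The condition `k ≠ l` is used twice: it excludes `k = l = 1`, where the dimension is only 4,
  -- and it makes the superdimension nonzero.
  · have nD : 5 ≤ Fintype.card ((Fin k ⊕ Fin k) ⊕ (Fin l ⊕ Fin l)) := by
      simp only [Fintype.card_sum, Fintype.card_fin]
      omega
    exact ⟨hD.symSquare_isIso nD (Super.sdim_D_ne_zero hkl) hτ,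
      fun V _ _ ρ hρ hch => hD.isIso_of_ch_eq nD (Super.sdim_D_ne_zero hkl) hτ hρ hch⟩
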